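/- **Spaces.** Let $d\in\mathbf N$ and write points of $\mathbf R^{3d}=\mathbf R^d\times\mathbf R^d\times\mathbf R^d$ as $X=(X_1,X_2,X_3)=(x,\xi,\eta)$. Let $\mathbf a=(a_1,a_2,a_3)$ and $\mathbf b=(b_1,b_2,b_3)$ be triples of positive real numbers. For $h>0$ let $\mathcal S_{\mathbf a;h}^{\mathbf b}(\mathbf R^{3d})$ be the Banach space of all $F\in C^\infty(\mathbf R^{3d})$ with $$\|F\|_h=\sup_{\alpha,\beta}\ \sup_{X\in\mathbf R^{3d}}\frac{|X^{\alpha}\partial^{\beta}F(X)|}{h^{|\alpha+\beta|}\prod_{j=1}^3\alpha_j!^{\,a_j}\,\beta_j!^{\,b_j}}<\infty ,$$ where the first supremum is over all multi-indices $\alpha=(\alpha_1,\alpha_2,\alpha_3)$, $\beta=(\beta_1,\beta_2,\beta_3)$ with $\alpha_j,\beta_j\in\mathbf N^d$. Put $$\mathcal S_{\mathbf a}^{\mathbf b}(\mathbf R^{3d})=\bigcup_{h>0}\mathcal S_{\mathbf a;h}^{\mathbf b}(\mathbf R^{3d}),\qquad \Sigma_{\mathbf a}^{\mathbf b}(\mathbf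 R^{3d})=\bigcap_{h>0}\mathcal S_{\mathbf a;h}^{\mathbf b}(\mathbf R^{3d}),$$ with the (locally convex) inductive limit topology and the projective limit topology, respectively; both are subspaces of the Schwartz space $\mathscr S(\mathbf R^{3d})$. Their spaces of continuous linear functionals $(\mathcal S_{\mathbf a}^{\mathbf b})'(\mathbf R^{3d})$ and $(\Sigma_{\mathbf a}^{\mathbf b})'(\mathbf R^{3d})$ carry the projective limit topology and the (locally convex) inductive limit topology, respectively, of the Banach duals $(\mathcal S_{\mathbf a;h}^{\mathbf b})'$, $h>0$. A function $f\in\mathscr S(\mathbf R^{3d})$ is identified with the functional $F\mapsto\int_{\mathbf R^{3d}}f(X)F(X)\,dX$ in these duals. **Operator.** For $r,t\in\mathbf R$ the continuous operator $e^{-i\langle rD_\xi+tD_\eta,D_x\rangle}$ on $\mathscr S(\mathbf R^{3d})$, where $D=-i\partial$, is the one that multiplies the Fourier transform $$\widehat f(\zeta,y,z)=(2\pi)^{-\frac{3d}2}\iiint f(x,\xi,\eta)\,e^{-i(\langle x,\zeta\rangle+\langle\xi,y\rangle+\langle\eta,z\rangle)}\,dx\,d\xi\,d\eta$$ by the function $e^{-i\langle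 ry+tz,\zeta\rangle}$. **Theorem.** Let $s_j,\sigma_j$, $j=1,2,3$, be real numbers such that $$s_j+\sigma_j\ge1\ (j=1,2,3),\qquad 0<s_2\le s_1,\quad 0<s_3\le s_1,\qquad 0<\sigma_1\le\sigma_2,\quad \sigma_1\le\sigma_3,$$ and let $r,t\in[0,1]$ be such that $r+t\le1$. Then the following is true. 1. The operator $e^{-i\langle rD_\xi+tD_\eta,D_x\rangle}$ on $\mathscr S(\mathbf R^{3d})$ restricts to a (linear) homeomorphism of $\mathcal S_{s_1,\sigma_2,\sigma_3}^{\sigma_1,s_2,s_3}(\mathbf R^{3d})$ onto itself, and it extends to a (linear) homeomorphism of $(\mathcal S_{s_1,\sigma_2,\sigma_3}^{\sigma_1,s_2,s_3})'(\mathbf R^{3d})$ onto itself; this extension is unique, even among all continuous maps of $(\mathcal S_{s_1,\sigma_2,\sigma_3}^{\sigma_1,s_2,s_3})'(\mathbf R^{3d})$ into itself that agree with the operator on $\mathscr S(\mathbf R^{3d})$. 2. If in addition $(s_j,\sigma_j)\ne(\frac12,\frac12)$ for $j=1,2,3$, then the same holds with $\Sigma_{s_1,\sigma_2,\sigma_3}^{\sigma_1,s_2,s_3}(\mathbf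 R^{3d})$ and $(\Sigma_{s_1,\sigma_2,\sigma_3}^{\sigma_1,s_2,s_3})'(\mathbf R^{3d})$ in place of $\mathcal S_{s_1,\sigma_2,\sigma_3}^{\sigma_1,s_2,s_3}(\mathbf R^{3d})$ and $(\mathcal S_{s_1,\sigma_2,\sigma_3}^{\sigma_1,s_2,s_3})'(\mathbf R^{3d})$. -/

import Mathlib

noncomputable section

namespace GelfandShilov

open scoped SchwartzMap ContDiff FourierTransform Nat

/-! ### Anisotropic Gelfand-Shilov spaces on `ℝ^{d+d+d}` -/

/-- The space `ℝ^{3d} = ℝ^d × ℝ^d × ℝ^d`; the coordinate `(j, i)` is the `i`-th coordinate of the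
`j`-th block, so that the three blocks of a point are the variables `(x, ξ, η)`. -/
abbrev Space (d : ℕ) : Type := EuclideanSpace ℝ (Fin 3 × Fin d)

/-- Multi-indices `α = (α_0, α_1, α_2) ∈ ℕ^{3d}`. -/
abbrev MultiIndex (d : ℕ) : Type := Fin 3 × Fin d → ℕ

variable {d : ℕ}

/-- The monomial `x^α`. -/
def monomial (α : MultiIndex d) (x : Space d) : ℝ := ∏ c, x c ^ α c

/-- The partial derivative `∂^β F`: the iterated derivative of order `|β|`, evaluated at a list of
basis vectors in which the basis vector of the coordinate `c` occurs `β c` times. -/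
def partialDeriv (β : MultiIndex d) (F : Space d → ℂ) (x : Space d) : ℂ :=
  iteratedFDeriv ℝ (Fintype.card (Σ c, Fin (β c))) F x
    (fun m => EuclideanSpace.single ((Fintype.equivFin (Σ c, Fin (β c))).symm m).1 (1 : ℝ))

/-- The number `h^{|α + β|} ∏_j (α_j !)^{s_j} (β_j !)^{σ_j}`, where `α_j` and `β_j` are the `j`-th
blocks of the multi-indices `α` and `β`. -/
def weight (s σ : Fin 3 → ℝ) (h : ℝ) (α β : MultiIndex d) : ℝ :=
  h ^ (∑ c, (α c + β c)) *
    ∏ j, (∏ i, ((α (j, i))! : ℝ)) ^ s j * (∏ i, ((β (j, i))! : ℝ)) ^ σ j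

/-- `|x^α ∂^β F(x)| / (h^{|α + β|} ∏_j (α_j !)^{s_j} (β_j !)^{σ_j})`. -/
def quotient (s σ : Fin 3 → ℝ) (h : ℝ) (F : Space d → ℂ)
    (p : MultiIndex d × MultiIndex d × Space d) : ℝ :=
  ‖(monomial p.1 p.2.2 : ℂ) * partialDeriv p.2.1 F p.2.2‖ / weight s σ h p.1 p.2.1

theorem weight_pos (s σ : Fin 3 → ℝ) {h : ℝ} (hh : 0 < h) (α β : MultiIndex d) :
    0 < weight s σ h α β := by
  unfold weight
  have : ∀ n : ℕ, (0 : ℝ) < (n ! : ℝ) := fun n => by exact_mod_cast n.factorial_pos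
  refine mul_pos (pow_pos hh _) (Finset.prod_pos fun j _ => mul_pos ?_ ?_) <;>
    exact Real.rpow_pos_of_pos (Finset.prod_pos fun i _ => this _) _

theorem weight_mono (s σ : Fin 3 → ℝ) {h h' : ℝ} (hh : 0 < h) (hle : h ≤ h')
    (α β : MultiIndex d) : weight s σ h α β ≤ weight s σ h' α β := by
  have h1 := weight_pos s σ (one_pos) α β
  unfold weight at *
  refine mul_le_mul_of_nonneg_right (pow_le_pow_left₀ hh.le hle _) ?_
  simpa using h1.le

theorem partialDeriv_add (β : MultiIndex d) {F G : Space d → ℂ} (hF : ContDiff ℝ ∞ F)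
    (hG : ContDiff ℝ ∞ G) (x : Space d) :
    partialDeriv β (F + G) x = partialDeriv β F x + partialDeriv β G x := by
  unfold partialDeriv
  rw [iteratedFDeriv_add_apply (hF.of_le (by exact_mod_cast le_top)).contDiffAt
    (hG.of_le (by exact_mod_cast le_top)).contDiffAt]
  rfl

theorem partialDeriv_smul (β : MultiIndex d) (a : ℂ) {F : Space d → ℂ} (hF : ContDiff ℝ ∞ F)
    (x : Space d) : partialDeriv β (a • F) x = a * partialDeriv β F x := by
  unfold partialDeriv
  rw [iteratedFDeriv_const_smul_apply (hF.of_le (by exact_mod_cast le_top)).contDiffAt]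
  rfl

theorem partialDeriv_zero_index (F : Space d → ℂ) (x : Space d) :
    partialDeriv 0 F x = F x := by
  unfold partialDeriv
  have key : ∀ (n : ℕ) (hn : n = 0) (v : Fin n → Space d), iteratedFDeriv ℝ n F x v = F x := by
    rintro n rfl v
    simp
  exact key _ (by simp) _

theorem monomial_zero_index (x : Space d) : monomial 0 x = 1 := by simp [monomial]

theorem weight_zero_index (s σ : Fin 3 → ℝ) (h : ℝ) : weight (d := d) s σ h 0 0 = 1 := by
  simp [weight]

theorem quotient_nonneg (s σ : Fin 3 → ℝ) {h : ℝ} (hh : 0 < h) (F : Space d → ℂ)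
    (p : MultiIndex d × MultiIndex d × Space d) : 0 ≤ quotient s σ h F p :=
  div_nonneg (norm_nonneg _) (weight_pos s σ hh _ _).le

theorem quotient_add_le (s σ : Fin 3 → ℝ) {h : ℝ} (hh : 0 < h) {F G : Space d → ℂ}
    (hF : ContDiff ℝ ∞ F) (hG : ContDiff ℝ ∞ G) (p : MultiIndex d × MultiIndex d × Space d) :
    quotient s σ h (F + G) p ≤ quotient s σ h F p + quotient s σ h G p := by
  unfold quotient
  rw [partialDeriv_add _ hF hG, mul_add, ← add_div]
  exact div_le_div_of_nonneg_right (norm_add_le _ _) (weight_pos s σ hh _ _).le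

theorem quotient_smul (s σ : Fin 3 → ℝ) (h : ℝ) (a : ℂ) {F : Space d → ℂ}
    (hF : ContDiff ℝ ∞ F) (p : MultiIndex d × MultiIndex d × Space d) :
    quotient s σ h (a • F) p = ‖a‖ * quotient s σ h F p := by
  unfold quotient
  rw [partialDeriv_smul _ _ hF, mul_left_comm, norm_mul a, mul_div_assoc]

theorem quotient_mono (s σ : Fin 3 → ℝ) {h h' : ℝ} (hh : 0 < h) (hle : h ≤ h')
    (F : Space d → ℂ) (p : MultiIndex d × MultiIndex d × Space d) :
    quotient s σ h' F p ≤ quotient s σ h F p :=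
  div_le_div_of_nonneg_left (norm_nonneg _) (weight_pos s σ hh _ _) (weight_mono s σ hh hle _ _)

/-- The range `(0, ∞)` of the parameter `h`. -/
abbrev Scale : Type := {h : ℝ // 0 < h}

/-- The space `𝒮_{s;h}^σ(ℝ^{3d})` of all `F ∈ C^∞(ℝ^{3d})` for which
`sup_{α, β, x} |x^α ∂^β F(x)| / (h^{|α + β|} ∏_j (α_j !)^{s_j} (β_j !)^{σ_j})` is finite,
as a subspace of the space of all functions. -/
def stepSubmodule (d : ℕ) (s σ : Fin 3 → ℝ) (h : Scale) : Submodule ℂ (Space d → ℂ) where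
  carrier := {F | ContDiff ℝ ∞ F ∧ BddAbove (Set.range (quotient s σ h F))}
  zero_mem' := by
    refine ⟨contDiff_const, 0, ?_⟩
    rintro _ ⟨p, rfl⟩
    have := quotient_smul (d := d) s σ h 0 (F := 0) contDiff_const p
    simp only [smul_zero, norm_zero, zero_mul] at this
    exact this.le
  add_mem' := by
    rintro F G ⟨hF, A, hA⟩ ⟨hG, B, hB⟩
    refine ⟨hF.add hG, A + B, ?_⟩
    rintro _ ⟨p, rfl⟩
    exact (quotient_add_le s σ h.2 hF hG p).trans (add_le_add (hA ⟨p, rfl⟩) (hB ⟨p, rfl⟩))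
  smul_mem' := by
    rintro a F ⟨hF, A, hA⟩
    refine ⟨contDiff_const.smul hF, ‖a‖ * A, ?_⟩
    rintro _ ⟨p, rfl⟩
    rw [quotient_smul s σ h a hF]
    exact mul_le_mul_of_nonneg_left (hA ⟨p, rfl⟩) (norm_nonneg _)

theorem stepSubmodule_mono (s σ : Fin 3 → ℝ) {h h' : Scale} (hle : h ≤ h') :
    stepSubmodule d s σ h ≤ stepSubmodule d s σ h' := by
  rintro F ⟨hF, A, hA⟩
  refine ⟨hF, A, ?_⟩
  rintro _ ⟨p, rfl⟩
  exact (quotient_mono s σ h.2 hle F p).trans (hA ⟨p, rfl⟩)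

/-- The union `𝒮_s^σ(ℝ^{3d}) = ⋃_{h > 0} 𝒮_{s;h}^σ(ℝ^{3d})`. -/
def roumieuSubmodule (d : ℕ) (s σ : Fin 3 → ℝ) : Submodule ℂ (Space d → ℂ) where
  carrier := {F | ∃ h : Scale, F ∈ stepSubmodule d s σ h}
  zero_mem' := ⟨⟨1, one_pos⟩, zero_mem _⟩
  add_mem' := by
    rintro F G ⟨h, hF⟩ ⟨h', hG⟩
    exact ⟨h ⊔ h', add_mem (stepSubmodule_mono s σ le_sup_left hF)
      (stepSubmodule_mono s σ le_sup_right hG)⟩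
  smul_mem' := by
    rintro a F ⟨h, hF⟩
    exact ⟨h, Submodule.smul_mem _ a hF⟩

/-- The intersection `Σ_s^σ(ℝ^{3d}) = ⋂_{h > 0} 𝒮_{s;h}^σ(ℝ^{3d})`. -/
def beurlingSubmodule (d : ℕ) (s σ : Fin 3 → ℝ) : Submodule ℂ (Space d → ℂ) :=
  ⨅ h : Scale, stepSubmodule d s σ h

/-! The three spaces as types of their own: none of them carries the topology of pointwise
convergence. -/

/-- The Banach space `𝒮_{s;h}^σ(ℝ^{3d})`. -/
def Step (d : ℕ) (s σ : Fin 3 → ℝ) (h : Scale) : Type := stepSubmodule d s σ h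

/-- The Gelfand-Shilov space `𝒮_s^σ(ℝ^{3d})` of Roumieu type. -/
def Roumieu (d : ℕ) (s σ : Fin 3 → ℝ) : Type := roumieuSubmodule d s σ

/-- The Gelfand-Shilov space `Σ_s^σ(ℝ^{3d})` of Beurling type. -/
def Beurling (d : ℕ) (s σ : Fin 3 → ℝ) : Type := beurlingSubmodule d s σ

variable {s σ : Fin 3 → ℝ} {h : Scale}

instance : AddCommGroup (Step d s σ h) := inferInstanceAs (AddCommGroup (stepSubmodule d s σ h))
instance : Module ℂ (Step d s σ h) := inferInstanceAs (Module ℂ (stepSubmodule d s σ h))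
instance : AddCommGroup (Roumieu d s σ) := inferInstanceAs (AddCommGroup (roumieuSubmodule d s σ))
instance : Module ℂ (Roumieu d s σ) := inferInstanceAs (Module ℂ (roumieuSubmodule d s σ))
instance : AddCommGroup (Beurling d s σ) :=
  inferInstanceAs (AddCommGroup (beurlingSubmodule d s σ))
instance : Module ℂ (Beurling d s σ) := inferInstanceAs (Module ℂ (beurlingSubmodule d s σ))

/-- The function underlying an element of `𝒮_{s;h}^σ`. -/
def Step.fn (F : Step d s σ h) : Space d → ℂ := F.1

/-- The function underlying an element of `𝒮_s^σ`. -/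
def Roumieu.fn (F : Roumieu d s σ) : Space d → ℂ := F.1

/-- The function underlying an element of `Σ_s^σ`. -/
def Beurling.fn (F : Beurling d s σ) : Space d → ℂ := F.1

/-! ### Topologies -/

/-- The norm `‖F‖ = sup_{α, β, x} |x^α ∂^β F(x)| / (h^{|α + β|} ∏_j (α_j !)^{s_j} (β_j !)^{σ_j})`. -/
instance : Norm (Step d s σ h) := ⟨fun F => ⨆ p, quotient s σ h F.fn p⟩

theorem Step.quotient_le (F : Step d s σ h) (p : MultiIndex d × MultiIndex d × Space d) :
    quotient s σ h F.fn p ≤ ‖F‖ :=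
  le_ciSup F.2.2 p

theorem Step.norm_fn_le (F : Step d s σ h) (x : Space d) : ‖F.fn x‖ ≤ ‖F‖ := by
  simpa [quotient, partialDeriv_zero_index, monomial_zero_index, weight_zero_index] using
    F.quotient_le (0, 0, x)

theorem Step.core : NormedSpace.Core ℂ (Step d s σ h) where
  norm_nonneg F := Real.iSup_nonneg fun p => quotient_nonneg s σ h.2 _ p
  norm_smul a F := by
    change (⨆ p, quotient s σ h (a • F.fn) p) = ‖a‖ * ⨆ p, quotient s σ h F.fn p
    rw [Real.mul_iSup_of_nonneg (norm_nonneg a)]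
    exact iSup_congr fun p => quotient_smul s σ h a F.2.1 p
  norm_triangle F G := ciSup_le fun p =>
    (quotient_add_le s σ h.2 F.2.1 G.2.1 p).trans (add_le_add (F.quotient_le p) (G.quotient_le p))
  norm_eq_zero_iff F := by
    constructor
    · intro hF
      apply Subtype.ext
      funext x
      have := F.norm_fn_le x
      rw [hF] at this
      exact norm_le_zero_iff.1 this
    · rintro rfl
      have : ∀ p, quotient s σ h (0 : Step d s σ h).fn p = 0 := fun p => by
        have := quotient_smul (d := d) s σ h 0 (F := 0) contDiff_const p
        simp only [smul_zero, norm_zero, zero_mul] at this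
        exact this
      change (⨆ p, quotient s σ h (0 : Step d s σ h).fn p) = 0
      simp only [this, ciSup_const]

instance : NormedAddCommGroup (Step d s σ h) := NormedAddCommGroup.ofCore Step.core
instance : NormedSpace ℂ (Step d s σ h) := NormedSpace.ofCore Step.core

section Inductive

variable {ι V W : Type*} {X : ι → Type*} [∀ i, TopologicalSpace (X i)]
  [AddCommGroup V] [Module ℂ V] [AddCommGroup W] [Module ℂ W]

/-- The locally convex inductive limit topology on a complex vector space `V` with respect to a
family of maps `f i : X i → V`: the finest locally convex vector space topology on `V` that makes
every `f i` continuous. -/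
@[reducible] def inductiveTopology (f : ∀ i, X i → V) : TopologicalSpace V :=
  sInf {t : TopologicalSpace V | (∀ i, @Continuous _ _ _ t (f i)) ∧ @IsTopologicalAddGroup V t _ ∧
    @ContinuousSMul ℂ V _ _ t ∧ @LocallyConvexSpace ℝ V _ _ _ _ t}

theorem continuous_inductiveTopology (f : ∀ i, X i → V) (i : ι) :
    @Continuous _ _ _ (inductiveTopology f) (f i) :=
  continuous_sInf_rng.2 fun _ ht => ht.1 i

theorem continuous_of_inductiveTopology (f : ∀ i, X i → V) [TopologicalSpace W]
    [IsTopologicalAddGroup W] [ContinuousSMul ℂ W] [LocallyConvexSpace ℝ W] (u : V →ₗ[ℂ] W)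
    (hu : ∀ i, Continuous fun x => u (f i x)) : @Continuous _ _ (inductiveTopology f) _ u := by
  rw [continuous_iff_le_induced]
  refine sInf_le ⟨fun i => continuous_induced_rng.2 (hu i), topologicalAddGroup_induced u,
    continuousSMul_induced u, ?_⟩
  exact LocallyConvexSpace.induced (u.restrictScalars ℝ)

end Inductive

/-- The inclusion `𝒮_{s;h}^σ → 𝒮_s^σ`. -/
def Step.toRoumieu : Step d s σ h →ₗ[ℂ] Roumieu d s σ :=
  Submodule.inclusion (p := stepSubmodule d s σ h) (p' := roumieuSubmodule d s σ)
    (fun _ hF => ⟨h, hF⟩)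

/-- The inclusion `Σ_s^σ → 𝒮_{s;h}^σ`. -/
def Beurling.toStep (h : Scale) : Beurling d s σ →ₗ[ℂ] Step d s σ h :=
  Submodule.inclusion (p := beurlingSubmodule d s σ) (p' := stepSubmodule d s σ h)
    (iInf_le (fun h : Scale => stepSubmodule d s σ h) h)

/-- `𝒮_s^σ` carries the inductive limit topology of the Banach spaces `𝒮_{s;h}^σ`, `h > 0`. -/
instance : TopologicalSpace (Roumieu d s σ) :=
  inductiveTopology fun h : Scale => ⇑(Step.toRoumieu : Step d s σ h →ₗ[ℂ] Roumieu d s σ)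

instance : IsTopologicalAddGroup (Roumieu d s σ) := topologicalAddGroup_sInf fun _ ht => ht.2.1
instance : ContinuousSMul ℂ (Roumieu d s σ) := continuousSMul_sInf fun _ ht => ht.2.2.1
instance : LocallyConvexSpace ℝ (Roumieu d s σ) := .sInf fun _ ht => ht.2.2.2

/-- `Σ_s^σ` carries the projective limit topology of the Banach spaces `𝒮_{s;h}^σ`, `h > 0`. -/
instance : TopologicalSpace (Beurling d s σ) :=
  ⨅ h : Scale, TopologicalSpace.induced (Beurling.toStep h : Beurling d s σ →ₗ[ℂ] Step d s σ h)
    inferInstance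

instance : IsTopologicalAddGroup (Beurling d s σ) :=
  topologicalAddGroup_iInf fun _ => topologicalAddGroup_induced _
instance : ContinuousSMul ℂ (Beurling d s σ) :=
  continuousSMul_iInf fun _ => continuousSMul_induced _
instance : LocallyConvexSpace ℝ (Beurling d s σ) :=
  .iInf fun h => .induced ((Beurling.toStep h).restrictScalars ℝ)

/-- The inclusion `𝒮_{s;h}^σ → 𝒮_s^σ` as a continuous linear map. -/
def Step.toRoumieuCLM : Step d s σ h →L[ℂ] Roumieu d s σ :=
  ⟨Step.toRoumieu, continuous_inductiveTopology
    (fun h : Scale => ⇑(Step.toRoumieu : Step d s σ h →ₗ[ℂ] Roumieu d s σ)) h⟩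

/-- The inclusion `Σ_s^σ → 𝒮_{s;h}^σ` as a continuous linear map. -/
def Beurling.toStepCLM (h : Scale) : Beurling d s σ →L[ℂ] Step d s σ h :=
  ⟨Beurling.toStep h, continuous_iInf_dom continuous_induced_dom⟩

/-! ### Dual spaces -/

/-- The Gelfand-Shilov distribution space `(𝒮_s^σ)'(ℝ^{3d})`: the continuous linear functionals on
`𝒮_s^σ(ℝ^{3d})`. -/
def RoumieuDual (d : ℕ) (s σ : Fin 3 → ℝ) : Type := Roumieu d s σ →L[ℂ] ℂ

/-- The Gelfand-Shilov distribution space `(Σ_s^σ)'(ℝ^{3d})`: the continuous linear functionals on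
`Σ_s^σ(ℝ^{3d})`. -/
def BeurlingDual (d : ℕ) (s σ : Fin 3 → ℝ) : Type := Beurling d s σ →L[ℂ] ℂ

instance : AddCommGroup (RoumieuDual d s σ) :=
  inferInstanceAs (AddCommGroup (Roumieu d s σ →L[ℂ] ℂ))
instance : Module ℂ (RoumieuDual d s σ) := inferInstanceAs (Module ℂ (Roumieu d s σ →L[ℂ] ℂ))
instance : AddCommGroup (BeurlingDual d s σ) :=
  inferInstanceAs (AddCommGroup (Beurling d s σ →L[ℂ] ℂ))
instance : Module ℂ (BeurlingDual d s σ) := inferInstanceAs (Module ℂ (Beurling d s σ →L[ℂ] ℂ))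

/-- The restriction map `(𝒮_s^σ)' → (𝒮_{s;h}^σ)'`. -/
def RoumieuDual.restrict (h : Scale) : RoumieuDual d s σ →ₗ[ℂ] StrongDual ℂ (Step d s σ h) where
  toFun u := ContinuousLinearMap.comp (show Roumieu d s σ →L[ℂ] ℂ from u) Step.toRoumieuCLM
  map_add' _ _ := rfl
  map_smul' _ _ := rfl

/-- The restriction map `(𝒮_{s;h}^σ)' → (Σ_s^σ)'`. -/
def BeurlingDual.ofStepDual (h : Scale) :
    StrongDual ℂ (Step d s σ h) →ₗ[ℂ] BeurlingDual d s σ where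
  toFun u := ContinuousLinearMap.comp u (Beurling.toStepCLM h)
  map_add' _ _ := rfl
  map_smul' _ _ := rfl

/-- `(𝒮_s^σ)'` carries the projective limit topology of the Banach duals `(𝒮_{s;h}^σ)'`. -/
instance : TopologicalSpace (RoumieuDual d s σ) :=
  ⨅ h : Scale, TopologicalSpace.induced
    (RoumieuDual.restrict h : RoumieuDual d s σ →ₗ[ℂ] StrongDual ℂ (Step d s σ h)) inferInstance

/-- `(Σ_s^σ)'` carries the inductive limit topology of the Banach duals `(𝒮_{s;h}^σ)'`. -/
instance : TopologicalSpace (BeurlingDual d s σ) :=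
  inductiveTopology fun h : Scale =>
    ⇑(BeurlingDual.ofStepDual h : StrongDual ℂ (Step d s σ h) →ₗ[ℂ] BeurlingDual d s σ)

instance : IsTopologicalAddGroup (RoumieuDual d s σ) :=
  topologicalAddGroup_iInf fun _ => topologicalAddGroup_induced _
instance : ContinuousSMul ℂ (RoumieuDual d s σ) :=
  continuousSMul_iInf fun _ => continuousSMul_induced _
instance : IsTopologicalAddGroup (BeurlingDual d s σ) :=
  topologicalAddGroup_sInf fun _ ht => ht.2.1
instance : ContinuousSMul ℂ (BeurlingDual d s σ) := continuousSMul_sInf fun _ ht => ht.2.2.1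


/-! ### The inclusion into the Schwartz space -/

theorem norm_multilinear_le {n : ℕ} (M : ContinuousMultilinearMap ℝ (fun _ : Fin n => Space d) ℂ) :
    ‖M‖ ≤ ∑ v : Fin n → Fin 3 × Fin d, ‖M fun m => EuclideanSpace.single (v m) (1 : ℝ)‖ := by
  refine M.opNorm_le_bound (Finset.sum_nonneg fun _ _ => norm_nonneg _) fun y => ?_
  have hy : y = fun m => ∑ c, y m c • EuclideanSpace.single c (1 : ℝ) := by
    funext m
    have := (EuclideanSpace.basisFun (Fin 3 × Fin d) ℝ).sum_repr (y m)
    simpa using this.symm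
  conv_lhs => rw [hy]
  rw [M.map_sum, Finset.sum_mul]
  refine (norm_sum_le _ _).trans (Finset.sum_le_sum fun v _ => ?_)
  rw [M.map_smul_univ, norm_smul, mul_comm]
  refine mul_le_mul_of_nonneg_left ?_ (norm_nonneg _)
  rw [norm_prod]
  exact Finset.prod_le_prod (fun _ _ => norm_nonneg _) fun m _ => PiLp.norm_apply_le (y m) (v m)

theorem iteratedFDeriv_comp_swap {E : Type*} [NormedAddCommGroup E] [NormedSpace ℝ E]
    {F : E → ℂ} (hF : ContDiff ℝ ∞ F) (n : ℕ) (i : Fin n) (m : Fin (n + 1) → E) (x : E) :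
    iteratedFDeriv ℝ (n + 1) F x (m ∘ Equiv.swap i.castSucc i.succ) =
      iteratedFDeriv ℝ (n + 1) F x m := by
  have hd : ∀ k x, DifferentiableAt ℝ (iteratedFDeriv ℝ k F) x := fun k x =>
    (hF.differentiable_iteratedFDeriv (m := k) (by exact_mod_cast WithTop.coe_lt_top k)) x
  have step : ∀ k x (m : Fin (k + 1) → E), iteratedFDeriv ℝ (k + 1) F x m =
      fderiv ℝ (fun y => iteratedFDeriv ℝ k F y (Fin.tail m)) x (m 0) :=
    fun k x m => (hd k x).iteratedFDeriv_succ_apply_left'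
  have hc : ∀ k, ContDiff ℝ 2 (iteratedFDeriv ℝ k F) := fun k =>
    (contDiff_infty.1 hF (2 + k)).iteratedFDeriv_right (by norm_cast)
  induction n generalizing x with
  | zero => exact i.elim0
  | succ n ih =>
    rw [step, step _ x m]
    refine Fin.cases ?_ (fun j => ?_) i
    · have h2 : ∀ (a b : E) (v : Fin n → E),
          fderiv ℝ (fun y => iteratedFDeriv ℝ (n + 1) F y (Fin.cons b v)) x a =
            fderiv ℝ (fderiv ℝ (iteratedFDeriv ℝ n F)) x a b v := by
        intro a b v
        have hdd : DifferentiableAt ℝ (fderiv ℝ (iteratedFDeriv ℝ n F)) x := by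
          exact ((hc n).fderiv_right (m := 1) (by norm_num)).differentiable (by simp) x
        have e : (fun y => iteratedFDeriv ℝ (n + 1) F y (Fin.cons b v)) =
            fun y => fderiv ℝ (iteratedFDeriv ℝ n F) y b v := by
          funext y
          rw [iteratedFDeriv_succ_apply_left]
          simp
        rw [e]
        have hb : DifferentiableAt ℝ (fun y => fderiv ℝ (iteratedFDeriv ℝ n F) y b) x :=
          hdd.clm_apply (differentiableAt_const b)
        rw [fderiv_continuousMultilinear_apply_const_apply hb,
          fderiv_clm_apply hdd (differentiableAt_const b)]
        simp
      have hs : IsSymmSndFDerivAt ℝ (iteratedFDeriv ℝ n F) x := by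
        exact (hc n).contDiffAt.isSymmSndFDerivAt (by simp)
      have t1 : Fin.tail (m ∘ Equiv.swap (Fin.castSucc 0) (Fin.succ 0)) =
          Fin.cons (m 0) (Fin.tail (Fin.tail m)) := by
        funext k
        refine Fin.cases ?_ (fun k => ?_) k
        · simp [Fin.tail]
        · simp only [Fin.tail, Function.comp, Fin.cons_succ]
          rw [Equiv.swap_apply_of_ne_of_ne]
          · simp [Fin.ext_iff]
          · simp [Fin.ext_iff]
      have t2 : Fin.tail m = Fin.cons (m 1) (Fin.tail (Fin.tail m)) := by
        rw [show m 1 = Fin.tail m 0 from rfl, Fin.cons_self_tail]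
      have t3 : (m ∘ Equiv.swap (Fin.castSucc 0) (Fin.succ 0)) 0 = m 1 := by
        simp
      rw [t1, t3, h2]
      conv_rhs => rw [t2]
      rw [h2, hs]
    · have t1 : Fin.tail (m ∘ Equiv.swap j.succ.castSucc j.succ.succ) =
          Fin.tail m ∘ Equiv.swap j.castSucc j.succ := by
        funext k
        simp only [Fin.tail, Function.comp]
        congr 1
        rw [Fin.castSucc_succ, ← (Fin.succ_injective _).map_swap]
      have t3 : (m ∘ Equiv.swap j.succ.castSucc j.succ.succ) 0 = m 0 := by
        simp only [Function.comp]
        rw [Equiv.swap_apply_of_ne_of_ne]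
        · simp [Fin.ext_iff]
        · simp [Fin.ext_iff]
      rw [t1, t3]
      simp only [ih]

theorem iteratedFDeriv_comp_perm {E : Type*} [NormedAddCommGroup E] [NormedSpace ℝ E]
    {F : E → ℂ} (hF : ContDiff ℝ ∞ F) {n : ℕ} (e : Equiv.Perm (Fin n)) (m : Fin n → E) (x : E) :
    iteratedFDeriv ℝ n F x (m ∘ e) = iteratedFDeriv ℝ n F x m := by
  cases n with
  | zero => exact congrArg _ (Subsingleton.elim _ _)
  | succ n =>
    have he : e ∈ Submonoid.closure
        (Set.range fun i : Fin n => Equiv.swap i.castSucc i.succ) := by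
      rw [Equiv.Perm.mclosure_swap_castSucc_succ]; trivial
    induction he using Submonoid.closure_induction generalizing m with
    | mem e he => obtain ⟨i, rfl⟩ := he; exact iteratedFDeriv_comp_swap hF n i m x
    | one => rfl
    | mul a b _ _ ha hb =>
      rw [Equiv.Perm.coe_mul, ← Function.comp_assoc, hb, ha]

/-- Iterated derivatives along an arbitrary list of basis vectors are partial derivatives. -/
theorem iteratedFDeriv_single_eq {F : Space d → ℂ} (hF : ContDiff ℝ ∞ F) {n : ℕ}
    (v : Fin n → Fin 3 × Fin d) (x : Space d) :
    iteratedFDeriv ℝ n F x (fun m => EuclideanSpace.single (v m) (1 : ℝ)) =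
      partialDeriv (fun c => Fintype.card {m // v m = c}) F x := by
  let e : Fin n ≃ Fin (Fintype.card (Σ c, Fin (Fintype.card {m // v m = c}))) :=
    ((Equiv.sigmaFiberEquiv v).symm.trans
      (Equiv.sigmaCongrRight fun c => Fintype.equivFin {m // v m = c})).trans (Fintype.equivFin _)
  have he : ∀ m, ((Fintype.equivFin (Σ c, Fin (Fintype.card {m // v m = c}))).symm (e m)).1
      = v m := fun m => by simp [e, Equiv.sigmaFiberEquiv]
  unfold partialDeriv
  have key : ∀ (N : ℕ) (e : Fin n ≃ Fin N) (w : Fin N → Space d),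
      iteratedFDeriv ℝ n F x (fun m => w (e m)) = iteratedFDeriv ℝ N F x w := by
    intro N e w
    obtain rfl : n = N := Fin.equiv_iff_eq.1 ⟨e⟩
    exact iteratedFDeriv_comp_perm hF e w x
  rw [← key _ e]
  simp only [he]

theorem exists_bound_of_mem {h : Scale} {F : Space d → ℂ} (hF : F ∈ stepSubmodule d s σ h)
    (k n : ℕ) : ∃ C : ℝ, ∀ x, ‖x‖ ^ k * ‖iteratedFDeriv ℝ n F x‖ ≤ C := by
  obtain ⟨hF, A, hA⟩ := hF
  have hbd : ∀ α β : MultiIndex d, ∃ C : ℝ, ∀ x, |monomial α x| * ‖partialDeriv β F x‖ ≤ C := by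
    intro α β
    refine ⟨A * weight s σ h α β, fun x => ?_⟩
    have h1 : quotient s σ h F (α, β, x) ≤ A := hA ⟨_, rfl⟩
    have := (div_le_iff₀ (weight_pos s σ h.2 α β)).1 h1
    rwa [norm_mul, Complex.norm_real, Real.norm_eq_abs] at this
  choose C hC using hbd
  set N : ℝ := (((Finset.univ : Finset (Fin 3 × Fin d)).card : ℝ) + 1) ^ k with hN
  have hN0 : 0 ≤ N := by positivity
  have hsum : ∀ x : Space d, ‖x‖ ≤ ∑ c, |x c| := fun x => by
    have hx := (EuclideanSpace.basisFun (Fin 3 × Fin d) ℝ).sum_repr x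
    calc ‖x‖ = ‖∑ c, x c • EuclideanSpace.single c (1 : ℝ)‖ := by
          conv_lhs => rw [← hx]
          simp
      _ ≤ ∑ c, ‖x c • EuclideanSpace.single c (1 : ℝ)‖ := norm_sum_le _ _
      _ = ∑ c, |x c| := by simp [norm_smul]
  have hsingle : ∀ (x : Space d) c, monomial (Pi.single c k) x = x c ^ k := fun x c => by
    unfold monomial
    rw [Finset.prod_eq_single c (fun c' _ hc' => by simp [hc']) (by simp)]
    simp
  have hpow : ∀ x : Space d,
      ‖x‖ ^ k ≤ |monomial 0 x| + N * ∑ c, |monomial (Pi.single c k) x| := fun x => by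
    simp only [hsingle, monomial_zero_index, abs_one, abs_pow]
    have hS : 0 ≤ N * ∑ c, |x c| ^ k := by positivity
    rcases Nat.eq_zero_or_pos k with rfl | hk
    · simpa using hS
    · obtain ⟨l, rfl⟩ : ∃ l, k = l + 1 := ⟨k - 1, by omega⟩
      refine (pow_le_pow_left₀ (norm_nonneg x) (hsum x) _).trans ?_
      refine (pow_sum_le_card_mul_sum_pow (fun c _ => abs_nonneg (x c)) l).trans ?_
      refine le_add_of_nonneg_of_le zero_le_one
        (mul_le_mul_of_nonneg_right ?_ (by positivity))
      rw [hN]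
      exact (pow_le_pow_left₀ (by positivity) (by linarith) l).trans
        (pow_le_pow_right₀ (by simp) (Nat.le_succ l))
  let β : (Fin n → Fin 3 × Fin d) → MultiIndex d := fun v c => Fintype.card {m // v m = c}
  refine ⟨∑ v, (C 0 (β v) + N * ∑ c, C (Pi.single c k) (β v)), fun x => ?_⟩
  have hD := norm_multilinear_le (iteratedFDeriv ℝ n F x)
  simp only [iteratedFDeriv_single_eq hF] at hD
  calc ‖x‖ ^ k * ‖iteratedFDeriv ℝ n F x‖
      ≤ (|monomial 0 x| + N * ∑ c, |monomial (Pi.single c k) x|) *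
          ∑ v, ‖partialDeriv (β v) F x‖ :=
        mul_le_mul (hpow x) hD (norm_nonneg _) (by positivity)
    _ = ∑ v, (|monomial 0 x| * ‖partialDeriv (β v) F x‖ +
          N * ∑ c, |monomial (Pi.single c k) x| * ‖partialDeriv (β v) F x‖) := by
        rw [Finset.mul_sum]
        refine Finset.sum_congr rfl fun v _ => ?_
        rw [add_mul, mul_assoc, Finset.sum_mul]
    _ ≤ _ := Finset.sum_le_sum fun v _ => add_le_add (hC _ _ x)
        (mul_le_mul_of_nonneg_left (Finset.sum_le_sum fun c _ => hC _ _ x) hN0)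

/-- Every element of `𝒮_s^σ` is a Schwartz function. -/
def Roumieu.toSchwartz (F : Roumieu d s σ) : 𝓢(Space d, ℂ) where
  toFun := F.fn
  smooth' := F.2.choose_spec.1
  decay' := exists_bound_of_mem F.2.choose_spec

theorem Beurling.mem_step (F : Beurling d s σ) (h : Scale) : F.fn ∈ stepSubmodule d s σ h :=
  (Beurling.toStep h F).2

/-- Every element of `Σ_s^σ` is a Schwartz function. -/
def Beurling.toSchwartz (F : Beurling d s σ) : 𝓢(Space d, ℂ) where
  toFun := F.fn
  smooth' := (F.mem_step ⟨1, one_pos⟩).1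
  decay' := exists_bound_of_mem (F.mem_step ⟨1, one_pos⟩)

/-! ### The embedding of the Schwartz space into the dual spaces -/

theorem integrable_mul_step (f : 𝓢(Space d, ℂ)) (F : Step d s σ h) :
    MeasureTheory.Integrable fun x => f x * F.fn x :=
  f.integrable.mul_bdd (c := ‖F‖) F.2.1.continuous.aestronglyMeasurable
    (.of_forall F.norm_fn_le)

/-- The continuous linear functional `F ↦ ∫ f(x) F(x) dx` on `𝒮_{s;h}^σ`. -/
def pairing (h : Scale) (f : 𝓢(Space d, ℂ)) : Step d s σ h →L[ℂ] ℂ :=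
  LinearMap.mkContinuous
    { toFun := fun F => ∫ x, f x * F.fn x
      map_add' := fun F G => by
        rw [← MeasureTheory.integral_add (integrable_mul_step f F) (integrable_mul_step f G)]
        exact MeasureTheory.integral_congr_ae (.of_forall fun x => mul_add (f x) (F.fn x) (G.fn x))
      map_smul' := fun a F => by
        rw [RingHom.id_apply, smul_eq_mul, ← MeasureTheory.integral_const_mul]
        exact MeasureTheory.integral_congr_ae
          (.of_forall fun x => mul_left_comm (f x) a (F.fn x)) }
    (∫ x, ‖f x‖) fun F => by
      refine (MeasureTheory.norm_integral_le_integral_norm _).trans ?_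
      rw [← MeasureTheory.integral_mul_const]
      refine MeasureTheory.integral_mono (integrable_mul_step f F).norm
        (f.integrable.norm.mul_const _) fun x => ?_
      simp only [norm_mul]
      exact mul_le_mul_of_nonneg_left (F.norm_fn_le x) (norm_nonneg _)

/-- The embedding `𝒮(ℝ^{3d}) → (𝒮_s^σ)'(ℝ^{3d})`, `f ↦ (F ↦ ∫ f(x) F(x) dx)`. -/
def toRoumieuDual (f : 𝓢(Space d, ℂ)) : RoumieuDual d s σ :=
  let u : Roumieu d s σ →ₗ[ℂ] ℂ :=
    { toFun := fun F => ∫ x, f x * F.fn x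
      map_add' := fun F G => by
        obtain ⟨h, hF⟩ := F.2
        obtain ⟨h', hG⟩ := G.2
        exact (pairing (h ⊔ h') f).map_add ⟨F.1, stepSubmodule_mono s σ le_sup_left hF⟩
          ⟨G.1, stepSubmodule_mono s σ le_sup_right hG⟩
      map_smul' := fun a F => by
        obtain ⟨h, hF⟩ := F.2
        exact (pairing h f).map_smul a ⟨F.1, hF⟩ }
  show Roumieu d s σ →L[ℂ] ℂ from
    ⟨u, continuous_of_inductiveTopology
      (fun h : Scale => ⇑(Step.toRoumieu : Step d s σ h →ₗ[ℂ] Roumieu d s σ)) u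
      fun h => (pairing h f).continuous⟩

/-- The embedding `𝒮(ℝ^{3d}) → (Σ_s^σ)'(ℝ^{3d})`, `f ↦ (F ↦ ∫ f(x) F(x) dx)`. -/
def toBeurlingDual (f : 𝓢(Space d, ℂ)) : BeurlingDual d s σ :=
  BeurlingDual.ofStepDual ⟨1, one_pos⟩ (pairing _ f)

theorem toRoumieuDual_apply (f : 𝓢(Space d, ℂ)) (F : Roumieu d s σ) :
    (show Roumieu d s σ →L[ℂ] ℂ from toRoumieuDual f) F = ∫ x, f x * F.toSchwartz x := rfl

theorem toBeurlingDual_apply (f : 𝓢(Space d, ℂ)) (F : Beurling d s σ) :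
    (show Beurling d s σ →L[ℂ] ℂ from toBeurlingDual f) F = ∫ x, f x * F.toSchwartz x := rfl

/-! ### The operator `e^{-i⟨r D_ξ + t D_η, D_x⟩}` -/

/-- The function `e^{-i⟨r y + t z, ζ⟩}` of the point `(ζ, y, z) ∈ ℝ^{3d}`. -/
def symbol (r t : ℝ) (w : Space d) : ℂ :=
  Complex.exp (-(Complex.I * ((∑ i, (r * w (1, i) + t * w (2, i)) * w (0, i) : ℝ) : ℂ)))

/-- The operator `e^{-i⟨r D_ξ + t D_η, D_x⟩}` on `𝒮(ℝ^{3d})`, where `D = -i∂`: it multiplies the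
Fourier transform `f̂(ζ, y, z) = (2π)^{-3d/2} ∫ e^{-i(⟨x, ζ⟩ + ⟨ξ, y⟩ + ⟨η, z⟩)} f(x, ξ, η)` by
`e^{-i⟨r y + t z, ζ⟩}`. The factor `2 π` accounts for the kernel `e^{-2 π i⟨X, w⟩}` of `𝓕`. -/
def expOp (r t : ℝ) : 𝓢(Space d, ℂ) →L[ℂ] 𝓢(Space d, ℂ) :=
  SchwartzMap.fourierMultiplierCLM ℂ fun w => symbol r t ((2 * Real.pi) • w)

theorem hasTemperateGrowth_expI :
    Function.HasTemperateGrowth fun x : ℝ => Complex.exp (-(Complex.I * (x : ℂ))) := by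
  have hs : ContDiff ℝ ∞ fun x : ℝ => Complex.exp (-(Complex.I * (x : ℂ))) :=
    ((contDiff_const.mul Complex.ofRealCLM.contDiff).neg).cexp
  have hi : ∀ n : ℕ, iteratedDeriv n (fun x : ℝ => Complex.exp (-(Complex.I * (x : ℂ)))) =
      fun x : ℝ => (-Complex.I) ^ n * Complex.exp (-(Complex.I * (x : ℂ))) := by
    intro n
    induction n with
    | zero => simp
    | succ n ih =>
      rw [iteratedDeriv_succ, ih]
      funext x
      have h1 : HasDerivAt (fun x : ℝ => -(Complex.I * (x : ℂ))) (-(Complex.I * 1)) x :=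
        (Complex.ofRealCLM.hasDerivAt.const_mul Complex.I).neg
      rw [(h1.cexp.const_mul ((-Complex.I) ^ n)).deriv]
      ring
  refine ⟨hs, fun n => ⟨0, 1, fun x => ?_⟩⟩
  rw [norm_iteratedFDeriv_eq_norm_iteratedDeriv, hi]
  simp [Complex.norm_exp]

/-- The multiplier is an admissible one. -/
theorem hasTemperateGrowth_symbol (r t : ℝ) :
    Function.HasTemperateGrowth fun w : Space d => symbol r t ((2 * Real.pi) • w) := by
  have hc : ∀ c, Function.HasTemperateGrowth fun w : Space d => w c := fun c =>
    (EuclideanSpace.proj c : Space d →L[ℝ] ℝ).hasTemperateGrowth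
  refine hasTemperateGrowth_expI.comp
    (f := fun w : Space d => ∑ i, (r * ((2 * Real.pi) • w) (1, i) + t * ((2 * Real.pi) • w) (2, i))
      * ((2 * Real.pi) • w) (0, i)) ?_
  simp only [PiLp.smul_apply, smul_eq_mul]
  fun_prop

theorem fourier_expOp (r t : ℝ) (f : 𝓢(Space d, ℂ)) (w : Space d) :
    𝓕 (expOp r t f) w = symbol r t ((2 * Real.pi) • w) * 𝓕 f w := by
  rw [expOp, SchwartzMap.fourierMultiplierCLM_apply, FourierTransform.fourier_fourierInv_eq,
    SchwartzMap.smulLeftCLM_apply_apply (hasTemperateGrowth_symbol r t), smul_eq_mul]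

end GelfandShilov

end

/-!
Write `T = e^{-i⟨r D_ξ + t D_η, D_x⟩}`, `s` for the exponents of decay and `σ` for those of
regularity. The operator `T` is inverted by the one with `-r, -t` in place of `r, t`, and it is
symmetric for the pairing `∫ f g` because the symbol is even. So everything follows from bounds of
`T` between the step spaces `𝒮_{s;h}^σ` and from the density of the Schwartz functions in the
duals.

**Bounds.** On the Fourier side one reads off that `T` commutes with the derivatives and that `x_c
T = T (x_c + ∑ ρ_{c,e} ∂_e)`, where `e` runs over the coordinates coupled to `c` by the symbol
(`expOp_derX`, `mulX_expOp`). After splitting `T` into its `r`- and `t`-part at most one `∂_e` is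
left for each `c`. Hence `x^α ∂^β T F` is `T` applied to a combination of at most `2^{|α|}` words
in the operators `x_c`, `∂_e`, acting on `∂^β F`. `T` costs a fixed number of further
multiplications and derivatives, by its continuity on the Schwartz space; normal ordering of a
word costs a geometric factor as long as `j!` is at most a geometric factor times `j!^{s_c + σ_c}`
(`ordBound_coordWeight_le`); and replacing a multiplication `x_c` by a derivative `∂_e` is
harmless because `σ_e ≤ s_c`. This is `boundedBetween_of_intertwine`. If `s_c + σ_c ≥ 1`, the
parameter `h` may be given and `h'` is found (Roumieu); if `s_c + σ_c > 1` for all `c`, then `h'`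
may be given and `h` is found (Beurling).

**The critical line.** If `s_c + σ_c = 1` for some coordinate `c`, the Beurling space is `{0}`
(`Beurling.eq_zero_of_critical`), so that the assertion is trivial there. Indeed, on each line
parallel to the `c`-axis an element `F` extends to an entire function `H` with `|H(x + i y)|
E(|x|) ≤ C E(|y| / 2)`, `E(r) = ∑ r^n / n!^{s_c}`. Therefore `H(z) H(i z)` tends to zero at
infinity, and Liouville's theorem gives `H = 0`.

**Density.** Every functional on `𝒮_{s;h}^σ` is a limit of Schwartz functions in the dual norm of
a smaller space `𝒮_{s;h₁}^σ`, `h₁ < h` (`comp_inclCLM_mem_closure`). Dirac measures are limits of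
bump functions, and their derivatives are limits of difference quotients. Moreover, an `F` in the
unit ball of `𝒮_{s;h₁}^σ` has small norm in `𝒮_{s;h}^σ` once `∂^β F(x) = 0` for finitely many
suitable `(β, x)`: high orders and large `x` are controlled by the stronger norm, the rest is a
compactness argument. By the Hahn-Banach theorem a functional on `𝒮_{s;h}^σ` is then, up to a
small error, a combination of the functionals `F ↦ ∂^β F(x)`. Since the duals of the
Gelfand-Shilov spaces are Hausdorff, density makes the extension of `T` unique, and its existence
follows by transposition of `T` on the test functions.
-/

noncomputable section

namespace GelfandShilov

open scoped SchwartzMap ContDiff FourierTransform Nat LineDeriv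

variable {d : ℕ}

section

/-! ### Calculus of the partial derivatives -/

/-- The unit vector of the coordinate `c`. -/
def basisVec (c : Fin 3 × Fin d) : Space d := EuclideanSpace.single c 1

theorem basisVec_apply (c c' : Fin 3 × Fin d) :
    (basisVec c : Space d) c' = if c' = c then 1 else 0 := by
  simp [basisVec]

theorem norm_basisVec (c : Fin 3 × Fin d) : ‖(basisVec c : Space d)‖ = 1 := by
  simp [basisVec]

theorem sum_smul_basisVec (x : Space d) : ∑ c, x c • basisVec c = x := by
  have := (EuclideanSpace.basisFun (Fin 3 × Fin d) ℝ).sum_repr x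
  simpa [basisVec] using this

theorem exists_partialDeriv_eq_iteratedFDeriv (β : MultiIndex d) (F : Space d → ℂ) :
    ∃ (n : ℕ) (v : Fin n → Fin 3 × Fin d),
      (∀ x, partialDeriv β F x = iteratedFDeriv ℝ n F x fun m => basisVec (v m)) ∧
      ∀ c, Fintype.card {m // v m = c} = β c := by
  refine ⟨_, fun m => ((Fintype.equivFin (Σ c, Fin (β c))).symm m).1, fun x => rfl, fun c => ?_⟩
  have e : {m // ((Fintype.equivFin (Σ c, Fin (β c))).symm m).1 = c} ≃ Fin (β c) :=
    ((Fintype.equivFin (Σ c, Fin (β c))).symm.subtypeEquiv fun a => Iff.rfl).trans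
      (Equiv.sigmaSubtype c)
  simpa using Fintype.card_congr e

theorem card_fiber_cons {n : ℕ} (c c' : Fin 3 × Fin d) (v : Fin n → Fin 3 × Fin d) :
    Fintype.card {m // (Fin.cons c v : Fin (n + 1) → Fin 3 × Fin d) m = c'} =
      Fintype.card {m // v m = c'} + (Pi.single c 1 : MultiIndex d) c' := by
  simp only [Fintype.card_subtype, Finset.card_filter, Fin.sum_univ_succ, Fin.cons_zero,
    Fin.cons_succ, Pi.single_apply]
  rw [add_comm]
  simp only [eq_comm]

theorem card_fiber_snoc {n : ℕ} (c c' : Fin 3 × Fin d) (v : Fin n → Fin 3 × Fin d) :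
    Fintype.card {m // (Fin.snoc v c : Fin (n + 1) → Fin 3 × Fin d) m = c'} =
      Fintype.card {m // v m = c'} + (Pi.single c 1 : MultiIndex d) c' := by
  simp only [Fintype.card_subtype, Finset.card_filter, Fin.sum_univ_castSucc, Fin.snoc_last,
    Fin.snoc_castSucc, Pi.single_apply]
  simp only [eq_comm]

theorem differentiable_iteratedFDeriv_of_contDiff {F : Space d → ℂ} (hF : ContDiff ℝ ∞ F) (n : ℕ) :
    Differentiable ℝ (iteratedFDeriv ℝ n F) :=
  hF.differentiable_iteratedFDeriv (m := n) (by exact_mod_cast WithTop.coe_lt_top n)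

/-- `∂^{β + e_c} F = ∂_c ∂^β F`. -/
theorem partialDeriv_add_single {F : Space d → ℂ} (hF : ContDiff ℝ ∞ F) (β : MultiIndex d)
    (c : Fin 3 × Fin d) (x : Space d) :
    partialDeriv (β + Pi.single c 1) F x = fderiv ℝ (partialDeriv β F) x (basisVec c) := by
  obtain ⟨n, v, hv, hcard⟩ := exists_partialDeriv_eq_iteratedFDeriv β F
  have h1 := iteratedFDeriv_single_eq hF (Fin.cons c v : Fin (n + 1) → Fin 3 × Fin d) x
  have h2 : (fun c' => Fintype.card {m // (Fin.cons c v : Fin (n + 1) → Fin 3 × Fin d) m = c'}) =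
      β + Pi.single c 1 := by
    funext c'
    rw [card_fiber_cons, hcard, Pi.add_apply]
  rw [h2] at h1
  rw [← h1, (differentiable_iteratedFDeriv_of_contDiff hF n x).iteratedFDeriv_succ_apply_left',
    show partialDeriv β F = _ from funext hv]
  rfl

/-- `∂^{β + e_c} F = ∂^β ∂_c F`, with the new derivative acting first. -/
theorem partialDeriv_add_single' {F : Space d → ℂ} (hF : ContDiff ℝ ∞ F) (β : MultiIndex d)
    (c : Fin 3 × Fin d) (x : Space d) :
    partialDeriv (β + Pi.single c 1) F x =
      partialDeriv β (fun y => fderiv ℝ F y (basisVec c)) x := by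
  obtain ⟨n, v, hv, hcard⟩ :=
    exists_partialDeriv_eq_iteratedFDeriv β (fun y => fderiv ℝ F y (basisVec c))
  have h1 := iteratedFDeriv_single_eq hF (Fin.snoc v c : Fin (n + 1) → Fin 3 × Fin d) x
  have h2 : (fun c' => Fintype.card {m // (Fin.snoc v c : Fin (n + 1) → Fin 3 × Fin d) m = c'}) =
      β + Pi.single c 1 := by
    funext c'
    rw [card_fiber_snoc, hcard, Pi.add_apply]
  rw [h2] at h1
  have hF' : ContDiff ℝ ∞ (fderiv ℝ F) := hF.fderiv_right (by simp)
  rw [← h1, iteratedFDeriv_succ_apply_right, hv,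
    iteratedFDeriv_clm_apply_const_apply (n := ∞) hF' (by exact_mod_cast le_top)]
  congr 1
  · congr 1
    funext m
    simp [Fin.init, basisVec]
  · simp [basisVec]

/-- Induction on a multi-index, raising one coordinate at a time. -/
theorem MultiIndex.induction {P : MultiIndex d → Prop} (h0 : P 0)
    (hs : ∀ β c, P β → P (β + Pi.single c 1)) (β : MultiIndex d) : P β := by
  induction hN : ∑ c, β c generalizing β with
  | zero =>
    have : β = 0 := funext fun c => by
      simpa using (Finset.sum_eq_zero_iff.1 hN) c (Finset.mem_univ c)
    exact this ▸ h0
  | succ N ih =>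
    obtain ⟨c, -, hc⟩ : ∃ c ∈ Finset.univ, β c ≠ 0 := by
      by_contra! h
      rw [Finset.sum_eq_zero h] at hN
      omega
    have hle : (Pi.single c 1 : MultiIndex d) ≤ β := fun c' => by
      rcases eq_or_ne c' c with rfl | h
      · simpa using Nat.one_le_iff_ne_zero.2 hc
      · simp [Pi.single_eq_of_ne h]
    have hβ : β - Pi.single c 1 + Pi.single c 1 = β := tsub_add_cancel_of_le hle
    rw [← hβ]
    refine hs _ c (ih _ ?_)
    have : ∑ c', (β - Pi.single c 1 + Pi.single c 1 : MultiIndex d) c' = N + 1 := by rw [hβ, hN]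
    simp only [Pi.add_apply, Finset.sum_add_distrib, Finset.sum_pi_single', Finset.mem_univ,
      if_true] at this
    omega

theorem contDiff_partialDeriv {F : Space d → ℂ} (hF : ContDiff ℝ ∞ F) (β : MultiIndex d) :
    ContDiff ℝ ∞ (partialDeriv β F) := by
  induction β using MultiIndex.induction with
  | h0 => rwa [show partialDeriv 0 F = F from funext (partialDeriv_zero_index F)]
  | hs β c ih =>
    rw [show partialDeriv (β + Pi.single c 1) F = _ from funext (partialDeriv_add_single hF β c)]
    exact (ih.fderiv_right (m := ∞) (by simp)).clm_apply contDiff_const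

/-- The Leibniz rule `∂^β (x_c F) = x_c ∂^β F + β_c ∂^{β - e_c} F`. The truncated subtraction of
multi-indices does no harm, since the last term vanishes if `β_c = 0`. -/
theorem partialDeriv_coord_mul {F : Space d → ℂ} (hF : ContDiff ℝ ∞ F) (β : MultiIndex d)
    (c : Fin 3 × Fin d) (x : Space d) :
    partialDeriv β (fun y => (y c : ℂ) * F y) x =
      x c * partialDeriv β F x + β c * partialDeriv (β - Pi.single c 1) F x := by
  have hc : ∀ y : Space d, HasFDerivAt (fun y : Space d => (y c : ℂ))
      (Complex.ofRealCLM.comp (EuclideanSpace.proj c)) y := fun y =>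
    (Complex.ofRealCLM.comp (EuclideanSpace.proj c : Space d →L[ℝ] ℝ)).hasFDerivAt
  have hcs : ContDiff ℝ ∞ fun y : Space d => (y c : ℂ) :=
    (Complex.ofRealCLM.comp (EuclideanSpace.proj c : Space d →L[ℝ] ℝ)).contDiff
  have hcF : ContDiff ℝ ∞ fun y : Space d => (y c : ℂ) * F y := hcs.mul hF
  induction β using MultiIndex.induction generalizing x with
  | h0 => simp [partialDeriv_zero_index]
  | hs β e ih =>
    rw [partialDeriv_add_single hcF, show partialDeriv β (fun y => (y c : ℂ) * F y) = _ from
      funext ih]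
    have h1 : ∀ γ, HasFDerivAt (partialDeriv γ F) (fderiv ℝ (partialDeriv γ F) x) x := fun γ =>
      ((contDiff_partialDeriv hF γ).differentiable (by simp) x).hasFDerivAt
    have h2 := (((hc x).mul (h1 β)).add ((h1 (β - Pi.single c 1)).const_mul (β c : ℂ))).fderiv
    have h3 : fderiv ℝ (fun x : Space d => (x c : ℂ) * partialDeriv β F x +
        β c * partialDeriv (β - Pi.single c 1) F x) x = _ := h2
    rw [h3]
    simp only [add_apply, smul_apply,
      ContinuousLinearMap.comp_apply, ← partialDeriv_add_single hF, smul_eq_mul,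
      Complex.ofRealCLM_apply]
    rcases eq_or_ne c e with rfl | hce
    · have h4 : β + Pi.single c 1 - Pi.single c 1 = β := add_tsub_cancel_right _ _
      rw [h4]
      rcases Nat.eq_zero_or_pos (β c) with h0 | h0
      · simp [h0, basisVec_apply]
      · have h5 : β - Pi.single c 1 + Pi.single c 1 = β := tsub_add_cancel_of_le fun c' => by
          rcases eq_or_ne c' c with rfl | h
          · simpa using Nat.succ_le_of_lt h0
          · simp [Pi.single_eq_of_ne h]
        rw [h5]
        simp [basisVec_apply]
        ring
    · have h4 : β + Pi.single e 1 - Pi.single c 1 = β - Pi.single c 1 + Pi.single e 1 := by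
        funext c'
        rcases eq_or_ne c' c with rfl | h
        · simp [Pi.single_eq_of_ne hce]
        · simp [Pi.single_eq_of_ne h]
      rw [h4]
      simp [hce, basisVec_apply]

theorem monomial_add_single (α : MultiIndex d) (c : Fin 3 × Fin d) (x : Space d) :
    monomial (α + Pi.single c 1) x = monomial α x * x c := by
  unfold monomial
  simp only [Pi.add_apply, pow_add, Finset.prod_mul_distrib]
  congr 1
  rw [Finset.prod_eq_single c (fun c' _ h => by simp [Pi.single_eq_of_ne h]) (by simp)]
  simp

theorem monomial_single (c : Fin 3 × Fin d) (k : ℕ) (x : Space d) :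
    monomial (Pi.single c k) x = x c ^ k := by
  unfold monomial
  rw [Finset.prod_eq_single c (fun c' _ hc' => by simp [hc']) (by simp)]
  simp

/-! ### Seminorms of the Schwartz space through monomials and partial derivatives -/

theorem sum_card_fiber {n : ℕ} (v : Fin n → Fin 3 × Fin d) :
    ∑ c, Fintype.card {m // v m = c} = n := by
  have := Fintype.card_congr (Equiv.sigmaFiberEquiv v)
  simpa using this

/-- The seminorms that define the Schwartz space are bounded by suprema of `|x^α ∂^β F|`. -/
theorem exists_bound_iteratedFDeriv (d k n : ℕ) : ∃ C : ℝ, 0 ≤ C ∧ ∀ (F : Space d → ℂ),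
    ContDiff ℝ ∞ F → ∀ M : ℝ,
    (∀ α β : MultiIndex d, ∑ c, α c ≤ k → ∑ c, β c ≤ n → ∀ x,
      ‖(monomial α x : ℂ) * partialDeriv β F x‖ ≤ M) →
    ∀ x, ‖x‖ ^ k * ‖iteratedFDeriv ℝ n F x‖ ≤ C * M := by
  set N : ℝ := (((Finset.univ : Finset (Fin 3 × Fin d)).card : ℝ) + 1) ^ k with hN
  have hN0 : 0 ≤ N := by positivity
  have hsum : ∀ x : Space d, ‖x‖ ≤ ∑ c, |x c| := fun x => by
    conv_lhs => rw [← sum_smul_basisVec x]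
    refine (norm_sum_le _ _).trans_eq ?_
    simp [norm_smul, norm_basisVec]
  have hpow : ∀ x : Space d,
      ‖x‖ ^ k ≤ |monomial 0 x| + N * ∑ c, |monomial (Pi.single c k) x| := fun x => by
    simp only [monomial_single, monomial_zero_index, abs_one, abs_pow]
    have hS : 0 ≤ N * ∑ c, |x c| ^ k := by positivity
    rcases Nat.eq_zero_or_pos k with rfl | hk
    · simpa using hS
    · obtain ⟨l, rfl⟩ : ∃ l, k = l + 1 := ⟨k - 1, by omega⟩
      refine (pow_le_pow_left₀ (norm_nonneg x) (hsum x) _).trans ?_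
      refine (pow_sum_le_card_mul_sum_pow (fun c _ => abs_nonneg (x c)) l).trans ?_
      refine le_add_of_nonneg_of_le zero_le_one
        (mul_le_mul_of_nonneg_right ?_ (by positivity))
      rw [hN]
      exact (pow_le_pow_left₀ (by positivity) (by linarith) l).trans
        (pow_le_pow_right₀ (by simp) (Nat.le_succ l))
  refine ⟨∑ _v : Fin n → Fin 3 × Fin d, (1 + N * ∑ _c : Fin 3 × Fin d, 1), by positivity,
    fun F hF M hM x => ?_⟩
  let β : (Fin n → Fin 3 × Fin d) → MultiIndex d := fun v c => Fintype.card {m // v m = c}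
  have hβ : ∀ v, ∑ c, β v c ≤ n := fun v => (sum_card_fiber v).le
  have hM' : ∀ α v, ∑ c, α c ≤ k → |monomial α x| * ‖partialDeriv (β v) F x‖ ≤ M := by
    intro α v hα
    simpa using hM α (β v) hα (hβ v) x
  have hD := norm_multilinear_le (iteratedFDeriv ℝ n F x)
  simp only [iteratedFDeriv_single_eq hF] at hD
  calc ‖x‖ ^ k * ‖iteratedFDeriv ℝ n F x‖
      ≤ (|monomial 0 x| + N * ∑ c, |monomial (Pi.single c k) x|) *
          ∑ v, ‖partialDeriv (β v) F x‖ :=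
        mul_le_mul (hpow x) hD (norm_nonneg _) (by positivity)
    _ = ∑ v, (|monomial 0 x| * ‖partialDeriv (β v) F x‖ +
          N * ∑ c, |monomial (Pi.single c k) x| * ‖partialDeriv (β v) F x‖) := by
        rw [Finset.mul_sum]
        refine Finset.sum_congr rfl fun v _ => ?_
        rw [add_mul, mul_assoc, Finset.sum_mul]
    _ ≤ ∑ _v : Fin n → Fin 3 × Fin d, (M + N * ∑ _c : Fin 3 × Fin d, M) :=
        Finset.sum_le_sum fun v _ => add_le_add (hM' _ _ (by simp))
          (mul_le_mul_of_nonneg_left (Finset.sum_le_sum fun c _ => hM' _ _ (by simp)) hN0)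
    _ = _ := by
        simp only [Finset.sum_const, nsmul_eq_mul, mul_one]
        ring

/-- A continuous operator on the Schwartz space is bounded, in the supremum norm, by finitely many
of the suprema of `|x^α ∂^β F|`. -/
theorem exists_degree_bound (T : 𝓢(Space d, ℂ) →L[ℂ] 𝓢(Space d, ℂ)) :
    ∃ (L : ℕ) (C : ℝ), 0 ≤ C ∧ ∀ (G : 𝓢(Space d, ℂ)) (M : ℝ),
      (∀ α β : MultiIndex d, ∑ c, α c ≤ L → ∑ c, β c ≤ L → ∀ x,
        ‖(monomial α x : ℂ) * partialDeriv β G x‖ ≤ M) →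
      ∀ x, ‖T G x‖ ≤ C * M := by
  let q : Seminorm ℂ 𝓢(Space d, ℂ) := (SchwartzMap.seminorm ℂ 0 0).comp T.toLinearMap
  have hq : Continuous q :=
    ((schwartz_withSeminorms ℂ (Space d) ℂ).continuous_seminorm (0, 0)).comp T.continuous
  obtain ⟨S, C, -, hS⟩ := Seminorm.bound_of_continuous (schwartz_withSeminorms ℂ (Space d) ℂ) q hq
  choose K hK0 hK using exists_bound_iteratedFDeriv d
  refine ⟨S.sup Prod.fst ⊔ S.sup Prod.snd, C * ∑ p ∈ S, K p.1 p.2,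
    mul_nonneg C.2 (Finset.sum_nonneg fun p _ => hK0 _ _), fun G M hM x => ?_⟩
  have hM0 : 0 ≤ M := (norm_nonneg _).trans (hM 0 0 (by simp) (by simp) 0)
  have h1 : ‖T G x‖ ≤ q G := SchwartzMap.norm_le_seminorm ℂ (T G) x
  refine (h1.trans (hS G)).trans ?_
  rw [mul_assoc]
  refine mul_le_mul_of_nonneg_left ?_ C.2
  refine Seminorm.finset_sup_apply_le
    (mul_nonneg (Finset.sum_nonneg fun p _ => hK0 _ _) hM0) fun p hp => ?_
  refine SchwartzMap.seminorm_le_bound ℂ p.1 p.2 G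
    (mul_nonneg (Finset.sum_nonneg fun p _ => hK0 _ _) hM0) fun y => ?_
  refine (hK p.1 p.2 G (G.smooth ⊤) M (fun α β hα hβ z => hM α β ?_ ?_ z) y).trans ?_
  · exact hα.trans ((Finset.le_sup (f := Prod.fst) hp).trans le_sup_left)
  · exact hβ.trans ((Finset.le_sup (f := Prod.snd) hp).trans le_sup_right)
  · exact mul_le_mul_of_nonneg_right
      (Finset.single_le_sum (f := fun p => K p.1 p.2) (fun p _ => hK0 _ _) hp) hM0

/-! ### Multiplication and differentiation on the Schwartz space, and the operator -/

theorem hasTemperateGrowth_coord (c : Fin 3 × Fin d) :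
    Function.HasTemperateGrowth fun x : Space d => (x c : ℂ) :=
  (Complex.ofRealCLM.comp (EuclideanSpace.proj c : Space d →L[ℝ] ℝ)).hasTemperateGrowth

/-- Multiplication by the coordinate `x_c`. -/
def mulX (c : Fin 3 × Fin d) : 𝓢(Space d, ℂ) →L[ℂ] 𝓢(Space d, ℂ) :=
  SchwartzMap.smulLeftCLM ℂ fun x : Space d => (x c : ℂ)

/-- The partial derivative `∂_c`. -/
def derX (c : Fin 3 × Fin d) : 𝓢(Space d, ℂ) →L[ℂ] 𝓢(Space d, ℂ) :=
  LineDeriv.lineDerivOpCLM ℂ 𝓢(Space d, ℂ) (basisVec c)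

theorem mulX_apply (c : Fin 3 × Fin d) (f : 𝓢(Space d, ℂ)) (x : Space d) :
    mulX c f x = x c * f x := by
  rw [mulX, SchwartzMap.smulLeftCLM_apply_apply (hasTemperateGrowth_coord c), smul_eq_mul]

theorem derX_apply (c : Fin 3 × Fin d) (f : 𝓢(Space d, ℂ)) (x : Space d) :
    derX c f x = fderiv ℝ f x (basisVec c) := by
  rw [derX, LineDeriv.lineDerivOpCLM_apply, SchwartzMap.lineDerivOp_apply_eq_fderiv]

theorem partialDeriv_derX (β : MultiIndex d) (c : Fin 3 × Fin d) (f : 𝓢(Space d, ℂ))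
    (x : Space d) : partialDeriv β (derX c f) x = partialDeriv (β + Pi.single c 1) f x := by
  rw [partialDeriv_add_single' (f.smooth ⊤)]
  congr 1

theorem partialDeriv_mulX (β : MultiIndex d) (c : Fin 3 × Fin d) (f : 𝓢(Space d, ℂ))
    (x : Space d) : partialDeriv β (mulX c f) x =
      x c * partialDeriv β f x + β c * partialDeriv (β - Pi.single c 1) f x := by
  rw [← partialDeriv_coord_mul (f.smooth ⊤)]
  congr 1
  exact funext (mulX_apply c f)

theorem fourier_derX (c : Fin 3 × Fin d) (f : 𝓢(Space d, ℂ)) (w : Space d) :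
    𝓕 (derX c f) w = 2 * Real.pi * Complex.I * (w c * 𝓕 f w) := by
  have h : (fun x : Space d => inner ℝ x (basisVec c)).HasTemperateGrowth :=
    ((innerSL ℝ).flip (basisVec c)).hasTemperateGrowth
  rw [derX, LineDeriv.lineDerivOpCLM_apply, SchwartzMap.fourier_lineDerivOp_eq]
  simp only [smul_apply, SchwartzMap.smulLeftCLM_apply_apply h]
  simp [basisVec, EuclideanSpace.inner_single_right]

theorem derX_fourier (c : Fin 3 × Fin d) (f : 𝓢(Space d, ℂ)) :
    derX c (𝓕 f) = (-(2 * Real.pi * Complex.I)) • 𝓕 (mulX c f) := by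
  have h : (fun x : Space d => inner ℝ x (basisVec c)).HasTemperateGrowth :=
    ((innerSL ℝ).flip (basisVec c)).hasTemperateGrowth
  rw [derX, LineDeriv.lineDerivOpCLM_apply, SchwartzMap.lineDerivOp_fourier_eq,
    ← FourierTransform.fourier_smul]
  congr 2
  ext x
  rw [mulX_apply, SchwartzMap.smulLeftCLM_apply_apply h]
  simp [basisVec, EuclideanSpace.inner_single_right]

theorem fourier_injective {f g : 𝓢(Space d, ℂ)} (h : 𝓕 f = 𝓕 g) : f = g := by
  have := congrArg (fun u : 𝓢(Space d, ℂ) => (𝓕⁻ u : 𝓢(Space d, ℂ))) h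
  simpa only [FourierTransform.fourierInv_fourier_eq] using this

theorem expOp_derX (r t : ℝ) (c : Fin 3 × Fin d) (f : 𝓢(Space d, ℂ)) :
    expOp r t (derX c f) = derX c (expOp r t f) := by
  apply fourier_injective
  ext w
  rw [fourier_expOp, fourier_derX, fourier_derX, fourier_expOp]
  ring

theorem expOp_expOp (r t r' t' : ℝ) (f : 𝓢(Space d, ℂ)) :
    expOp r t (expOp r' t' f) = expOp (r + r') (t + t') f := by
  apply fourier_injective
  ext w
  rw [fourier_expOp, fourier_expOp, fourier_expOp, ← mul_assoc]
  congr 1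
  rw [symbol, symbol, symbol, ← Complex.exp_add]
  congr 1
  rw [← neg_add, ← mul_add, ← Complex.ofReal_add, ← Finset.sum_add_distrib]
  congr 4
  funext i
  ring

theorem expOp_zero_zero (f : 𝓢(Space d, ℂ)) : expOp 0 0 f = f := by
  apply fourier_injective
  ext w
  rw [fourier_expOp]
  simp [symbol]

theorem symbol_neg (r t : ℝ) (w : Space d) : symbol r t (-w) = symbol r t w := by
  unfold symbol
  congr 5
  funext i
  simp only [PiLp.neg_apply]
  ring

/-- The operator is symmetric for the bilinear pairing `∫ f g`, because its symbol is even. -/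
theorem integral_expOp_mul (r t : ℝ) (f g : 𝓢(Space d, ℂ)) :
    ∫ x, expOp r t f x * g x = ∫ x, f x * expOp r t g x := by
  have hinv : ∀ (u : 𝓢(Space d, ℂ)) (w : Space d), 𝓕⁻ u w = 𝓕 u (-w) := fun u w => by
    rw [SchwartzMap.fourierInv_coe, SchwartzMap.fourier_coe, Real.fourierInv_eq_fourier_neg]
  have h1 : ∀ u v : 𝓢(Space d, ℂ), ∫ x, u x * v x = ∫ w, 𝓕 u w * 𝓕⁻ v w := fun u v => by
    rw [SchwartzMap.integral_fourier_mul_eq, FourierTransform.fourier_fourierInv_eq]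
  rw [h1, h1 f, ← MeasureTheory.integral_neg_eq_self]
  rw [← MeasureTheory.integral_neg_eq_self]
  refine MeasureTheory.integral_congr_ae (.of_forall fun w => ?_)
  simp only [hinv, neg_neg, fourier_expOp, smul_neg, symbol_neg]
  ring

/-- The product rule for `∂_c` applied to the symbol times `𝓕 f`. The factor `(2 π)^2` appears
because the quadratic form in the exponent is evaluated at `2 π w`. -/
theorem derX_fourier_expOp (r t : ℝ) (f : 𝓢(Space d, ℂ)) (c : Fin 3 × Fin d)
    (w : Space d) : derX c (𝓕 (expOp r t f)) w =
      symbol r t ((2 * Real.pi) • w) * derX c (𝓕 f) w -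
        Complex.I * (2 * Real.pi) ^ 2 * (if c.1 = 0 then r * w (1, c.2) + t * w (2, c.2)
          else if c.1 = 1 then r * w (0, c.2) else t * w (0, c.2)) *
        (symbol r t ((2 * Real.pi) • w) * 𝓕 f w) := by
  have hp : ∀ c, HasFDerivAt (fun w : Space d => w c) (EuclideanSpace.proj c : Space d →L[ℝ] ℝ) w :=
    fun c => (EuclideanSpace.proj c : Space d →L[ℝ] ℝ).hasFDerivAt
  let Q : Space d → ℝ := fun w => ∑ i, (r * w (1, i) + t * w (2, i)) * w (0, i)
  let Q' : Space d →L[ℝ] ℝ := ∑ i : Fin d, ((r * w (1, i) + t * w (2, i)) •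
    (EuclideanSpace.proj (0, i) : Space d →L[ℝ] ℝ) + w (0, i) •
      (r • (EuclideanSpace.proj (1, i) : Space d →L[ℝ] ℝ) + t • EuclideanSpace.proj (2, i)))
  have hQ : HasFDerivAt Q Q' w := HasFDerivAt.fun_sum (u := Finset.univ) fun (i : Fin d) _ =>
    ((((hp (1, i)).const_mul r).add ((hp (2, i)).const_mul t)).mul (hp (0, i)))
  have hQ' : Q' (basisVec c) = if c.1 = 0 then r * w (1, c.2) + t * w (2, c.2)
          else if c.1 = 1 then r * w (0, c.2) else t * w (0, c.2) := by
    obtain ⟨j, i⟩ := c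
    simp only [Q', sum_apply, add_apply, smul_apply, PiLp.proj_apply, basisVec_apply,
      Prod.mk.injEq, smul_eq_mul]
    rw [Finset.sum_eq_single i (fun i' _ h => by simp [h]) (by simp)]
    fin_cases j <;> simp [mul_comm]
  have hsym : ∀ w : Space d, symbol r t ((2 * Real.pi) • w) =
      Complex.exp (-(Complex.I * Complex.ofRealCLM ((2 * Real.pi) ^ 2 * Q w))) := fun w => by
    simp only [symbol, PiLp.smul_apply, smul_eq_mul, Q, Finset.mul_sum, Complex.ofRealCLM_apply]
    congr 5
    funext i
    ring
  have hS : HasFDerivAt (fun w : Space d => symbol r t ((2 * Real.pi) • w))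
      (symbol r t ((2 * Real.pi) • w) •
        -(Complex.I • Complex.ofRealCLM.comp ((2 * Real.pi) ^ 2 • Q'))) w := by
    rw [hsym w, show (fun w : Space d => symbol r t ((2 * Real.pi) • w)) = _ from funext hsym]
    exact (((Complex.ofRealCLM.hasFDerivAt.comp w (hQ.const_mul ((2 * Real.pi) ^ 2))).const_mul
      Complex.I).neg.cexp)
  have hF := (hS.mul (𝓕 f : 𝓢(Space d, ℂ)).differentiableAt.hasFDerivAt).fderiv
  rw [derX_apply, derX_apply]
  refine (congrArg (fun u : Space d → ℂ => fderiv ℝ u w (basisVec c))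
    (funext (fourier_expOp r t f))).trans
      ((congrArg (fun L : Space d →L[ℝ] ℂ => L (basisVec c)) hF).trans ?_)
  simp only [add_apply, smul_apply, neg_apply, ContinuousLinearMap.comp_apply, hQ',
    Complex.ofRealCLM_apply, smul_eq_mul]
  push_cast
  ring

/-- The operator conjugates multiplication by a coordinate into the same multiplication plus
first-order derivatives in the coordinates that the symbol couples to it. -/
theorem mulX_expOp (r t : ℝ) (c : Fin 3 × Fin d) (f : 𝓢(Space d, ℂ)) :
    mulX c (expOp r t f) = expOp r t (mulX c f +
      (-Complex.I) • (if c.1 = 0 then (r : ℂ) • derX (1, c.2) f + (t : ℂ) • derX (2, c.2) f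
        else if c.1 = 1 then (r : ℂ) • derX (0, c.2) f else (t : ℂ) • derX (0, c.2) f)) := by
  apply fourier_injective
  ext w
  have hF : ∀ (g : 𝓢(Space d, ℂ)), 𝓕 (mulX c g) w = (Complex.I / (2 * Real.pi)) *
      derX c (𝓕 g) w := fun g => by
    rw [derX_fourier, smul_apply, smul_eq_mul, ← mul_assoc]
    have : (Real.pi : ℂ) ≠ 0 := by exact_mod_cast Real.pi_ne_zero
    field_simp
    simp
  have hπ : (Real.pi : ℂ) ≠ 0 := by exact_mod_cast Real.pi_ne_zero
  rw [hF, fourier_expOp, derX_fourier_expOp, FourierTransform.fourier_add, add_apply,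
    FourierTransform.fourier_smul, smul_apply, smul_eq_mul, hF]
  split_ifs <;>
  · simp only [FourierTransform.fourier_add, FourierTransform.fourier_smul, add_apply, smul_apply,
      smul_eq_mul, fourier_derX]
    push_cast
    field_simp
    ring_nf

end

section

/-! ### Words in coordinates and derivatives -/

/-- The operator of a letter: `inl c` is multiplication by `x_c`, `inr c` is `∂_c`. -/
def letterOp : (Fin 3 × Fin d) ⊕ (Fin 3 × Fin d) → 𝓢(Space d, ℂ) →L[ℂ] 𝓢(Space d, ℂ) :=
  Sum.elim mulX derX

/-- The product of the operators of the letters of a word; the last letter acts first. -/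
def wordOp : List ((Fin 3 × Fin d) ⊕ (Fin 3 × Fin d)) → 𝓢(Space d, ℂ) → 𝓢(Space d, ℂ)
  | [], F => F
  | l :: w, F => letterOp l (wordOp w F)

theorem wordOp_append (w w' : List ((Fin 3 × Fin d) ⊕ (Fin 3 × Fin d))) (F : 𝓢(Space d, ℂ)) :
    wordOp (w ++ w') F = wordOp w (wordOp w' F) := by
  induction w with
  | nil => rfl
  | cons l w ih => simp only [List.cons_append, wordOp, ih]

/-- The multi-index that counts the multiplications in a word. -/
def mulIdx : List ((Fin 3 × Fin d) ⊕ (Fin 3 × Fin d)) → MultiIndex d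
  | [] => 0
  | Sum.inl e :: w => mulIdx w + Pi.single e 1
  | Sum.inr _ :: w => mulIdx w

/-- The multi-index that counts the derivatives in a word. -/
def derIdx : List ((Fin 3 × Fin d) ⊕ (Fin 3 × Fin d)) → MultiIndex d
  | [] => 0
  | Sum.inl _ :: w => derIdx w
  | Sum.inr e :: w => derIdx w + Pi.single e 1

/-- The multi-index that counts the occurrences of the coordinates in a list. -/
def countIdx : List (Fin 3 × Fin d) → MultiIndex d
  | [] => 0
  | e :: l => countIdx l + Pi.single e 1

theorem exists_countIdx_eq (α : MultiIndex d) : ∃ l, countIdx l = α := by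
  induction α using MultiIndex.induction with
  | h0 => exact ⟨[], rfl⟩
  | hs α c ih =>
    obtain ⟨l, rfl⟩ := ih
    exact ⟨c :: l, rfl⟩

theorem sum_countIdx (l : List (Fin 3 × Fin d)) : ∑ c, countIdx l c = l.length := by
  induction l with
  | nil => simp [countIdx]
  | cons e l ih =>
    simp [countIdx, Finset.sum_add_distrib, ih]

theorem wordOp_inl_apply (l : List (Fin 3 × Fin d)) (F : 𝓢(Space d, ℂ)) (x : Space d) :
    wordOp (l.map Sum.inl) F x = monomial (countIdx l) x * F x := by
  induction l with
  | nil => simp [wordOp, countIdx, monomial]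
  | cons e l ih =>
    simp only [List.map_cons, wordOp, letterOp, Sum.elim_inl, mulX_apply, ih, countIdx,
      monomial_add_single]
    push_cast
    ring

theorem wordOp_inr_apply (l : List (Fin 3 × Fin d)) (F : 𝓢(Space d, ℂ)) (x : Space d) :
    wordOp (l.map Sum.inr) F x = partialDeriv (countIdx l) F x := by
  induction l generalizing x with
  | nil => exact (partialDeriv_zero_index F x).symm
  | cons e l ih =>
    simp only [List.map_cons, wordOp, letterOp, Sum.elim_inr, derX_apply, countIdx]
    rw [partialDeriv_add_single (F.smooth ⊤), show ⇑(wordOp (l.map Sum.inr) F) = _ from funext ih]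

/-- The majorant that results from `f` by moving `m` multiplications to the left past `D`
derivatives: it solves the recursion that the relation `∂^D x = x ∂^D + D ∂^{D - 1}` gives. -/
def ordBound (f : ℕ → ℕ → ℝ) : ℕ → ℕ → ℕ → ℝ
  | g, D, 0 => f g D
  | g, D, m + 1 => ordBound f (g + 1) D m + D * ordBound f g (D - 1) m

theorem ordBound_nonneg {f : ℕ → ℕ → ℝ} (hf : ∀ g D, 0 ≤ f g D) (g D m : ℕ) :
    0 ≤ ordBound f g D m := by
  induction m generalizing g D with
  | zero => exact hf g D
  | succ m ih => exact add_nonneg (ih _ _) (mul_nonneg (Nat.cast_nonneg _) (ih _ _))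

/-- Two products that agree with `∏ r` in all factors except the one at `e` are added in that
factor. -/
theorem prod_add_mul_prod_le {ι : Type*} [Fintype ι] [DecidableEq ι] (e : ι) {p q r : ι → ℝ}
    {k : ℝ} (hr : ∀ c, 0 ≤ r c) (hp : ∀ c, c ≠ e → p c = r c) (hq : ∀ c, c ≠ e → q c = r c)
    (he : p e + k * q e ≤ r e) : ∏ c, p c + k * ∏ c, q c ≤ ∏ c, r c := by
  rw [← Finset.mul_prod_erase _ p (Finset.mem_univ e), ← Finset.mul_prod_erase _ q
    (Finset.mem_univ e), ← Finset.mul_prod_erase _ r (Finset.mem_univ e),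
    Finset.prod_congr rfl fun c hc => hp c (Finset.ne_of_mem_erase hc),
    Finset.prod_congr rfl fun c hc => hq c (Finset.ne_of_mem_erase hc), ← mul_assoc, ← add_mul]
  exact mul_le_mul_of_nonneg_right he (Finset.prod_nonneg fun c _ => hr c)

/-- Bounds for `x^γ ∂^δ w F`, where `w` is a word. The majorant depends only on how often the
letters occur in `w`, not on their order. -/
theorem norm_wordOp_le {f : Fin 3 × Fin d → ℕ → ℕ → ℝ} (hf : ∀ c g D, 0 ≤ f c g D)
    {F : 𝓢(Space d, ℂ)} {A : ℝ} (hA : 0 ≤ A)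
    (hF : ∀ α β x, ‖(monomial α x : ℂ) * partialDeriv β F x‖ ≤ A * ∏ c, f c (α c) (β c))
    (w : List ((Fin 3 × Fin d) ⊕ (Fin 3 × Fin d))) (γ δ : MultiIndex d) (x : Space d) :
    ‖(monomial γ x : ℂ) * partialDeriv δ (wordOp w F) x‖ ≤
      A * ∏ c, ordBound (f c) (γ c) (δ c + derIdx w c) (mulIdx w c) := by
  induction w generalizing γ δ with
  | nil => simpa [wordOp, ordBound, mulIdx, derIdx] using hF γ δ x
  | cons l w ih =>
    cases l with
    | inr e =>
      simp only [wordOp, letterOp, Sum.elim_inr]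
      rw [partialDeriv_derX]
      refine (ih γ (δ + Pi.single e 1)).trans_eq ?_
      congr 1
      refine Finset.prod_congr rfl fun c _ => ?_
      simp only [mulIdx, derIdx, Pi.add_apply]
      congr 1
      ring
    | inl e =>
      simp only [wordOp, letterOp, Sum.elim_inl]
      rw [partialDeriv_mulX]
      have h1 := ih (γ + Pi.single e 1) δ
      have h2 := ih γ (δ - Pi.single e 1)
      rw [monomial_add_single] at h1
      have h3 : (monomial γ x : ℂ) * (x e * partialDeriv δ (wordOp w F) x +
          δ e * partialDeriv (δ - Pi.single e 1) (wordOp w F) x) =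
          ((monomial γ x * x e : ℝ) : ℂ) * partialDeriv δ (wordOp w F) x +
          (δ e : ℂ) * ((monomial γ x : ℂ) * partialDeriv (δ - Pi.single e 1) (wordOp w F) x) := by
        push_cast; ring
      rw [h3]
      refine (norm_add_le _ _).trans ?_
      rw [norm_mul (δ e : ℂ), Complex.norm_natCast]
      refine (add_le_add h1 (mul_le_mul_of_nonneg_left h2 (Nat.cast_nonneg _))).trans ?_
      rw [mul_left_comm, ← mul_add]
      refine mul_le_mul_of_nonneg_left ?_ hA
      refine prod_add_mul_prod_le e (fun c => ordBound_nonneg (hf c) _ _ _) ?_ ?_ ?_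
      · intro c hc
        simp [mulIdx, derIdx, hc]
      · intro c hc
        simp [mulIdx, derIdx, hc]
      · simp only [mulIdx, derIdx, Pi.add_apply, Pi.single_eq_same, ordBound, Pi.sub_apply]
        refine add_le_add le_rfl ?_
        rcases Nat.eq_zero_or_pos (δ e) with h0 | h0
        · rw [h0, Nat.cast_zero, zero_mul]
          exact mul_nonneg (Nat.cast_nonneg _) (ordBound_nonneg (hf e) _ _ _)
        · rw [show δ e - 1 + derIdx w e = δ e + derIdx w e - 1 by omega]
          refine mul_le_mul_of_nonneg_right ?_ (ordBound_nonneg (hf e) _ _ _)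
          exact_mod_cast Nat.le_add_right _ _

/-! ### Estimate of the majorant -/

/-- The majorant is a sum over the ways to absorb `j` of the `m` multiplications in derivatives;
there are at most `2^m` terms, and absorbing `j` of them costs the factor
`D (D - 1) ⋯ (D - j + 1)`. -/
theorem ordBound_le {f : ℕ → ℕ → ℝ} {g D m : ℕ} {M : ℝ}
    (h : ∀ j ≤ m, (D.descFactorial j : ℝ) * f (g + m - j) (D - j) ≤ M) (hM : 0 ≤ M) :
    ordBound f g D m ≤ 2 ^ m * M := by
  induction m generalizing g D M with
  | zero => simpa [ordBound] using h 0 le_rfl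
  | succ m ih =>
    have h1 : ordBound f (g + 1) D m ≤ 2 ^ m * M := ih (fun j hj => by
      have := h j (by omega)
      rwa [show g + (m + 1) - j = g + 1 + m - j by omega] at this) hM
    have h2 : (D : ℝ) * ordBound f g (D - 1) m ≤ 2 ^ m * M := by
      rcases D with _ | D
      · simp only [Nat.cast_zero, zero_mul]; positivity
      · have hD : (0 : ℝ) < (D + 1 : ℕ) := by positivity
        have := ih (g := g) (D := D) (M := M / (D + 1 : ℕ)) (fun j hj => by
          rw [le_div_iff₀ hD]
          have := h (j + 1) (by omega)
          rw [Nat.succ_descFactorial_succ, Nat.add_sub_add_right,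
            show g + (m + 1) - (j + 1) = g + m - j by omega] at this
          push_cast at this ⊢
          linarith) (by positivity)
        rw [Nat.add_sub_cancel]
        calc ((D + 1 : ℕ) : ℝ) * ordBound f g D m ≤ (D + 1 : ℕ) * (2 ^ m * (M / (D + 1 : ℕ))) :=
              mul_le_mul_of_nonneg_left this hD.le
          _ = 2 ^ m * M := by field_simp
    calc ordBound f g D (m + 1) ≤ 2 ^ m * M + 2 ^ m * M := add_le_add h1 h2
      _ = 2 ^ (m + 1) * M := by ring

/-- The factor `h^{m + n} m!^a n!^b` that one coordinate contributes to the weight. -/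
def coordWeight (h a b : ℝ) (m n : ℕ) : ℝ := h ^ (m + n) * ((m ! : ℝ) ^ a * (n ! : ℝ) ^ b)

theorem factorial_rpow_pos (n : ℕ) (a : ℝ) : 0 < (n ! : ℝ) ^ a :=
  Real.rpow_pos_of_pos (by exact_mod_cast n.factorial_pos) a

theorem coordWeight_nonneg {h : ℝ} (hh : 0 ≤ h) (a b : ℝ) (m n : ℕ) :
    0 ≤ coordWeight h a b m n :=
  mul_nonneg (pow_nonneg hh _) (mul_pos (factorial_rpow_pos _ _) (factorial_rpow_pos _ _)).le

theorem weight_eq_prod (s σ : Fin 3 → ℝ) (h : ℝ) (α β : MultiIndex d) :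
    weight s σ h α β = ∏ c, coordWeight h (s c.1) (σ c.1) (α c) (β c) := by
  have h0 : ∀ n : ℕ, (0 : ℝ) ≤ (n ! : ℝ) := fun n => Nat.cast_nonneg _
  unfold weight coordWeight
  conv_rhs => rw [Finset.prod_mul_distrib, Finset.prod_pow_eq_pow_sum]
  simp only [Fintype.prod_prod_type]
  congr 1
  refine Finset.prod_congr rfl fun j _ => ?_
  rw [Finset.prod_mul_distrib, Real.finsetProd_rpow _ _ fun i _ => h0 _,
    Real.finsetProd_rpow _ _ fun i _ => h0 _]

/-- Normal ordering costs a geometric factor, provided that `j!` is dominated by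
`h^{2j} j!^{a + b}` up to the geometric factor `B κ^j`. -/
theorem ordBound_coordWeight_le {h a b κ B : ℝ} (hh : 0 < h) (ha : 0 ≤ a) (hb : 0 ≤ b)
    (hκ : 1 ≤ κ) (hB : 0 ≤ B)
    (hj : ∀ j : ℕ, (j ! : ℝ) ≤ B * κ ^ j * h ^ (2 * j) * ((j ! : ℝ) ^ a * (j ! : ℝ) ^ b))
    (g D m : ℕ) :
    ordBound (coordWeight h a b) g D m ≤ B * coordWeight (2 * κ * h) a b (g + m) D := by
  have hmain : ordBound (coordWeight h a b) g D m ≤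
      2 ^ m * (B * ((2 * κ) ^ D * coordWeight h a b (g + m) D)) := by
    have hcw := coordWeight_nonneg hh.le a b (g + m) D
    have h2κ : 0 ≤ 2 * κ := by positivity
    refine ordBound_le (fun j hjm => ?_) (by positivity)
    rcases lt_or_ge D j with hDj | hDj
    · rw [Nat.descFactorial_of_lt hDj, Nat.cast_zero, zero_mul]
      positivity
    obtain ⟨D, rfl⟩ : ∃ D', D = D' + j := ⟨D - j, by omega⟩
    obtain ⟨n, hn⟩ : ∃ n, g + m = n + j := ⟨g + m - j, by omega⟩
    rw [hn, Nat.add_sub_cancel, Nat.add_sub_cancel]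
    have hdesc : (((D + j).descFactorial j : ℕ) : ℝ) ≤ 2 ^ (D + j) * (j ! : ℝ) := by
      rw [Nat.descFactorial_eq_factorial_mul_choose]
      have := Nat.choose_le_two_pow (D + j) j
      rw [mul_comm (j !)]
      exact_mod_cast Nat.mul_le_mul_right _ this
    have hfac : ∀ (k : ℕ) (e : ℝ), 0 ≤ e →
        (j ! : ℝ) ^ e * (k ! : ℝ) ^ e ≤ ((k + j)! : ℝ) ^ e := fun k e he => by
      rw [← Real.mul_rpow (by positivity) (by positivity)]
      refine Real.rpow_le_rpow (by positivity) ?_ he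
      rw [add_comm k j]
      exact_mod_cast Nat.le_of_dvd (Nat.factorial_pos _) (Nat.factorial_mul_factorial_dvd_factorial_add j k)
    have hκj : κ ^ j ≤ κ ^ (D + j) := pow_le_pow_right₀ hκ (by omega)
    have p1 := factorial_rpow_pos n a
    have p2 := factorial_rpow_pos D b
    have p3 := factorial_rpow_pos j a
    have p4 := factorial_rpow_pos j b
    have p5 := factorial_rpow_pos (n + j) a
    have p6 := factorial_rpow_pos (D + j) b
    unfold coordWeight
    calc (((D + j).descFactorial j : ℕ) : ℝ) * (h ^ (n + D) * ((n ! : ℝ) ^ a * (D ! : ℝ) ^ b))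
        ≤ (2 ^ (D + j) * (B * κ ^ j * h ^ (2 * j) * ((j ! : ℝ) ^ a * (j ! : ℝ) ^ b))) *
            (h ^ (n + D) * ((n ! : ℝ) ^ a * (D ! : ℝ) ^ b)) := by
          refine mul_le_mul_of_nonneg_right (hdesc.trans ?_) (by positivity)
          exact mul_le_mul_of_nonneg_left (hj j) (by positivity)
      _ = B * (2 ^ (D + j) * κ ^ j * (h ^ (n + j + (D + j)) *
            (((j ! : ℝ) ^ a * (n ! : ℝ) ^ a) * ((j ! : ℝ) ^ b * (D ! : ℝ) ^ b)))) := by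
          ring
      _ ≤ B * (2 ^ (D + j) * κ ^ (D + j) * (h ^ (n + j + (D + j)) *
            (((n + j)! : ℝ) ^ a * ((D + j)! : ℝ) ^ b))) := by
          gcongr
          · exact hfac n a ha
          · exact hfac D b hb
      _ = _ := by rw [mul_pow]
  refine hmain.trans ?_
  have hcw : coordWeight (2 * κ * h) a b (g + m) D =
      (2 * κ) ^ (g + m + D) * coordWeight h a b (g + m) D := by
    unfold coordWeight
    rw [mul_pow]; ring
  rw [hcw]
  have hcw' := coordWeight_nonneg hh.le a b (g + m) D
  have h1 : (2 : ℝ) ^ m * (2 * κ) ^ D ≤ (2 * κ) ^ (g + m + D) := by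
    calc (2 : ℝ) ^ m * (2 * κ) ^ D ≤ (2 * κ) ^ (g + m) * (2 * κ) ^ D := by
          refine mul_le_mul_of_nonneg_right ?_ (by positivity)
          refine (pow_le_pow_left₀ (by norm_num) (by linarith : (2 : ℝ) ≤ 2 * κ) m).trans ?_
          exact pow_le_pow_right₀ (by linarith) (by omega)
      _ = _ := by rw [← pow_add]
  calc 2 ^ m * (B * ((2 * κ) ^ D * coordWeight h a b (g + m) D))
      = B * ((2 ^ m * (2 * κ) ^ D) * coordWeight h a b (g + m) D) := by ring
    _ ≤ _ := by gcongr

end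

section

/-! ### Operators that turn `x_c` into `x_c + ρ_c ∂_{π c}` -/

section Intertwiner

variable (π : Equiv.Perm (Fin 3 × Fin d)) (ρ : Fin 3 × Fin d → ℂ)

/-- The product of the operators `x_c + ρ_c ∂_{π c}` over a list of coordinates. -/
def twistOp : List (Fin 3 × Fin d) → 𝓢(Space d, ℂ) → 𝓢(Space d, ℂ)
  | [], F => F
  | c :: l, F => mulX c (twistOp l F) + ρ c • derX (π c) (twistOp l F)

/-- The words that occur when the product of the operators `x_c + ρ_c ∂_{π c}` is expanded. -/
inductive Expansion : List (Fin 3 × Fin d) → List ((Fin 3 × Fin d) ⊕ (Fin 3 × Fin d)) → Prop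
  | nil : Expansion [] []
  | mul (c : Fin 3 × Fin d) {l w} : Expansion l w → Expansion (c :: l) (Sum.inl c :: w)
  | der (c : Fin 3 × Fin d) {l w} : ρ c ≠ 0 → Expansion l w →
      Expansion (c :: l) (Sum.inr (π c) :: w)

variable {π ρ}

/-- A functional of the expanded product is bounded through its values on the single words: there
are at most `2^{|l|}` of them, with coefficients that add up to at most `(1 + R)^{|l|}`. -/
theorem norm_twistOp_le {R : ℝ} (hR : ∀ c, ‖ρ c‖ ≤ R) (hR0 : 0 ≤ R) {F : 𝓢(Space d, ℂ)} {M : ℝ}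
    (hM0 : 0 ≤ M) (l : List (Fin 3 × Fin d)) (u : 𝓢(Space d, ℂ) →ₗ[ℂ] ℂ)
    (hM : ∀ w, Expansion π ρ l w → ‖u (wordOp w F)‖ ≤ M) :
    ‖u (twistOp π ρ l F)‖ ≤ (1 + R) ^ l.length * M := by
  induction l generalizing u with
  | nil => simpa [twistOp, wordOp] using hM [] .nil
  | cons c l ih =>
    have h1 := ih (u ∘ₗ (mulX c).toLinearMap) fun w hw => hM _ (.mul c hw)
    have h2 : ‖ρ c • u (derX (π c) (twistOp π ρ l F))‖ ≤ R * ((1 + R) ^ l.length * M) := by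
      rcases eq_or_ne (ρ c) 0 with h0 | h0
      · rw [h0, zero_smul, norm_zero]; positivity
      · rw [norm_smul]
        have h1 := ih (u ∘ₗ (derX (π c)).toLinearMap) fun w hw => hM _ (.der c h0 hw)
        exact mul_le_mul (hR c) h1 (norm_nonneg _) hR0
    rw [twistOp, map_add, map_smul, List.length_cons]
    refine (norm_add_le _ _).trans ((add_le_add h1 h2).trans_eq ?_)
    ring

/-- Each factor `x_c + ρ_c ∂_{π c}` contributes either an `x_c` or a `∂_{π c}`. -/
theorem Expansion.mulIdx_add_derIdx {l : List (Fin 3 × Fin d)} {w}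
    (h : Expansion π ρ l w) (c : Fin 3 × Fin d) :
    mulIdx w c + derIdx w (π c) = countIdx l c := by
  induction h with
  | nil => rfl
  | mul e _ ih => simp only [mulIdx, derIdx, countIdx, Pi.add_apply, ← ih]; ring
  | der e _ _ ih =>
    simp only [mulIdx, derIdx, countIdx, Pi.add_apply, ← ih, Pi.single_apply,
      EmbeddingLike.apply_eq_iff_eq]
    ring

theorem Expansion.derIdx_eq_zero {l : List (Fin 3 × Fin d)} {w}
    (h : Expansion π ρ l w) (c : Fin 3 × Fin d) (hc : ρ c = 0) : derIdx w (π c) = 0 := by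
  induction h with
  | nil => rfl
  | mul e _ ih => exact ih
  | der e he _ ih =>
    have : c ≠ e := fun h => he (h ▸ hc)
    simp [derIdx, ih, this]

theorem wordOp_map_inl_intertwine {T : 𝓢(Space d, ℂ) →L[ℂ] 𝓢(Space d, ℂ)}
    (hT : ∀ c F, mulX c (T F) = T (mulX c F + ρ c • derX (π c) F)) (l : List (Fin 3 × Fin d))
    (F : 𝓢(Space d, ℂ)) : wordOp (l.map Sum.inl) (T F) = T (twistOp π ρ l F) := by
  induction l with
  | nil => rfl
  | cons c l ih =>
    simp only [List.map_cons, wordOp, letterOp, Sum.elim_inl, ih, hT, twistOp]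

theorem wordOp_map_inr_commute {T : 𝓢(Space d, ℂ) →L[ℂ] 𝓢(Space d, ℂ)}
    (hT : ∀ c F, derX c (T F) = T (derX c F)) (l : List (Fin 3 × Fin d))
    (F : 𝓢(Space d, ℂ)) : wordOp (l.map Sum.inr) (T F) = T (wordOp (l.map Sum.inr) F) := by
  induction l with
  | nil => rfl
  | cons c l ih =>
    simp only [List.map_cons, wordOp, letterOp, Sum.elim_inr, ih, hT]

end Intertwiner

theorem mulIdx_append_map_inr (w) (l : List (Fin 3 × Fin d)) :
    mulIdx (w ++ l.map Sum.inr) = mulIdx w := by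
  induction w with
  | nil =>
    induction l with
    | nil => rfl
    | cons c l ih => simpa [mulIdx] using ih
  | cons e w ih => cases e <;> simp [mulIdx, ih]

theorem derIdx_append_map_inr (w) (l : List (Fin 3 × Fin d)) :
    derIdx (w ++ l.map Sum.inr) = derIdx w + countIdx l := by
  induction w with
  | nil =>
    induction l with
    | nil => rfl
    | cons c l ih => simpa [derIdx, countIdx] using ih
  | cons e w ih =>
    cases e
    · simp [derIdx, ih]
    · simp [derIdx, ih, add_right_comm]

/-- The functional `F ↦ x^γ ∂^δ F(x)`. -/
def evalMonomialDeriv (γ δ : MultiIndex d) (x : Space d) : 𝓢(Space d, ℂ) →ₗ[ℂ] ℂ where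
  toFun F := monomial γ x * partialDeriv δ F x
  map_add' F G := by
    have := partialDeriv_add δ (F.smooth ⊤) (G.smooth ⊤) x
    rw [← mul_add]
    exact congrArg _ this
  map_smul' a F := by
    have := partialDeriv_smul δ a (F.smooth ⊤) x
    rw [RingHom.id_apply, smul_eq_mul, mul_left_comm]
    exact congrArg _ this

theorem norm_le_of_quotient_le {s σ : Fin 3 → ℝ} {h : ℝ} (hh : 0 < h) {F : Space d → ℂ} {A : ℝ}
    (hA : ∀ p, quotient s σ h F p ≤ A) (α β : MultiIndex d) (x : Space d) :
    ‖(monomial α x : ℂ) * partialDeriv β F x‖ ≤ A * weight s σ h α β :=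
  (div_le_iff₀ (weight_pos s σ hh α β)).1 (hA (α, β, x))

theorem quotient_le_of_norm_le {s σ : Fin 3 → ℝ} {h : ℝ} (hh : 0 < h) {F : Space d → ℂ} {A : ℝ}
    (hA : ∀ α β x, ‖(monomial α x : ℂ) * partialDeriv β F x‖ ≤ A * weight s σ h α β) (p) :
    quotient s σ h F p ≤ A :=
  (div_le_iff₀ (weight_pos s σ hh _ _)).2 (hA p.1 p.2.1 p.2.2)

/-- Separation of the factorials: for `γ, δ ≤ L` the weight of `(γ + m, δ + n + β)` is bounded by a
constant times a geometric factor times `m!^a n!^b β!^b`. -/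
theorem coordWeight_add_le {H a b K : ℝ} (hH : 0 < H) (ha : 0 ≤ a) (hb : 0 ≤ b)
    (hK : (4 : ℝ) ^ (a + b) ≤ K) {L γ δ : ℕ} (hγ : γ ≤ L) (hδ : δ ≤ L) (m n β : ℕ) :
    coordWeight H a b (γ + m) (δ + (n + β)) ≤
      ((max 1 H) ^ (2 * L) * ((2 ^ L * L ! : ℝ) ^ a * (2 ^ L * L ! : ℝ) ^ b)) *
        ((K * H) ^ (m + n + β) * ((m ! : ℝ) ^ a * ((n ! : ℝ) ^ b * (β ! : ℝ) ^ b))) := by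
  have key : ∀ i j : ℕ, ((i + j)! : ℝ) ≤ 2 ^ (i + j) * ((i ! : ℝ) * (j ! : ℝ)) := fun i j => by
    have h1 := Nat.add_choose_mul_factorial_mul_factorial i j
    have h2 := Nat.choose_le_two_pow (i + j) j
    rw [← h1, mul_assoc]
    push_cast
    gcongr
    exact_mod_cast h2
  have key2 : ∀ i j : ℕ, i ≤ L → ((i + j)! : ℝ) ≤ (2 ^ L * L !) * (2 ^ j * (j ! : ℝ)) :=
    fun i j hi => by
      refine (key i j).trans ?_
      have h1 : (i ! : ℝ) ≤ (L ! : ℝ) := by exact_mod_cast Nat.factorial_le hi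
      have h2 : (2 : ℝ) ^ i ≤ 2 ^ L := pow_le_pow_right₀ (by norm_num) hi
      calc (2 : ℝ) ^ (i + j) * ((i ! : ℝ) * (j ! : ℝ)) = (2 ^ i * i !) * (2 ^ j * j !) := by ring
        _ ≤ _ := by gcongr
  have f1 : ((γ + m)! : ℝ) ^ a ≤ (2 ^ L * L ! : ℝ) ^ a * (((4 : ℝ) ^ a) ^ m * (m ! : ℝ) ^ a) := by
    rw [Real.rpow_pow_comm (by norm_num), ← Real.mul_rpow (by positivity) (by positivity),
      ← Real.mul_rpow (by positivity) (by positivity)]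
    refine Real.rpow_le_rpow (by positivity) ((key2 γ m hγ).trans ?_) ha
    gcongr
    norm_num
  have f2 : ((δ + (n + β))! : ℝ) ^ b ≤ (2 ^ L * L ! : ℝ) ^ b *
      (((4 : ℝ) ^ b) ^ (n + β) * ((n ! : ℝ) ^ b * (β ! : ℝ) ^ b)) := by
    rw [Real.rpow_pow_comm (by norm_num), ← Real.mul_rpow (by positivity) (by positivity),
      ← Real.mul_rpow (by positivity) (by positivity),
      ← Real.mul_rpow (by positivity) (by positivity)]
    refine Real.rpow_le_rpow (by positivity) ((key2 δ (n + β) hδ).trans ?_) hb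
    refine mul_le_mul_of_nonneg_left ?_ (by positivity)
    refine (mul_le_mul_of_nonneg_left (key n β) (by positivity)).trans_eq ?_
    rw [← mul_assoc, ← mul_pow]
    norm_num
  have h4 : ∀ {e e' : ℝ}, 0 ≤ e' → e + e' = a + b → (4 : ℝ) ^ e ≤ K := fun he' h =>
    (Real.rpow_le_rpow_of_exponent_le (by norm_num) (by linarith)).trans hK
  have f3 : ((4 : ℝ) ^ a) ^ m * ((4 : ℝ) ^ b) ^ (n + β) ≤ K ^ (m + n + β) := by
    have h4a : (4 : ℝ) ^ a ≤ K := h4 hb rfl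
    have h4b : (4 : ℝ) ^ b ≤ K := h4 ha (add_comm _ _)
    have hK0 : 0 ≤ K := (Real.rpow_nonneg (by norm_num) _).trans hK
    rw [add_assoc, pow_add K]
    gcongr
  have f4 : H ^ (γ + m + (δ + (n + β))) ≤ (max 1 H) ^ (2 * L) * H ^ (m + n + β) := by
    rw [show γ + m + (δ + (n + β)) = (γ + δ) + (m + n + β) by ring, pow_add]
    refine mul_le_mul_of_nonneg_right ?_ (by positivity)
    exact (pow_le_pow_left₀ hH.le (le_max_right _ _) _).trans
      (pow_le_pow_right₀ (le_max_left _ _) (by omega))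
  unfold coordWeight
  have g1 := factorial_rpow_pos m a
  have g2 := factorial_rpow_pos n b
  have g3 := factorial_rpow_pos β b
  have g4 := factorial_rpow_pos (γ + m) a
  have g5 := factorial_rpow_pos (δ + (n + β)) b
  calc H ^ (γ + m + (δ + (n + β))) * (((γ + m)! : ℝ) ^ a * ((δ + (n + β))! : ℝ) ^ b)
      ≤ ((max 1 H) ^ (2 * L) * H ^ (m + n + β)) *
        (((2 ^ L * L ! : ℝ) ^ a * (((4 : ℝ) ^ a) ^ m * (m ! : ℝ) ^ a)) *
          ((2 ^ L * L ! : ℝ) ^ b *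
            (((4 : ℝ) ^ b) ^ (n + β) * ((n ! : ℝ) ^ b * (β ! : ℝ) ^ b)))) := by
        gcongr
    _ = ((max 1 H) ^ (2 * L) * ((2 ^ L * L ! : ℝ) ^ a * (2 ^ L * L ! : ℝ) ^ b)) *
        ((((4 : ℝ) ^ a) ^ m * ((4 : ℝ) ^ b) ^ (n + β)) * H ^ (m + n + β) *
          ((m ! : ℝ) ^ a * ((n ! : ℝ) ^ b * (β ! : ℝ) ^ b))) := by ring
    _ ≤ ((max 1 H) ^ (2 * L) * ((2 ^ L * L ! : ℝ) ^ a * (2 ^ L * L ! : ℝ) ^ b)) *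
        (K ^ (m + n + β) * H ^ (m + n + β) *
          ((m ! : ℝ) ^ a * ((n ! : ℝ) ^ b * (β ! : ℝ) ^ b))) := by gcongr
    _ = _ := by rw [mul_pow]

/-- `T` maps `𝒮_{s;h}^σ` boundedly into `𝒮_{s;h'}^σ`. -/
def BoundedBetween (s σ : Fin 3 → ℝ) (h h' : ℝ) (T : 𝓢(Space d, ℂ) →L[ℂ] 𝓢(Space d, ℂ)) : Prop :=
  ∃ C : ℝ, 0 ≤ C ∧ ∀ (F : 𝓢(Space d, ℂ)) (A : ℝ), (∀ p, quotient s σ h F p ≤ A) →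
    ∀ p, quotient s σ h' (T F) p ≤ C * A

theorem BoundedBetween.comp {s σ : Fin 3 → ℝ} {h h' h'' : ℝ}
    {T S : 𝓢(Space d, ℂ) →L[ℂ] 𝓢(Space d, ℂ)} (hT : BoundedBetween s σ h' h'' T)
    (hS : BoundedBetween s σ h h' S) : BoundedBetween s σ h h'' (T.comp S) := by
  obtain ⟨C, hC, hT⟩ := hT
  obtain ⟨C', hC', hS⟩ := hS
  refine ⟨C * C', mul_nonneg hC hC', fun F A hA p => ?_⟩
  rw [mul_assoc]
  exact hT _ _ (hS F A hA) p

/-- Trading multiplications `x_c` for derivatives `∂_{π c}` does not increase the factorial weights,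
since `σ_{π c} ≤ s_c` wherever `ρ_c ≠ 0`. -/
theorem Expansion.prod_factorial_le {π : Equiv.Perm (Fin 3 × Fin d)} {ρ : Fin 3 × Fin d → ℂ}
    {s σ : Fin 3 → ℝ} (hs : ∀ j, 0 ≤ s j) (hsσ : ∀ c, ρ c ≠ 0 → σ (π c).1 ≤ s c.1)
    {l : List (Fin 3 × Fin d)} {w} (hw : Expansion π ρ l w) :
    (∏ c, ((mulIdx w c)! : ℝ) ^ s c.1) * ∏ c, ((derIdx w c)! : ℝ) ^ σ c.1 ≤
      ∏ c, ((countIdx l c)! : ℝ) ^ s c.1 := by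
  rw [← Equiv.prod_comp π fun c => ((derIdx w c)! : ℝ) ^ σ c.1, ← Finset.prod_mul_distrib]
  refine Finset.prod_le_prod (fun c _ =>
    (mul_pos (factorial_rpow_pos _ _) (factorial_rpow_pos _ _)).le) fun c _ => ?_
  have h1 : ((derIdx w (π c))! : ℝ) ^ σ (π c).1 ≤ ((derIdx w (π c))! : ℝ) ^ s c.1 := by
    by_cases hc : ρ c = 0
    · simp [hw.derIdx_eq_zero c hc]
    · exact Real.rpow_le_rpow_of_exponent_le
        (by exact_mod_cast Nat.one_le_iff_ne_zero.2 (Nat.factorial_ne_zero _)) (hsσ c hc)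
  refine (mul_le_mul_of_nonneg_left h1 (factorial_rpow_pos _ _).le).trans ?_
  rw [← Real.mul_rpow (by positivity) (by positivity), ← hw.mulIdx_add_derIdx c]
  refine Real.rpow_le_rpow (by positivity) ?_ (hs _)
  exact_mod_cast Nat.le_of_dvd (Nat.factorial_pos _)
    (Nat.factorial_mul_factorial_dvd_factorial_add _ _)

/-- The main estimate. If `T` commutes with the derivatives and turns multiplication by `x_c` into
`x_c + ρ_c ∂_{π c}`, where the regularity exponent of `π c` does not exceed the decay exponent
of `c`, then `T` maps each step space boundedly into one with a comparable parameter. -/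
theorem boundedBetween_of_intertwine {π : Equiv.Perm (Fin 3 × Fin d)} {ρ : Fin 3 × Fin d → ℂ}
    {s σ : Fin 3 → ℝ} (hs : ∀ j, 0 ≤ s j) (hσ : ∀ j, 0 ≤ σ j)
    (hsσ : ∀ c, ρ c ≠ 0 → σ (π c).1 ≤ s c.1)
    {T : 𝓢(Space d, ℂ) →L[ℂ] 𝓢(Space d, ℂ)} (hder : ∀ c F, derX c (T F) = T (derX c F))
    (hmul : ∀ c F, mulX c (T F) = T (mulX c F + ρ c • derX (π c) F))
    {R : ℝ} (hR0 : 0 ≤ R) (hR : ∀ c, ‖ρ c‖ ≤ R) {K : ℝ}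
    (hK : ∀ j, (4 : ℝ) ^ (s j + σ j) ≤ K) {h κ B : ℝ} (hh : 0 < h) (hκ : 1 ≤ κ) (hB : 0 ≤ B)
    (hj : ∀ (c : Fin 3 × Fin d) (j : ℕ),
      (j ! : ℝ) ≤ B * κ ^ j * h ^ (2 * j) * ((j ! : ℝ) ^ s c.1 * (j ! : ℝ) ^ σ c.1)) :
    BoundedBetween s σ h ((1 + R) * K * (2 * κ) * h) T := by
  obtain ⟨L, C, hC, hT⟩ := exists_degree_bound T
  have hK1 : 1 ≤ K := (Real.one_le_rpow (by norm_num) (add_nonneg (hs 0) (hσ 0))).trans (hK 0)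
  set H : ℝ := 2 * κ * h with hHdef
  have hH : 0 < H := by positivity
  set E : Fin 3 × Fin d → ℝ := fun c => B * ((max 1 H) ^ (2 * L) *
    ((2 ^ L * L ! : ℝ) ^ s c.1 * (2 ^ L * L ! : ℝ) ^ σ c.1)) with hE
  have hE0 : ∀ c, 0 ≤ E c := fun c => by positivity
  have hE1 : 0 ≤ ∏ c, E c := Finset.prod_nonneg fun c _ => hE0 c
  refine ⟨C * ∏ c, E c, by positivity, fun F A hA => ?_⟩
  have hA0 : 0 ≤ A := (quotient_nonneg s σ hh F (0, 0, 0)).trans (hA _)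
  have hF : ∀ α β x, ‖(monomial α x : ℂ) * partialDeriv β F x‖ ≤
      A * ∏ c, coordWeight h (s c.1) (σ c.1) (α c) (β c) := fun α β x => by
    rw [← weight_eq_prod]
    exact norm_le_of_quotient_le hh hA α β x
  refine quotient_le_of_norm_le (by positivity) fun α β x => ?_
  obtain ⟨lα, rfl⟩ := exists_countIdx_eq α
  obtain ⟨lβ, rfl⟩ := exists_countIdx_eq β
  set α := countIdx lα with hα
  set β := countIdx lβ with hβ
  rw [← wordOp_inr_apply, wordOp_map_inr_commute hder, ← wordOp_inl_apply,
    wordOp_map_inl_intertwine hmul]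
  -- bound for a single word of the expansion
  have hword : ∀ w, Expansion π ρ lα w → ∀ γ δ : MultiIndex d, ∑ c, γ c ≤ L → ∑ c, δ c ≤ L →
      ∀ y, ‖(monomial γ y : ℂ) * partialDeriv δ (wordOp w (wordOp (lβ.map Sum.inr) F)) y‖ ≤
        A * ((∏ c, E c) * ((K * H) ^ (∑ c, (α c + β c)) *
          ∏ c, ((α c)! : ℝ) ^ s c.1 * ((β c)! : ℝ) ^ σ c.1)) := by
    intro w hw γ δ hγ hδ y
    have hcγ : ∀ c, γ c ≤ L := fun c =>
      (Finset.single_le_sum (f := γ) (fun _ _ => Nat.zero_le _) (Finset.mem_univ c)).trans hγ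
    have hcδ : ∀ c, δ c ≤ L := fun c =>
      (Finset.single_le_sum (f := δ) (fun _ _ => Nat.zero_le _) (Finset.mem_univ c)).trans hδ
    rw [← wordOp_append]
    refine (norm_wordOp_le (fun c => coordWeight_nonneg hh.le _ _) hA0 hF _ γ δ y).trans ?_
    refine mul_le_mul_of_nonneg_left ?_ hA0
    rw [mulIdx_append_map_inr, derIdx_append_map_inr]
    have hc : ∀ c, ordBound (coordWeight h (s c.1) (σ c.1)) (γ c)
        (δ c + (derIdx w + countIdx lβ) c) (mulIdx w c) ≤
        E c * ((K * H) ^ (mulIdx w c + derIdx w c + β c) *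
          (((mulIdx w c)! : ℝ) ^ s c.1 * (((derIdx w c)! : ℝ) ^ σ c.1 *
            ((β c)! : ℝ) ^ σ c.1))) := fun c => by
      refine (ordBound_coordWeight_le hh (hs _) (hσ _) hκ hB (hj c) _ _ _).trans ?_
      rw [hE, mul_assoc B]
      refine mul_le_mul_of_nonneg_left ?_ hB
      exact coordWeight_add_le hH (hs _) (hσ _) (hK _) (hcγ c) (hcδ c) _ _ _
    refine (Finset.prod_le_prod (fun c _ => ordBound_nonneg (coordWeight_nonneg hh.le _ _) _ _ _)
      fun c _ => hc c).trans ?_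
    simp only [Finset.prod_mul_distrib, Finset.prod_pow_eq_pow_sum]
    refine mul_le_mul_of_nonneg_left ?_ hE1
    have hsum : ∑ c, (mulIdx w c + derIdx w c + β c) = ∑ c, (α c + β c) := by
      simp only [Finset.sum_add_distrib]
      rw [← Equiv.sum_comp π (derIdx w), ← Finset.sum_add_distrib]
      simp only [hw.mulIdx_add_derIdx, hα]
    rw [hsum, ← mul_assoc (∏ c, _)]
    refine mul_le_mul_of_nonneg_left ?_ (by positivity)
    exact mul_le_mul_of_nonneg_right (hw.prod_factorial_le hs hsσ)
      (Finset.prod_nonneg fun c _ => (factorial_rpow_pos _ _).le)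
  have hW0 : (0 : ℝ) ≤ ∏ c, ((α c)! : ℝ) ^ s c.1 * ((β c)! : ℝ) ^ σ c.1 :=
    Finset.prod_nonneg fun c _ => (mul_pos (factorial_rpow_pos _ _) (factorial_rpow_pos _ _)).le
  set M : ℝ := A * ((∏ c, E c) * ((K * H) ^ (∑ c, (α c + β c)) *
          ∏ c, ((α c)! : ℝ) ^ s c.1 * ((β c)! : ℝ) ^ σ c.1)) with hM
  have hM0 : 0 ≤ M := by positivity
  refine (hT (twistOp π ρ lα (wordOp (lβ.map Sum.inr) F)) ((1 + R) ^ lα.length * M)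
    (fun γ δ hγ hδ y => ?_) x).trans ?_
  · exact norm_twistOp_le hR hR0 hM0 lα (evalMonomialDeriv γ δ y)
      fun w hw => hword w hw γ δ hγ hδ y
  · have hwt : weight s σ ((1 + R) * K * (2 * κ) * h) α β =
        ((1 + R) * K * (2 * κ) * h) ^ (∑ c, (α c + β c)) *
          ∏ c, ((α c)! : ℝ) ^ s c.1 * ((β c)! : ℝ) ^ σ c.1 := by
      rw [weight_eq_prod]
      unfold coordWeight
      rw [Finset.prod_mul_distrib, Finset.prod_pow_eq_pow_sum]
    rw [hwt]
    have hlen : (1 + R) ^ lα.length ≤ (1 + R) ^ (∑ c, (α c + β c)) := by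
      refine pow_le_pow_right₀ (by linarith) ?_
      rw [Finset.sum_add_distrib, hα, sum_countIdx]
      exact Nat.le_add_right _ _
    calc C * ((1 + R) ^ lα.length * M) ≤ C * ((1 + R) ^ (∑ c, (α c + β c)) * M) := by gcongr
      _ = _ := by
        rw [hM, show (1 + R) * K * (2 * κ) * h = (1 + R) * (K * H) by rw [hHdef]; ring,
          mul_pow (1 + R)]
        ring

/-- A Roumieu space is mapped into itself: the parameter `h` may grow. -/
theorem exists_boundedBetween_of_intertwine {π : Equiv.Perm (Fin 3 × Fin d)}
    {ρ : Fin 3 × Fin d → ℂ} {s σ : Fin 3 → ℝ} (hs : ∀ j, 0 ≤ s j) (hσ : ∀ j, 0 ≤ σ j)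
    (hsσ : ∀ c, ρ c ≠ 0 → σ (π c).1 ≤ s c.1)
    {T : 𝓢(Space d, ℂ) →L[ℂ] 𝓢(Space d, ℂ)} (hder : ∀ c F, derX c (T F) = T (derX c F))
    (hmul : ∀ c F, mulX c (T F) = T (mulX c F + ρ c • derX (π c) F))
    (h1 : ∀ j, 1 ≤ s j + σ j) {h : ℝ} (hh : 0 < h) :
    ∃ h' : ℝ, 0 < h' ∧ BoundedBetween s σ h h' T := by
  have hR : ∀ c, ‖ρ c‖ ≤ ∑ c, ‖ρ c‖ := fun c =>
    Finset.single_le_sum (f := fun c => ‖ρ c‖) (fun _ _ => norm_nonneg _) (Finset.mem_univ c)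
  have hK : ∀ j, (4 : ℝ) ^ (s j + σ j) ≤ ∑ j, (4 : ℝ) ^ (s j + σ j) := fun j =>
    Finset.single_le_sum (f := fun j => (4 : ℝ) ^ (s j + σ j)) (fun _ _ => by positivity)
      (Finset.mem_univ j)
  refine ⟨_, ?_, boundedBetween_of_intertwine hs hσ hsσ hder hmul
    (Finset.sum_nonneg fun _ _ => norm_nonneg _) hR hK hh
    (κ := max 1 (h ^ 2)⁻¹) (B := 1) (le_max_left _ _) zero_le_one fun c j => ?_⟩
  · have : 0 < ∑ j, (4 : ℝ) ^ (s j + σ j) := by positivity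
    positivity
  -- `κ = max 1 h⁻²` compensates the factor `h^{2j}`
  · rw [← Real.rpow_add (by positivity), one_mul, pow_mul, ← mul_pow]
    have hf : (1 : ℝ) ≤ (j ! : ℝ) := by exact_mod_cast Nat.one_le_iff_ne_zero.2 j.factorial_ne_zero
    have h2 : (1 : ℝ) ≤ (max 1 (h ^ 2)⁻¹ * h ^ 2) ^ j := by
      refine one_le_pow₀ ?_
      calc (1 : ℝ) = (h ^ 2)⁻¹ * h ^ 2 := (inv_mul_cancel₀ (by positivity)).symm
        _ ≤ _ := by gcongr; exact le_max_right _ _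
    calc (j ! : ℝ) = 1 * (j ! : ℝ) ^ (1 : ℝ) := by rw [Real.rpow_one, one_mul]
      _ ≤ _ := mul_le_mul h2 (Real.rpow_le_rpow_of_exponent_le hf (h1 _)) (by positivity)
          (by positivity)

/-- A Beurling space is mapped into itself if `s + σ > 1`: every target parameter can be reached. -/
theorem exists_boundedBetween_of_intertwine' {π : Equiv.Perm (Fin 3 × Fin d)}
    {ρ : Fin 3 × Fin d → ℂ} {s σ : Fin 3 → ℝ} (hs : ∀ j, 0 ≤ s j) (hσ : ∀ j, 0 ≤ σ j)
    (hsσ : ∀ c, ρ c ≠ 0 → σ (π c).1 ≤ s c.1)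
    {T : 𝓢(Space d, ℂ) →L[ℂ] 𝓢(Space d, ℂ)} (hder : ∀ c F, derX c (T F) = T (derX c F))
    (hmul : ∀ c F, mulX c (T F) = T (mulX c F + ρ c • derX (π c) F))
    (h1 : ∀ c : Fin 3 × Fin d, 1 < s c.1 + σ c.1) {h' : ℝ} (hh' : 0 < h') :
    ∃ h : ℝ, 0 < h ∧ BoundedBetween s σ h h' T := by
  have hR : ∀ c, ‖ρ c‖ ≤ ∑ c, ‖ρ c‖ := fun c =>
    Finset.single_le_sum (f := fun c => ‖ρ c‖) (fun _ _ => norm_nonneg _) (Finset.mem_univ c)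
  have hK : ∀ j, (4 : ℝ) ^ (s j + σ j) ≤ ∑ j, (4 : ℝ) ^ (s j + σ j) := fun j =>
    Finset.single_le_sum (f := fun j => (4 : ℝ) ^ (s j + σ j)) (fun _ _ => by positivity)
      (Finset.mem_univ j)
  have hK0 : 0 < ∑ j, (4 : ℝ) ^ (s j + σ j) := by positivity
  have hR0 : 0 ≤ ∑ c, ‖ρ c‖ := Finset.sum_nonneg fun _ _ => norm_nonneg _
  set R := ∑ c, ‖ρ c‖
  set K := ∑ j, (4 : ℝ) ^ (s j + σ j)
  set h := h' / ((1 + R) * K * (2 * 1)) with hhdef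
  have hh : 0 < h := by positivity
  have hB : ∀ c : Fin 3 × Fin d, ∃ B : ℝ, 0 ≤ B ∧ ∀ j : ℕ, (j ! : ℝ) ≤
      B * h ^ (2 * j) * ((j ! : ℝ) ^ s c.1 * (j ! : ℝ) ^ σ c.1) := by
    intro c
    set ε := s c.1 + σ c.1 - 1 with hε
    have hε0 : 0 < ε := by have := h1 c; linarith
    -- `y^j / j!` is bounded, and its `ε`-th power is `h^{-2j} / j!^ε`
    set y : ℝ := ((h ^ 2)⁻¹) ^ (ε⁻¹) with hy
    obtain ⟨D, hD⟩ := (FloorSemiring.tendsto_pow_div_factorial_atTop y).bddAbove_range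
    have hy0 : 0 ≤ y := by positivity
    have hD0 : 0 ≤ D := le_trans (by positivity) (hD ⟨0, rfl⟩)
    refine ⟨D ^ ε, by positivity, fun j => ?_⟩
    have hf : (0 : ℝ) < (j ! : ℝ) := by exact_mod_cast j.factorial_pos
    have h3 : y ^ j ≤ D * j ! := (div_le_iff₀ hf).1 (hD ⟨j, rfl⟩)
    have h4 : (y ^ j) ^ ε ≤ (D * j !) ^ ε := Real.rpow_le_rpow (by positivity) h3 hε0.le
    rw [Real.mul_rpow hD0 hf.le, ← Real.rpow_pow_comm hy0, hy, ← Real.rpow_mul (by positivity),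
      inv_mul_cancel₀ hε0.ne', Real.rpow_one] at h4
    have h5 : (j ! : ℝ) ^ s c.1 * (j ! : ℝ) ^ σ c.1 = (j ! : ℝ) ^ ε * j ! := by
      rw [← Real.rpow_add hf]
      conv_rhs => rw [← Real.rpow_one (j ! : ℝ), ← Real.rpow_mul hf.le, one_mul]
      rw [← Real.rpow_add hf, hε]
      congr 1; ring
    rw [h5, pow_mul]
    have h6 : 1 ≤ (D ^ ε * (j ! : ℝ) ^ ε) * (h ^ 2) ^ j := by
      calc (1 : ℝ) = ((h ^ 2)⁻¹) ^ j * (h ^ 2) ^ j := by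
            rw [← mul_pow, inv_mul_cancel₀ (by positivity), one_pow]
        _ ≤ _ := by gcongr
    nlinarith
  choose B hB0 hB using hB
  refine ⟨h, hh, ?_⟩
  have := boundedBetween_of_intertwine hs hσ hsσ hder hmul hR0 hR hK hh le_rfl
    (B := ∑ c, B c) (Finset.sum_nonneg fun c _ => hB0 c) fun c j => by
      rw [one_pow, mul_one]
      refine (hB c j).trans ?_
      have : B c ≤ ∑ c, B c := Finset.single_le_sum (fun c _ => hB0 c) (Finset.mem_univ c)
      gcongr
  rwa [hhdef, mul_div_cancel₀ _ (by positivity)] at this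

end

section

/-! ### Boundedness of `e^{-i⟨r D_ξ + t D_η, D_x⟩}` between step spaces -/

/-- The permutation of the coordinates that exchanges the blocks `j` and `k`. -/
def blockSwap (j k : Fin 3) : Equiv.Perm (Fin 3 × Fin d) :=
  (Equiv.swap j k).prodCongr (Equiv.refl _)

theorem mulX_expOp_left (r : ℝ) (c : Fin 3 × Fin d) (F : 𝓢(Space d, ℂ)) :
    mulX c (expOp r 0 F) = expOp r 0 (mulX c F +
      (if c.1 = 2 then 0 else -Complex.I * r : ℂ) • derX (blockSwap 0 1 c) F) := by
  rw [mulX_expOp]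
  obtain ⟨j, i⟩ := c
  fin_cases j <;> simp [blockSwap, mul_smul, Equiv.swap_apply_def]

theorem mulX_expOp_right (t : ℝ) (c : Fin 3 × Fin d) (F : 𝓢(Space d, ℂ)) :
    mulX c (expOp 0 t F) = expOp 0 t (mulX c F +
      (if c.1 = 1 then 0 else -Complex.I * t : ℂ) • derX (blockSwap 0 2 c) F) := by
  rw [mulX_expOp]
  obtain ⟨j, i⟩ := c
  fin_cases j <;> simp [blockSwap, mul_smul, Equiv.swap_apply_def]

theorem expOp_eq_comp (r t : ℝ) : expOp (d := d) r t = (expOp r 0).comp (expOp 0 t) := by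
  ext1 F
  rw [ContinuousLinearMap.comp_apply, expOp_expOp, add_zero, zero_add]

/-- The conditions on the exponents: the decay exponents are `s`, the regularity exponents `σ`. -/
structure Admissible (s σ : Fin 3 → ℝ) : Prop where
  pos : ∀ j, 0 < s j
  pos' : ∀ j, 0 < σ j
  one_le : ∀ j, 1 ≤ s j + σ j
  le₁₀ : σ 1 ≤ s 0
  le₂₀ : σ 2 ≤ s 0
  le₀₁ : σ 0 ≤ s 1
  le₀₂ : σ 0 ≤ s 2

variable {s σ : Fin 3 → ℝ}

theorem Admissible.left (H : Admissible s σ) (r : ℝ) (c : Fin 3 × Fin d)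
    (hc : (if c.1 = 2 then 0 else -Complex.I * r : ℂ) ≠ 0) : σ (blockSwap 0 1 c).1 ≤ s c.1 := by
  obtain ⟨j, i⟩ := c
  fin_cases j
  · simpa [blockSwap] using H.le₁₀
  · simpa [blockSwap] using H.le₀₁
  · simp at hc

theorem Admissible.right (H : Admissible s σ) (t : ℝ) (c : Fin 3 × Fin d)
    (hc : (if c.1 = 1 then 0 else -Complex.I * t : ℂ) ≠ 0) : σ (blockSwap 0 2 c).1 ≤ s c.1 := by
  obtain ⟨j, i⟩ := c
  fin_cases j
  · simpa [blockSwap] using H.le₂₀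
  · simp at hc
  · simpa [blockSwap] using H.le₀₂

theorem Admissible.exists_boundedBetween_expOp (H : Admissible s σ) (r t : ℝ) {h : ℝ}
    (hh : 0 < h) : ∃ h' : ℝ, 0 < h' ∧ BoundedBetween s σ h h' (expOp (d := d) r t) := by
  obtain ⟨h', hh', hS⟩ := exists_boundedBetween_of_intertwine (fun j => (H.pos j).le)
    (fun j => (H.pos' j).le) (H.right t) (fun c F => (expOp_derX 0 t c F).symm)
    (mulX_expOp_right (d := d) t) H.one_le hh
  obtain ⟨h'', hh'', hT⟩ := exists_boundedBetween_of_intertwine (fun j => (H.pos j).le)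
    (fun j => (H.pos' j).le) (H.left r) (fun c F => (expOp_derX r 0 c F).symm)
    (mulX_expOp_left (d := d) r) H.one_le hh'
  exact ⟨h'', hh'', expOp_eq_comp (d := d) r t ▸ hT.comp hS⟩

theorem Admissible.exists_boundedBetween_expOp' (H : Admissible s σ)
    (h1 : ∀ c : Fin 3 × Fin d, 1 < s c.1 + σ c.1) (r t : ℝ) {h' : ℝ} (hh' : 0 < h') :
    ∃ h : ℝ, 0 < h ∧ BoundedBetween s σ h h' (expOp (d := d) r t) := by
  obtain ⟨h, hh, hT⟩ := exists_boundedBetween_of_intertwine' (fun j => (H.pos j).le)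
    (fun j => (H.pos' j).le) (H.left r) (fun c F => (expOp_derX r 0 c F).symm)
    (mulX_expOp_left (d := d) r) h1 hh'
  obtain ⟨h₀, hh₀, hS⟩ := exists_boundedBetween_of_intertwine' (fun j => (H.pos j).le)
    (fun j => (H.pos' j).le) (H.right t) (fun c F => (expOp_derX 0 t c F).symm)
    (mulX_expOp_right (d := d) t) h1 hh
  exact ⟨h₀, hh₀, expOp_eq_comp (d := d) r t ▸ hT.comp hS⟩

end

section

/-! ### Triviality of Beurling spaces on the critical line -/

/-- The series `∑ r^n / n!^a`. -/
def powerSum (a r : ℝ) : ℝ := ∑' n : ℕ, r ^ n / (n ! : ℝ) ^ a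

theorem summable_powerSum {a : ℝ} (ha : 0 < a) {r : ℝ} (hr : 0 ≤ r) :
    Summable fun n : ℕ => r ^ n / (n ! : ℝ) ^ a := by
  -- `y^n / n!` is bounded, and its `a`-th power is `(2 r)^n / n!^a`
  set y : ℝ := (2 * r) ^ a⁻¹ with hy
  obtain ⟨D, hD⟩ := (FloorSemiring.tendsto_pow_div_factorial_atTop y).bddAbove_range
  have hy0 : 0 ≤ y := by positivity
  have hD0 : 0 ≤ D := le_trans (by positivity) (hD ⟨0, rfl⟩)
  refine Summable.of_nonneg_of_le (fun n => by positivity) (fun n => ?_)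
    ((summable_geometric_two).mul_left (D ^ a))
  have hf : (0 : ℝ) < (n ! : ℝ) := by exact_mod_cast n.factorial_pos
  have h3 : y ^ n ≤ D * n ! := (div_le_iff₀ hf).1 (hD ⟨n, rfl⟩)
  have h4 : (y ^ n) ^ a ≤ (D * n !) ^ a := Real.rpow_le_rpow (by positivity) h3 ha.le
  rw [Real.mul_rpow hD0 hf.le, ← Real.rpow_pow_comm hy0, hy, ← Real.rpow_mul (by positivity),
    inv_mul_cancel₀ ha.ne', Real.rpow_one, mul_pow] at h4
  rw [div_le_iff₀ (factorial_rpow_pos n a)]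
  have h2 : (1 / 2 : ℝ) ^ n * 2 ^ n = 1 := by rw [← mul_pow]; norm_num
  calc r ^ n = (1 / 2) ^ n * (2 ^ n * r ^ n) := by rw [← mul_assoc, h2, one_mul]
    _ ≤ (1 / 2) ^ n * (D ^ a * (n ! : ℝ) ^ a) := by gcongr
    _ = _ := by ring

theorem powerSum_pos {a : ℝ} (ha : 0 < a) {r : ℝ} (hr : 0 ≤ r) : 0 < powerSum a r :=
  (summable_powerSum ha hr).tsum_pos
    (fun n => div_nonneg (pow_nonneg hr n) (factorial_rpow_pos n a).le) 0 (by simp)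

theorem succ_rpow_le_two_pow {a : ℝ} (ha1 : a ≤ 1) (n : ℕ) :
    ((n + 1 : ℕ) : ℝ) ^ a ≤ 2 ^ n := by
  have h1 : (1 : ℝ) ≤ (n + 1 : ℕ) := by exact_mod_cast Nat.succ_le_succ n.zero_le
  calc ((n + 1 : ℕ) : ℝ) ^ a ≤ ((n + 1 : ℕ) : ℝ) ^ (1 : ℝ) :=
        Real.rpow_le_rpow_of_exponent_le h1 ha1
    _ = (n + 1 : ℕ) := Real.rpow_one _
    _ ≤ 2 ^ n := by exact_mod_cast Nat.lt_two_pow_self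

theorem factorial_succ_rpow (n : ℕ) (a : ℝ) :
    ((n + 1)! : ℝ) ^ a = ((n + 1 : ℕ) : ℝ) ^ a * (n ! : ℝ) ^ a := by
  rw [Nat.factorial_succ, Nat.cast_mul, Real.mul_rpow (by positivity) (by positivity)]

/-- Halving the argument of the growth function `∑ r^n / n!^a` gains a factor of `1 + r`. -/
theorem one_add_mul_powerSum_le {a : ℝ} (ha : 0 < a) (ha1 : a ≤ 1) {r : ℝ} (hr : 0 ≤ r) :
    (1 + r) * powerSum a (r / 2) ≤ 2 * powerSum a r := by
  have hs := summable_powerSum ha hr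
  have hs2 := summable_powerSum ha (div_nonneg hr zero_le_two)
  have h1 : powerSum a (r / 2) ≤ powerSum a r := by
    refine hs2.tsum_le_tsum (fun n => ?_) hs
    have := factorial_rpow_pos n a
    gcongr
    linarith
  have h2 : r * powerSum a (r / 2) ≤ powerSum a r := by
    unfold powerSum
    rw [← tsum_mul_left, hs.tsum_eq_zero_add]
    refine le_add_of_nonneg_of_le (by positivity) ?_
    refine (hs2.mul_left r).tsum_le_tsum (fun n => ?_) ((summable_nat_add_iff 1).2 hs)
    have p1 := factorial_rpow_pos n a
    have p2 := factorial_rpow_pos (n + 1) a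
    rw [← mul_div_assoc, div_le_div_iff₀ p1 p2, factorial_succ_rpow, div_pow]
    have h3 := succ_rpow_le_two_pow ha1 n
    calc r * (r ^ n / 2 ^ n) * (((n + 1 : ℕ) : ℝ) ^ a * (n ! : ℝ) ^ a)
        ≤ r * (r ^ n / 2 ^ n) * (2 ^ n * (n ! : ℝ) ^ a) := by gcongr
      _ = r ^ (n + 1) * (n ! : ℝ) ^ a := by field_simp; ring
  linarith

section Entire

variable {g : ℕ → ℝ → ℂ} {a C : ℝ}

/-- The function `x + i y ↦ ∑ g_n(x) (i y)^n / n!`. If `g_n` is the `n`-th derivative of `g_0`,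
this is the holomorphic extension of `g_0`. -/
def holoExt (g : ℕ → ℝ → ℂ) (z : ℂ) : ℂ := ∑' n : ℕ, g n z.re * (Complex.I * z.im) ^ n / (n ! : ℂ)

theorem norm_holoExt_term_le (hg : ∀ n τ, ‖g n τ‖ ≤ C * (n ! : ℝ) ^ (1 - a)) (n : ℕ) (z : ℂ) :
    ‖g n z.re * (Complex.I * z.im) ^ n / (n ! : ℂ)‖ ≤ C * (|z.im| ^ n / (n ! : ℝ) ^ a) := by
  have p1 := factorial_rpow_pos n a
  have hf : (0 : ℝ) < (n ! : ℝ) := by exact_mod_cast n.factorial_pos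
  have h1 := hg n z.re
  rw [Real.rpow_sub hf, Real.rpow_one] at h1
  rw [norm_div, norm_mul, norm_pow, norm_mul, Complex.norm_I, one_mul, Complex.norm_real,
    Complex.norm_natCast, Real.norm_eq_abs]
  calc ‖g n z.re‖ * |z.im| ^ n / (n ! : ℝ) ≤
      (C * ((n ! : ℝ) / (n ! : ℝ) ^ a)) * |z.im| ^ n / (n ! : ℝ) := by gcongr
    _ = _ := by field_simp

/-- The series may be differentiated termwise in the real sense. With `A_n` the real-part derivative
of the `n`-th term, the imaginary-part derivative of the `n + 1`-st term is `i A_n`, so that the sum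
satisfies the Cauchy-Riemann equations. -/
theorem differentiable_holoExt (ha : 0 < a)
    (hd : ∀ n τ, HasDerivAt (g n) (g (n + 1) τ) τ)
    (hg : ∀ n τ, ‖g n τ‖ ≤ C * (n ! : ℝ) ^ (1 - a)) : Differentiable ℂ (holoExt g) := by
  intro z₀
  have hC : 0 ≤ C := by simpa using (norm_nonneg _).trans (hg 0 0)
  set R : ℝ := |z₀.im| + 1 with hR
  have hR1 : 1 ≤ R := by rw [hR]; linarith [abs_nonneg z₀.im]
  let A : ℕ → ℂ → ℂ := fun n z => g (n + 1) z.re * (Complex.I * z.im) ^ n / (n ! : ℂ)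
  let B : ℕ → ℂ → ℂ := fun n z =>
    g n z.re * (n * (Complex.I * z.im) ^ (n - 1) * Complex.I) / (n ! : ℂ)
  let reC : ℂ →L[ℝ] ℂ := Complex.ofRealCLM.comp Complex.reCLM
  let imC : ℂ →L[ℝ] ℂ := Complex.ofRealCLM.comp Complex.imCLM
  have hder : ∀ n z, HasFDerivAt (fun z : ℂ => g n z.re * (Complex.I * z.im) ^ n / (n ! : ℂ))
      (A n z • reC + B n z • imC) z := by
    intro n z
    have h1 : HasFDerivAt (fun z : ℂ => g n z.re) _ z :=
      (hd n z.re).hasFDerivAt.comp z Complex.reCLM.hasFDerivAt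
    have h2 : HasFDerivAt (fun z : ℂ => Complex.I * (z.im : ℂ)) (Complex.I • imC) z :=
      imC.hasFDerivAt.const_mul Complex.I
    have h3 := (h1.mul (h2.pow n)).mul_const ((n ! : ℂ)⁻¹)
    simp only [← div_eq_mul_inv] at h3
    refine h3.congr_fderiv ?_
    ext w
    all_goals simp [A, B, reC, imC]; try ring
  have hA : ∀ n z, |z.im| ≤ R → ‖A n z‖ ≤ C * ((2 * R) ^ n / (n ! : ℝ) ^ a) := by
    intro n z hz
    have p1 := factorial_rpow_pos n a
    have hf : (0 : ℝ) < (n ! : ℝ) := by exact_mod_cast n.factorial_pos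
    have h1 := hg (n + 1) z.re
    rw [factorial_succ_rpow, Real.rpow_sub hf, Real.rpow_one] at h1
    have h2 := succ_rpow_le_two_pow (a := 1 - a) (by linarith) n
    simp only [A]
    rw [norm_div, norm_mul, norm_pow, norm_mul, Complex.norm_I, one_mul, Complex.norm_real,
      Complex.norm_natCast, Real.norm_eq_abs]
    calc ‖g (n + 1) z.re‖ * |z.im| ^ n / (n ! : ℝ) ≤
        (C * (2 ^ n * ((n ! : ℝ) / (n ! : ℝ) ^ a))) * R ^ n / (n ! : ℝ) := by
          gcongr
          exact h1.trans (by gcongr)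
      _ = _ := by rw [mul_pow]; field_simp
  have hBA : ∀ n z, B (n + 1) z = Complex.I * A n z := by
    intro n z
    simp only [A, B, Nat.add_sub_cancel, Nat.factorial_succ]
    have hf : ((n ! : ℕ) : ℂ) ≠ 0 := by exact_mod_cast n.factorial_ne_zero
    have hn : ((n + 1 : ℕ) : ℂ) ≠ 0 := by exact_mod_cast n.succ_ne_zero
    push_cast at hn ⊢
    field_simp
  have hB0 : ∀ z, B 0 z = 0 := fun z => by simp [B]
  have hsR := (summable_powerSum ha (by positivity : 0 ≤ 2 * R)).mul_left C
  have hBn : ∀ n z, |z.im| ≤ R → ‖B n z‖ ≤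
      (fun n => if n = 0 then 0 else C * ((2 * R) ^ (n - 1) / ((n - 1)! : ℝ) ^ a)) n := by
    intro n z hz
    rcases n with _ | n
    · simp [hB0]
    · rw [hBA, norm_mul, Complex.norm_I, one_mul]
      simpa using hA n z hz
  have hsB : Summable
      (fun n : ℕ => if n = 0 then 0 else C * ((2 * R) ^ (n - 1) / ((n - 1)! : ℝ) ^ a)) := by
    rw [← summable_nat_add_iff 1]
    simpa using hsR
  let S : Set ℂ := {z | |z.im| < R}
  have hSopen : IsOpen S := isOpen_lt (Complex.continuous_im.abs) continuous_const
  have hSconv : Convex ℝ S := by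
    have : S = Complex.imLm ⁻¹' Metric.ball 0 R := by ext z; simp [S]
    rw [this]
    exact (convex_ball _ _).linear_preimage _
  have hz₀ : z₀ ∈ S := by simp only [S, Set.mem_ofPred_eq, hR]; linarith
  have hreC : ‖reC‖ ≤ 1 := ContinuousLinearMap.opNorm_le_bound _ zero_le_one fun w => by
    simpa [reC] using Complex.abs_re_le_norm w
  have himC : ‖imC‖ ≤ 1 := ContinuousLinearMap.opNorm_le_bound _ zero_le_one fun w => by
    simpa [imC] using Complex.abs_im_le_norm w
  have hmain := hasFDerivAt_tsum_of_isPreconnected (hsR.add hsB) hSopen hSconv.isPreconnected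
    (fun n z _ => hder n z) (fun n z hz => by
      refine (norm_add_le _ _).trans (add_le_add ?_ ?_)
      · rw [norm_smul]
        exact (mul_le_of_le_one_right (norm_nonneg _) hreC).trans (hA n z hz.le)
      · rw [norm_smul]
        exact (mul_le_of_le_one_right (norm_nonneg _) himC).trans (hBn n z hz.le))
    hz₀ (Summable.of_norm_bounded
      ((summable_powerSum ha (abs_nonneg z₀.im)).mul_left C)
      fun n => norm_holoExt_term_le hg n z₀) hz₀
  have hsA : HasSum (fun n => A n z₀) (∑' n, A n z₀) :=
    (Summable.of_norm_bounded hsR fun n => hA n z₀ hz₀.le).hasSum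
  have hsB' : HasSum (fun n => B n z₀) (Complex.I * ∑' n, A n z₀) := by
    rw [← hasSum_nat_add_iff' 1]
    simpa [hB0, hBA] using hsA.mul_left Complex.I
  -- the Cauchy-Riemann equations: the real derivative is multiplication by `∑ A_n`
  have hsum : ∑' n, (A n z₀ • reC + B n z₀ • imC) =
      ((∑' n, A n z₀) • ContinuousLinearMap.id ℂ ℂ).restrictScalars ℝ := by
    rw [((hsA.smul_const reC).add (hsB'.smul_const imC)).tsum_eq]
    ext w
    simp only [add_apply, smul_apply, smul_eq_mul,
      ContinuousLinearMap.coe_restrictScalars', ContinuousLinearMap.id_apply, reC, imC,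
      ContinuousLinearMap.comp_apply, Complex.reCLM_apply, Complex.imCLM_apply,
      Complex.ofRealCLM_apply]
    conv_rhs => rw [← Complex.re_add_im w]
    ring
  rw [hsum] at hmain
  exact (hasFDerivAt_of_restrictScalars ℝ hmain rfl).differentiableAt

/-- Summing the bounds for `x^m H(x + i y)` over `m` gives decay in `x` against growth in `y`. The
factor `1 / 2` in the hypothesis leads to `|y| / 2` on the right. -/
theorem powerSum_mul_norm_holoExt_le (ha : 0 < a)
    (hg : ∀ m n τ, |τ| ^ m * ‖g n τ‖ ≤
      C * (1 / 2) ^ (m + n) * ((m ! : ℝ) ^ a * (n ! : ℝ) ^ (1 - a))) (z : ℂ) :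
    powerSum a |z.re| * ‖holoExt g z‖ ≤ 2 * C * powerSum a (|z.im| / 2) := by
  have hsx := summable_powerSum ha (abs_nonneg z.re)
  have hsy := summable_powerSum ha (div_nonneg (abs_nonneg z.im) zero_le_two)
  have hm : ∀ m : ℕ, |z.re| ^ m / (m ! : ℝ) ^ a * ‖holoExt g z‖ ≤
      (C * powerSum a (|z.im| / 2)) * (1 / 2) ^ m := by
    intro m
    have p1 := factorial_rpow_pos m a
    have h1 : ∀ n : ℕ, ‖(|z.re| ^ m : ℂ) * (g n z.re * (Complex.I * z.im) ^ n / (n ! : ℂ))‖ ≤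
        (C * (1 / 2) ^ m * (m ! : ℝ) ^ a) * ((|z.im| / 2) ^ n / (n ! : ℝ) ^ a) := by
      intro n
      have p2 := factorial_rpow_pos n a
      have hf : (0 : ℝ) < (n ! : ℝ) := by exact_mod_cast n.factorial_pos
      have h1 := hg m n z.re
      rw [Real.rpow_sub hf, Real.rpow_one] at h1
      rw [norm_mul, norm_div, norm_mul, norm_pow, norm_pow, norm_mul, Complex.norm_I, one_mul,
        Complex.norm_real, Complex.norm_real, Complex.norm_natCast, Real.norm_eq_abs,
        Real.norm_eq_abs, abs_abs]
      calc |z.re| ^ m * (‖g n z.re‖ * |z.im| ^ n / (n ! : ℝ))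
          = (|z.re| ^ m * ‖g n z.re‖) * |z.im| ^ n / (n ! : ℝ) := by ring
        _ ≤ (C * (1 / 2) ^ (m + n) * ((m ! : ℝ) ^ a * ((n ! : ℝ) / (n ! : ℝ) ^ a))) *
              |z.im| ^ n / (n ! : ℝ) := by gcongr
        _ = _ := by
          rw [pow_add, div_pow |z.im|, div_pow 1 (2 : ℝ) n, one_pow]
          field_simp
    have h2 : ‖(|z.re| ^ m : ℂ) * holoExt g z‖ ≤
        (C * (1 / 2) ^ m * (m ! : ℝ) ^ a) * powerSum a (|z.im| / 2) := by
      unfold holoExt powerSum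
      rw [← tsum_mul_left]
      exact tsum_of_norm_bounded (hsy.hasSum.mul_left _) h1
    rw [norm_mul, norm_pow, Complex.norm_real, Real.norm_eq_abs, abs_abs] at h2
    rw [div_mul_eq_mul_div, div_le_iff₀ p1]
    refine h2.trans_eq ?_
    ring
  have hsum := (hsx.mul_right ‖holoExt g z‖).tsum_le_tsum hm (summable_geometric_two.mul_left _)
  rw [tsum_mul_right, tsum_mul_left, tsum_geometric_two] at hsum
  refine hsum.trans_eq ?_
  ring

/-- The one-dimensional triviality result. The holomorphic extension `H` of `g_0` satisfies
`|H(x + i y)| ≤ 2 C E(|y| / 2) / E(|x|)` with `E(r) = ∑ r^n / n!^a`, so that `H(z) H(i z)` tends to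
zero at infinity and vanishes by Liouville's theorem. -/
theorem eq_zero_of_critical_bounds (ha : 0 < a) (ha1 : a ≤ 1)
    (hd : ∀ n τ, HasDerivAt (g n) (g (n + 1) τ) τ)
    (hg : ∀ m n τ, |τ| ^ m * ‖g n τ‖ ≤
      C * (1 / 2) ^ (m + n) * ((m ! : ℝ) ^ a * (n ! : ℝ) ^ (1 - a))) (τ : ℝ) : g 0 τ = 0 := by
  have hC : 0 ≤ C := by simpa using (norm_nonneg _).trans (by simpa using hg 0 0 0)
  have hg0 : ∀ n τ, ‖g n τ‖ ≤ C * (n ! : ℝ) ^ (1 - a) := fun n τ => by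
    have h1 := hg 0 n τ
    have p := factorial_rpow_pos n (1 - a)
    simp only [pow_zero, one_mul, Nat.factorial_zero, Nat.cast_one, Real.one_rpow, zero_add] at h1
    refine h1.trans ?_
    have : (1 / 2 : ℝ) ^ n ≤ 1 := pow_le_one₀ (by norm_num) (by norm_num)
    have : C * (1 / 2) ^ n ≤ C := mul_le_of_le_one_right hC this
    gcongr
  have hH := differentiable_holoExt ha hd hg0
  have hHI : Differentiable ℂ fun z => holoExt g (Complex.I * z) :=
    hH.comp (differentiable_id.const_mul Complex.I)
  have hbound : ∀ z : ℂ, ‖holoExt g z * holoExt g (Complex.I * z)‖ * ‖z‖ ≤ 16 * C ^ 2 := by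
    intro z
    have b1 := powerSum_mul_norm_holoExt_le ha hg z
    have b2 := powerSum_mul_norm_holoExt_le ha hg (Complex.I * z)
    rw [Complex.I_mul_re, Complex.I_mul_im, abs_neg] at b2
    have hu := abs_nonneg z.re
    have hv := abs_nonneg z.im
    have c1 := one_add_mul_powerSum_le ha ha1 hu
    have c2 := one_add_mul_powerSum_le ha ha1 hv
    have p1 := powerSum_pos ha hu
    have p2 := powerSum_pos ha hv
    have q1 := powerSum_pos ha (div_nonneg hu zero_le_two)
    have q2 := powerSum_pos ha (div_nonneg hv zero_le_two)
    have hz : ‖z‖ ≤ (1 + |z.re|) * (1 + |z.im|) := by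
      refine (Complex.norm_le_abs_re_add_abs_im z).trans ?_
      nlinarith [mul_nonneg hu hv]
    set X := ‖holoExt g z‖
    set Y := ‖holoExt g (Complex.I * z)‖
    have hX : 0 ≤ X := norm_nonneg _
    have hY : 0 ≤ Y := norm_nonneg _
    rw [norm_mul]
    have hfin : (powerSum a |z.re| * powerSum a |z.im|) * (X * Y * ‖z‖) ≤
        (powerSum a |z.re| * powerSum a |z.im|) * (16 * C ^ 2) := by
      calc (powerSum a |z.re| * powerSum a |z.im|) * (X * Y * ‖z‖)
          = (powerSum a |z.re| * X) * (powerSum a |z.im| * Y) * ‖z‖ := by ring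
        _ ≤ (2 * C * powerSum a (|z.im| / 2)) * (2 * C * powerSum a (|z.re| / 2)) *
              ((1 + |z.re|) * (1 + |z.im|)) := by gcongr
        _ = 4 * C ^ 2 * (((1 + |z.re|) * powerSum a (|z.re| / 2)) *
              ((1 + |z.im|) * powerSum a (|z.im| / 2))) := by ring
        _ ≤ 4 * C ^ 2 * ((2 * powerSum a |z.re|) * (2 * powerSum a |z.im|)) := by gcongr
        _ = _ := by ring
    exact le_of_mul_le_mul_left hfin (mul_pos p1 p2)
  have hlim : Filter.Tendsto (fun z => holoExt g z * holoExt g (Complex.I * z))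
      (Filter.cocompact ℂ) (nhds 0) := by
    have h0 : Filter.Tendsto (fun z : ℂ => 16 * C ^ 2 / ‖z‖) (Filter.cocompact ℂ) (nhds 0) :=
      Filter.Tendsto.div_atTop tendsto_const_nhds (tendsto_norm_cocompact_atTop)
    refine squeeze_zero_norm' ?_ h0
    filter_upwards [(tendsto_norm_cocompact_atTop (E := ℂ)).eventually_gt_atTop 0] with z hz
    exact (le_div_iff₀ hz).2 (hbound z)
  have hzero : ∀ z, holoExt g z * holoExt g (Complex.I * z) = 0 := fun z =>
    (hH.mul hHI).apply_eq_of_tendsto_cocompact z hlim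
  have hor := AnalyticOnNhd.eq_zero_or_eq_zero_of_mul_eq_zero (U := Set.univ)
    (fun z _ => hH.analyticAt z) (fun z _ => hHI.analyticAt z) (fun z _ => hzero z)
    isPreconnected_univ
  have hall : ∀ z, holoExt g z = 0 := by
    rcases hor with h | h
    · exact fun z => h z trivial
    · intro z
      have := h (-Complex.I * z) trivial
      simpa [← mul_assoc] using this
  have := hall τ
  unfold holoExt at this
  rw [tsum_eq_single 0 (fun n hn => by simp [hn])] at this
  simpa using this

end Entire

/-- If `s_j + σ_j = 1` for some block `j` (and `d > 0`), the Beurling space is trivial. -/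
theorem Beurling.eq_zero_of_critical {s σ : Fin 3 → ℝ} (c : Fin 3 × Fin d) (hs : 0 < s c.1)
    (hσ : 0 ≤ σ c.1) (hc : s c.1 + σ c.1 = 1) (F : Beurling d s σ) : F = 0 := by
  apply Subtype.ext
  funext X
  obtain ⟨hF, A, hA⟩ := F.mem_step ⟨1 / 2, by norm_num⟩
  have hA' : ∀ p, quotient s σ (1 / 2) F.fn p ≤ A := fun p => hA ⟨p, rfl⟩
  let g : ℕ → ℝ → ℂ := fun n τ => partialDeriv (Pi.single c n) F.fn (X + (τ - X c) • basisVec c)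
  have key := eq_zero_of_critical_bounds (g := g) (C := A) hs (by linarith) (fun n τ => ?_)
    (fun m n τ => ?_) (X c)
  · have h0 : F.fn X = 0 := by simpa [g, partialDeriv_zero_index] using key
    exact h0
  · have h1 := (contDiff_partialDeriv hF (Pi.single c n)).differentiable (by simp)
      (X + (τ - X c) • basisVec c)
    have h2 : HasDerivAt (fun τ : ℝ => X + (τ - X c) • basisVec c) ((1 : ℝ) • basisVec c) τ :=
      (((hasDerivAt_id τ).sub_const _).smul_const _).const_add X
    have h3 := h1.hasFDerivAt.comp_hasDerivAt τ h2
    rw [one_smul, ← partialDeriv_add_single hF, ← Pi.single_add] at h3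
    exact h3
  · have h1 := norm_le_of_quotient_le (by norm_num) hA' (Pi.single c m) (Pi.single c n)
      (X + (τ - X c) • basisVec c)
    have h2 : weight s σ (1 / 2) (Pi.single c m) (Pi.single c n) =
        coordWeight (1 / 2) (s c.1) (σ c.1) m n := by
      rw [weight_eq_prod, Finset.prod_eq_single c (fun c' _ h => by simp [h, coordWeight])
        (by simp)]
      simp
    rw [monomial_single, h2, norm_mul] at h1
    have h3 : σ c.1 = 1 - s c.1 := by linarith
    simpa [basisVec_apply, coordWeight, h3, g, mul_assoc] using h1

end

section

/-! ### Density of the Schwartz functions in the dual spaces -/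

/-- A functional lies in a closed subspace `M` of the dual as soon as, up to an arbitrarily small
multiple of the norm, it is controlled by finitely many elements of `M`: by the Hahn-Banach theorem
it is the sum of a functional of small norm and of one vanishing on the common kernel. -/
theorem mem_of_forall_finset_ker {E : Type*} [SeminormedAddCommGroup E] [NormedSpace ℂ E]
    {M : Submodule ℂ (StrongDual ℂ E)} (hM : IsClosed (M : Set (StrongDual ℂ E)))
    {v : StrongDual ℂ E} (hv : ∀ ε > 0, ∃ t : Set (StrongDual ℂ E), t.Finite ∧ t ⊆ M ∧
      ∀ F, (∀ l ∈ t, l F = 0) → ‖v F‖ ≤ ε * ‖F‖) : v ∈ M := by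
  rw [← SetLike.mem_coe, ← hM.closure_eq, Metric.mem_closure_iff]
  intro ε hε
  obtain ⟨t, htf, htM, ht⟩ := hv (ε / 2) (half_pos hε)
  let N : Subspace ℂ E := ⨅ l : t, (l.1 : E →ₗ[ℂ] ℂ).ker
  have hN : ∀ F, F ∈ N ↔ ∀ l ∈ t, l F = 0 := fun F => by simp [N]
  obtain ⟨g, hg, hgn⟩ := exists_extension_norm_eq N (v.comp N.subtypeL)
  have hgε : ‖g‖ ≤ ε / 2 := by
    rw [hgn]
    exact ContinuousLinearMap.opNorm_le_bound _ (half_pos hε).le fun F => ht F ((hN F).1 F.2)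
  have hle : ⨅ l : t, (l.1 : E →ₗ[ℂ] ℂ).ker ≤ ((v - g : StrongDual ℂ E) : E →ₗ[ℂ] ℂ).ker := by
    intro F hF
    have h1 := hg ⟨F, hF⟩
    simp only [ContinuousLinearMap.comp_apply, Submodule.subtypeL_apply] at h1
    simp [h1]
  have : Finite t := htf
  have := Fintype.ofFinite t
  obtain ⟨a, ha⟩ := (Submodule.mem_span_range_iff_exists_fun ℂ).1 (mem_span_of_iInf_ker_le_ker hle)
  refine ⟨v - g, ?_, ?_⟩
  · have h2 : v - g = ∑ l : t, a l • l.1 := by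
      ext F
      have := LinearMap.congr_fun ha F
      simpa using this.symm
    rw [SetLike.mem_coe, h2]
    exact M.sum_mem fun l _ => M.smul_mem _ (htM l.2)
  · rw [dist_eq_norm, sub_sub_cancel]
    linarith

variable {s σ : Fin 3 → ℝ} {h h₁ : Scale}

/-- The bounded inclusion `𝒮_{s;h₁}^σ → 𝒮_{s;h}^σ` for `h₁ ≤ h`. -/
def Step.inclCLM (hle : h₁ ≤ h) : Step d s σ h₁ →L[ℂ] Step d s σ h :=
  LinearMap.mkContinuous
    (Submodule.inclusion (stepSubmodule_mono s σ hle) :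
      stepSubmodule d s σ h₁ →ₗ[ℂ] stepSubmodule d s σ h) 1 fun F => by
    rw [one_mul]
    exact ciSup_le fun p =>
      (quotient_mono s σ h₁.2 hle _ p).trans (Step.quotient_le (h := h₁) F p)

theorem Step.contDiff (F : Step d s σ h) : ContDiff ℝ ∞ F.fn := F.2.1

theorem Step.norm_monomial_mul_partialDeriv_le (F : Step d s σ h) (α β : MultiIndex d)
    (x : Space d) :
    ‖(monomial α x : ℂ) * partialDeriv β F.fn x‖ ≤ ‖F‖ * weight s σ h α β :=
  norm_le_of_quotient_le h.2 F.quotient_le α β x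

theorem Step.norm_partialDeriv_le (F : Step d s σ h) (β : MultiIndex d) (x : Space d) :
    ‖partialDeriv β F.fn x‖ ≤ ‖F‖ * weight s σ h 0 β := by
  simpa [monomial_zero_index] using F.norm_monomial_mul_partialDeriv_le 0 β x

/-- The functional `F ↦ ∂^β F(x)`. -/
def Step.derivAt (h : Scale) (β : MultiIndex d) (x : Space d) : StrongDual ℂ (Step d s σ h) :=
  LinearMap.mkContinuous
    { toFun := fun F => partialDeriv β F.fn x
      map_add' := fun F G => partialDeriv_add β F.2.1 G.2.1 x
      map_smul' := fun a F => partialDeriv_smul β a F.2.1 x }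
    (weight s σ h 0 β) fun F => (F.norm_partialDeriv_le β x).trans_eq (mul_comm _ _)

theorem Step.derivAt_apply (β : MultiIndex d) (x : Space d) (F : Step d s σ h) :
    Step.derivAt h β x F = partialDeriv β F.fn x := rfl

/-- A Lipschitz constant of `∂^β F` for `‖F‖ ≤ 1`. -/
def lipWeight (s σ : Fin 3 → ℝ) (h : ℝ) (β : MultiIndex d) : ℝ :=
  ∑ c, weight s σ h 0 (β + Pi.single c 1)

theorem lipWeight_nonneg (β : MultiIndex d) : 0 ≤ lipWeight s σ h β :=
  Finset.sum_nonneg fun _ _ => (weight_pos s σ h.2 _ _).le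

theorem Step.norm_partialDeriv_sub_le (F : Step d s σ h) (β : MultiIndex d) (x y : Space d) :
    ‖partialDeriv β F.fn y - partialDeriv β F.fn x‖ ≤ lipWeight s σ h β * ‖F‖ * ‖y - x‖ := by
  have hd := (contDiff_partialDeriv F.contDiff β).differentiable (by simp)
  refine Convex.norm_image_sub_le_of_norm_fderiv_le (𝕜 := ℝ) (fun z _ => hd z) (fun z _ => ?_)
    convex_univ (Set.mem_univ x) (Set.mem_univ y)
  refine ContinuousLinearMap.opNorm_le_bound _
    (mul_nonneg (lipWeight_nonneg β) (norm_nonneg F)) fun v => ?_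
  conv_lhs => rw [← sum_smul_basisVec v]
  rw [map_sum, lipWeight, Finset.sum_mul, Finset.sum_mul]
  refine (norm_sum_le _ _).trans (Finset.sum_le_sum fun c _ => ?_)
  rw [map_smul, norm_smul, mul_comm]
  have h1 := F.norm_partialDeriv_le (β + Pi.single c 1) z
  rw [partialDeriv_add_single F.contDiff, mul_comm] at h1
  exact mul_le_mul h1 (PiLp.norm_apply_le v c) (norm_nonneg _)
    (mul_nonneg (weight_pos s σ h.2 _ _).le (norm_nonneg F))

/-- The map `f ↦ (F ↦ ∫ f F)` from the Schwartz space to the dual of `𝒮_{s;h}^σ`. -/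
def pairingLM (h : Scale) : 𝓢(Space d, ℂ) →ₗ[ℂ] StrongDual ℂ (Step d s σ h) where
  toFun f := pairing h f
  map_add' f g := by
    ext F
    change ∫ x, (f x + g x) * F.fn x = (∫ x, f x * F.fn x) + ∫ x, g x * F.fn x
    rw [← MeasureTheory.integral_add (integrable_mul_step f F) (integrable_mul_step g F)]
    exact MeasureTheory.integral_congr_ae (.of_forall fun x => add_mul _ _ _)
  map_smul' a f := by
    ext F
    change ∫ x, (a * f x) * F.fn x = a * ∫ x, f x * F.fn x
    rw [← MeasureTheory.integral_const_mul]
    exact MeasureTheory.integral_congr_ae (.of_forall fun x => mul_assoc _ _ _)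

/-- The closure of the Schwartz functions in the dual of `𝒮_{s;h}^σ`. -/
def schwartzClosure (d : ℕ) (s σ : Fin 3 → ℝ) (h : Scale) :
    Submodule ℂ (StrongDual ℂ (Step d s σ h)) :=
  (LinearMap.range (pairingLM h)).topologicalClosure

theorem coe_schwartzClosure : (schwartzClosure d s σ h : Set (StrongDual ℂ (Step d s σ h))) =
    closure (Set.range (pairing h)) := rfl

theorem isClosed_schwartzClosure :
    IsClosed (schwartzClosure d s σ h : Set (StrongDual ℂ (Step d s σ h))) :=
  Submodule.isClosed_topologicalClosure _

/-- Dirac measures are limits of bump functions in the dual norm, because functions in the unit ball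
of `𝒮_{s;h}^σ` have a common Lipschitz constant. -/
theorem derivAt_zero_mem_schwartzClosure (x : Space d) :
    Step.derivAt h 0 x ∈ schwartzClosure d s σ h := by
  rw [← SetLike.mem_coe, coe_schwartzClosure, Metric.mem_closure_iff]
  intro ε hε
  set K := lipWeight (d := d) s σ h 0
  have hK : 0 ≤ K := lipWeight_nonneg 0
  set δ : ℝ := ε / (2 * (K + 1)) with hδ
  have hδ0 : 0 < δ := by positivity
  let b : ContDiffBump x := ⟨δ / 2, δ, by positivity, by linarith⟩
  let ρ : Space d → ℝ := b.normed MeasureTheory.volume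
  have hρc : HasCompactSupport ρ := b.hasCompactSupport_normed
  have hρ1 : ∫ y, ρ y = 1 := b.integral_normed
  let f : 𝓢(Space d, ℂ) := HasCompactSupport.toSchwartzMap (f := fun y => (ρ y : ℂ))
    (hρc.comp_left (g := fun y : ℝ => (y : ℂ)) Complex.ofReal_zero)
    (Complex.ofRealCLM.contDiff.comp b.contDiff_normed)
  have hf : ∀ y, f y = (ρ y : ℂ) := fun y => rfl
  refine ⟨pairing h f, ⟨f, rfl⟩, ?_⟩
  rw [dist_comm, dist_eq_norm]
  have hbound : ‖pairing (s := s) (σ := σ) h f - Step.derivAt h 0 x‖ ≤ K * δ := by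
    refine ContinuousLinearMap.opNorm_le_bound _ (by positivity) fun F => ?_
    have h1 : (pairing h f - Step.derivAt h 0 x : StrongDual ℂ (Step d s σ h)) F = ∫ y, (ρ y : ℂ) * (F.fn y - F.fn x) := by
      have h2 : ∫ y, (ρ y : ℂ) * F.fn x = F.fn x := by
        rw [MeasureTheory.integral_mul_const, integral_complex_ofReal, hρ1]
        simp
      have h3 : MeasureTheory.Integrable fun y => (ρ y : ℂ) * F.fn x :=
        f.integrable.mul_const (F.fn x)
      rw [sub_apply, Step.derivAt_apply, partialDeriv_zero_index]
      change (∫ y, f y * F.fn y) - F.fn x = _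
      conv_lhs => rw [← h2]
      rw [← MeasureTheory.integral_sub (integrable_mul_step f F) h3]
      exact MeasureTheory.integral_congr_ae (.of_forall fun y => (mul_sub _ _ _).symm)
    rw [h1]
    refine (MeasureTheory.norm_integral_le_of_norm_le
      (g := fun y => ρ y * (K * ‖F‖ * δ)) ?_ (.of_forall fun y => ?_)).trans_eq ?_
    · exact b.integrable_normed.mul_const _
    · have hρ0 : 0 ≤ ρ y := b.nonneg_normed y
      rw [norm_mul, Complex.norm_real, Real.norm_of_nonneg hρ0]
      by_cases hy : y ∈ Metric.ball x δ
      · refine mul_le_mul_of_nonneg_left ?_ hρ0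
        have h4 := F.norm_partialDeriv_sub_le 0 x y
        simp only [partialDeriv_zero_index] at h4
        refine h4.trans (mul_le_mul_of_nonneg_left ?_ (mul_nonneg hK (norm_nonneg F)))
        rw [← dist_eq_norm]
        exact (Metric.mem_ball.1 hy).le
      · have : ρ y = 0 := by
          have h5 := b.support_normed_eq (μ := MeasureTheory.volume)
          by_contra hne
          exact hy (h5 ▸ (Function.mem_support.2 hne))
        simp [this]
    · rw [MeasureTheory.integral_mul_const, hρ1]
      ring
  refine hbound.trans_lt ?_
  rw [hδ, ← mul_div_assoc, div_lt_iff₀ (by positivity)]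
  nlinarith

/-- Derivatives of Dirac measures are limits of difference quotients in the dual norm. -/
theorem derivAt_mem_schwartzClosure (β : MultiIndex d) :
    ∀ x, Step.derivAt h β x ∈ schwartzClosure d s σ h := by
  induction β using MultiIndex.induction with
  | h0 => exact derivAt_zero_mem_schwartzClosure
  | hs β c ih =>
    intro x
    rw [← SetLike.mem_coe, ← (isClosed_schwartzClosure (d := d)).closure_eq, Metric.mem_closure_iff]
    intro ε hε
    set K := lipWeight (d := d) s σ h (β + Pi.single c 1)
    have hK : 0 ≤ K := lipWeight_nonneg _
    set τ : ℝ := ε / (2 * (K + 1)) with hτ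
    have hτ0 : 0 < τ := by positivity
    refine ⟨((τ : ℂ)⁻¹) • (Step.derivAt h β (x + τ • basisVec c) - Step.derivAt h β x),
      Submodule.smul_mem _ _ (Submodule.sub_mem _ (ih _) (ih _)), ?_⟩
    rw [dist_comm, dist_eq_norm]
    have hbound : ‖((τ : ℂ)⁻¹) • (Step.derivAt h β (x + τ • basisVec c) - Step.derivAt h β x) -
        Step.derivAt (s := s) (σ := σ) h (β + Pi.single c 1) x‖ ≤ K * τ := by
      refine ContinuousLinearMap.opNorm_le_bound _ (by positivity) fun F => ?_
      set G := partialDeriv (β + Pi.single c 1) F.fn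
      have hder : ∀ u : ℝ, HasDerivAt
          (fun u : ℝ => partialDeriv β F.fn (x + u • basisVec c) - u • G x)
          (G (x + u • basisVec c) - G x) u := by
        intro u
        have h1 := (contDiff_partialDeriv F.contDiff β).differentiable (by simp)
          (x + u • basisVec c)
        have h2 : HasDerivAt (fun u : ℝ => x + u • basisVec c) ((1 : ℝ) • basisVec c) u :=
          ((hasDerivAt_id u).smul_const _).const_add x
        have h3 := h1.hasFDerivAt.comp_hasDerivAt u h2
        rw [one_smul, ← partialDeriv_add_single F.contDiff] at h3
        have h4 : HasDerivAt (fun u : ℝ => u • G x) ((1 : ℝ) • G x) u :=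
          (hasDerivAt_id u).smul_const _
        rw [one_smul] at h4
        exact h3.sub h4
      have hmv := norm_image_sub_le_of_norm_deriv_le_segment' (a := 0) (b := τ)
        (C := K * ‖F‖ * τ) (fun u _ => (hder u).hasDerivWithinAt) (fun u hu => by
          refine (F.norm_partialDeriv_sub_le _ x (x + u • basisVec c)).trans ?_
          refine mul_le_mul_of_nonneg_left ?_ (mul_nonneg hK (norm_nonneg F))
          rw [add_sub_cancel_left, norm_smul, norm_basisVec, mul_one, Real.norm_of_nonneg hu.1]
          exact hu.2.le) τ ⟨hτ0.le, le_rfl⟩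
      have h5 : (((τ : ℂ)⁻¹) • (Step.derivAt h β (x + τ • basisVec c) - Step.derivAt h β x) -
          Step.derivAt h (β + Pi.single c 1) x : StrongDual ℂ (Step d s σ h)) F = (τ : ℂ)⁻¹ *
            ((partialDeriv β F.fn (x + τ • basisVec c) - τ • G x) -
              (partialDeriv β F.fn (x + (0 : ℝ) • basisVec c) - (0 : ℝ) • G x)) := by
        have : (τ : ℂ) ≠ 0 := by exact_mod_cast hτ0.ne'
        change (τ : ℂ)⁻¹ * (partialDeriv β F.fn (x + τ • basisVec c) - partialDeriv β F.fn x) -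
          G x = _
        simp only [zero_smul, add_zero, sub_zero, Complex.real_smul]
        field_simp
        ring
      rw [h5, norm_mul, norm_inv, Complex.norm_real, Real.norm_of_nonneg hτ0.le,
        inv_mul_le_iff₀ hτ0]
      refine hmv.trans_eq ?_
      ring
    refine hbound.trans_lt ?_
    rw [hτ, ← mul_div_assoc, div_lt_iff₀ (by positivity)]
    nlinarith

theorem weight_eq_mul_weight (α β : MultiIndex d) :
    weight s σ h₁ α β = ((h₁ : ℝ) / h) ^ (∑ c, (α c + β c)) * weight s σ h α β := by
  have : (h : ℝ) ^ (∑ c, (α c + β c)) ≠ 0 := (pow_pos h.2 _).ne'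
  unfold weight
  rw [div_pow]
  field_simp

/-- For fixed `α` and `β`, zeros of `∂^β F` at the centres of a finite cover of a large ball by small
balls make `x^α ∂^β F` small: a Lipschitz bound controls it in the ball, one more power of `x`
outside. -/
theorem exists_finite_of_partialDeriv_eq_zero (h : Scale) (α β : MultiIndex d) {ε : ℝ}
    (hε : 0 < ε) : ∃ t : Set (Space d), t.Finite ∧ ∀ F : Step d s σ h,
      (∀ x ∈ t, partialDeriv β F.fn x = 0) →
        ∀ x, ‖(monomial α x : ℂ) * partialDeriv β F.fn x‖ ≤ ε * ‖F‖ := by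
  -- where some `|x_c| ≥ R`, the bound for `x^{α + e_c} ∂^β F` suffices
  set R : ℝ := 1 + ∑ c, weight s σ h (α + Pi.single c 1) β / ε with hR
  have hw : ∀ c, 0 ≤ weight s σ h (α + Pi.single c 1) β / ε := fun c =>
    div_nonneg (weight_pos s σ h.2 _ _).le hε.le
  have hR0 : 0 < R := by
    have := Finset.sum_nonneg fun c (_ : c ∈ Finset.univ) => hw c
    linarith
  set R' : ℝ := ∑ _c : Fin 3 × Fin d, R
  have hcont : Continuous fun x : Space d => (monomial α x : ℂ) := by
    unfold monomial
    fun_prop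
  have hcpt := isCompact_closedBall (0 : Space d) R'
  obtain ⟨B, hB⟩ := hcpt.exists_bound_of_continuousOn hcont.continuousOn
  set K := lipWeight s σ h β
  have hK : 0 ≤ K := lipWeight_nonneg _
  set δ : ℝ := ε / ((|B| + 1) * (K + 1)) with hδ
  have hδ0 : 0 < δ := by positivity
  obtain ⟨t, -, htf, htc⟩ := hcpt.finite_cover_balls hδ0
  refine ⟨t, htf, fun F hF x => ?_⟩
  by_cases hx : ∃ c, R ≤ |x c|
  · obtain ⟨c, hc⟩ := hx
    have h1 := F.norm_monomial_mul_partialDeriv_le (α + Pi.single c 1) β x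
    rw [monomial_add_single] at h1
    have h2 : weight s σ h (α + Pi.single c 1) β ≤ ε * R := by
      have := Finset.single_le_sum (fun c _ => hw c) (Finset.mem_univ c)
      rw [← div_le_iff₀' hε]
      linarith
    have h3 : R * ‖(monomial α x : ℂ) * partialDeriv β F.fn x‖ ≤ R * (ε * ‖F‖) := by
      calc R * ‖(monomial α x : ℂ) * partialDeriv β F.fn x‖
          ≤ |x c| * ‖(monomial α x : ℂ) * partialDeriv β F.fn x‖ := by gcongr
        _ ≤ ‖F‖ * weight s σ h (α + Pi.single c 1) β := by
            refine le_trans (le_of_eq ?_) h1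
            push_cast
            simp only [norm_mul, Complex.norm_real, Real.norm_eq_abs]
            ring
        _ ≤ ‖F‖ * (ε * R) := mul_le_mul_of_nonneg_left h2 (norm_nonneg F)
        _ = _ := by ring
    exact le_of_mul_le_mul_left h3 hR0
  · push Not at hx
    have hxb : x ∈ Metric.closedBall (0 : Space d) R' := by
      rw [mem_closedBall_zero_iff]
      conv_lhs => rw [← sum_smul_basisVec x]
      refine (norm_sum_le _ _).trans (Finset.sum_le_sum fun c _ => ?_)
      rw [norm_smul, norm_basisVec, mul_one]
      exact (hx c).le
    obtain ⟨y, hyt, hy⟩ := Set.mem_iUnion₂.1 (htc hxb)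
    have h1 := F.norm_partialDeriv_sub_le β y x
    rw [hF y hyt, sub_zero] at h1
    have h2 : ‖x - y‖ ≤ δ := by
      rw [← dist_eq_norm]
      exact (Metric.mem_ball.1 hy).le
    have hF0 := norm_nonneg F
    rw [norm_mul]
    calc ‖(monomial α x : ℂ)‖ * ‖partialDeriv β F.fn x‖ ≤ (|B| + 1) * ((K + 1) * ‖F‖ * δ) := by
          refine mul_le_mul ?_ (h1.trans ?_) (norm_nonneg _) (by positivity)
          · exact (hB x hxb).trans ((le_abs_self B).trans (by linarith))
          · refine mul_le_mul (mul_le_mul_of_nonneg_right (by linarith) hF0) h2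
              (norm_nonneg _) (by positivity)
      _ = ε * ‖F‖ := by rw [hδ]; field_simp

theorem finite_setOf_sum_lt (N : ℕ) :
    {p : MultiIndex d × MultiIndex d | ∑ c, (p.1 c + p.2 c) < N}.Finite := by
  refine ((Set.finite_Iic (fun _ => N : MultiIndex d)).prod
    (Set.finite_Iic (fun _ => N : MultiIndex d))).subset ?_
  rintro ⟨α, β⟩ hp
  have key : ∀ c, α c + β c < N := fun c =>
    (Finset.single_le_sum (f := fun c => α c + β c) (fun _ _ => Nat.zero_le _)
      (Finset.mem_univ c)).trans_lt hp
  exact ⟨fun c => by have := key c; simp only; omega, fun c => by have := key c; simp only; omega⟩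

/-- The inclusion `𝒮_{s;h₁}^σ → 𝒮_{s;h}^σ` with `h₁ < h` has small norm on the joint kernel of
finitely many functionals `F ↦ ∂^β F(x)`. -/
theorem exists_finite_norm_inclCLM_le (hlt : h₁ < h) {ε : ℝ} (hε : 0 < ε) :
    ∃ t : Set (MultiIndex d × Space d), t.Finite ∧ ∀ F : Step d s σ h₁,
      (∀ p ∈ t, partialDeriv p.1 F.fn p.2 = 0) → ‖Step.inclCLM hlt.le F‖ ≤ ε * ‖F‖ := by
  have hq0 : 0 ≤ (h₁ : ℝ) / h := div_nonneg h₁.2.le h.2.le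
  have hq1 : (h₁ : ℝ) / h < 1 := (div_lt_one h.2).2 hlt
  obtain ⟨N, hN⟩ := exists_pow_lt_of_lt_one hε hq1
  choose t htf ht using fun p : MultiIndex d × MultiIndex d =>
    exists_finite_of_partialDeriv_eq_zero (s := s) (σ := σ) h₁ p.1 p.2
      (mul_pos hε (weight_pos s σ h.2 p.1 p.2))
  refine ⟨⋃ p ∈ {p : MultiIndex d × MultiIndex d | ∑ c, (p.1 c + p.2 c) < N},
    (fun x => (p.2, x)) '' t p, (finite_setOf_sum_lt N).biUnion fun p _ => (htf p).image _,
    fun F hF => ciSup_le ?_⟩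
  have hF0 := norm_nonneg F
  refine quotient_le_of_norm_le h.2 fun α β x => ?_
  have hw := weight_pos s σ h.2 α β
  change ‖(monomial α x : ℂ) * partialDeriv β F.fn x‖ ≤ _
  by_cases hp : ∑ c, (α c + β c) < N
  · refine (ht (α, β) F (fun y hy => hF (β, y) ?_) x).trans_eq (by ring)
    exact Set.mem_biUnion (x := (α, β)) hp ⟨y, hy, rfl⟩
  · have h1 := F.norm_monomial_mul_partialDeriv_le α β x
    rw [weight_eq_mul_weight (h := h)] at h1
    refine h1.trans ?_
    have h2 : ((h₁ : ℝ) / h) ^ (∑ c, (α c + β c)) ≤ ε :=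
      (pow_le_pow_of_le_one hq0 hq1.le (not_lt.1 hp)).trans hN.le
    calc ‖F‖ * (((h₁ : ℝ) / h) ^ (∑ c, (α c + β c)) * weight s σ h α β)
        ≤ ‖F‖ * (ε * weight s σ h α β) := by gcongr
      _ = _ := by ring

/-- Functionals on `𝒮_{s;h}^σ` are approximated by Schwartz functions in the norm of the dual of
`𝒮_{s;h₁}^σ`, if `h₁ < h`. -/
theorem comp_inclCLM_mem_closure (hlt : h₁ < h) (v : StrongDual ℂ (Step d s σ h)) :
    v.comp (Step.inclCLM hlt.le) ∈ closure (Set.range (pairing (d := d) (s := s) (σ := σ) h₁)) := by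
  rw [← coe_schwartzClosure, SetLike.mem_coe]
  refine mem_of_forall_finset_ker isClosed_schwartzClosure fun ε hε => ?_
  have hv : 0 < ‖v‖ + 1 := by positivity
  obtain ⟨t, htf, ht⟩ := exists_finite_norm_inclCLM_le (d := d) (s := s) (σ := σ) hlt
    (div_pos hε hv)
  refine ⟨(fun p => Step.derivAt h₁ p.1 p.2) '' t, htf.image _, ?_, fun F hF => ?_⟩
  · rintro _ ⟨p, -, rfl⟩
    exact derivAt_mem_schwartzClosure p.1 p.2
  · have h1 := ht F fun p hp => hF _ ⟨p, hp, rfl⟩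
    rw [ContinuousLinearMap.comp_apply]
    have hF0 := norm_nonneg F
    calc ‖v (Step.inclCLM hlt.le F)‖ ≤ ‖v‖ * ‖Step.inclCLM hlt.le F‖ := v.le_opNorm _
      _ ≤ (‖v‖ + 1) * (ε / (‖v‖ + 1) * ‖F‖) := by gcongr; linarith
      _ = ε * ‖F‖ := by field_simp

end

section

/-! ### Operators on the Gelfand-Shilov spaces and on their duals -/

variable {s σ : Fin 3 → ℝ} {h h' : Scale} {T S : 𝓢(Space d, ℂ) →L[ℂ] 𝓢(Space d, ℂ)}

/-- Every element of `𝒮_{s;h}^σ` is a Schwartz function. -/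
def Step.toSchwartz : Step d s σ h →ₗ[ℂ] 𝓢(Space d, ℂ) where
  toFun F := (Step.toRoumieu F).toSchwartz
  map_add' _ _ := rfl
  map_smul' _ _ := rfl

theorem Roumieu.toSchwartz_injective :
    Function.Injective (Roumieu.toSchwartz : Roumieu d s σ → 𝓢(Space d, ℂ)) := fun _ _ hFG =>
  Subtype.ext (congrArg (fun f : 𝓢(Space d, ℂ) => (f : Space d → ℂ)) hFG)

theorem Beurling.toSchwartz_injective :
    Function.Injective (Beurling.toSchwartz : Beurling d s σ → 𝓢(Space d, ℂ)) := fun _ _ hFG =>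
  Subtype.ext (congrArg (fun f : 𝓢(Space d, ℂ) => (f : Space d → ℂ)) hFG)

theorem Roumieu.exists_toRoumieu_eq (F : Roumieu d s σ) :
    ∃ (h : Scale) (G : Step d s σ h), Step.toRoumieu G = F := by
  obtain ⟨h, hF⟩ := F.2
  exact ⟨h, ⟨F.1, hF⟩, rfl⟩

theorem BoundedBetween.mem_stepSubmodule (hT : BoundedBetween s σ h h' T) (F : Step d s σ h) :
    ⇑(T F.toSchwartz) ∈ stepSubmodule d s σ h' := by
  obtain ⟨C, -, hC⟩ := hT
  refine ⟨(T F.toSchwartz).smooth', C * ‖F‖, ?_⟩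
  rintro _ ⟨p, rfl⟩
  exact hC F.toSchwartz ‖F‖ F.quotient_le p

/-- The bounded operator `𝒮_{s;h}^σ → 𝒮_{s;h'}^σ` induced by `T`. -/
def BoundedBetween.stepMap (hT : BoundedBetween s σ h h' T) : Step d s σ h →L[ℂ] Step d s σ h' :=
  LinearMap.mkContinuousOfExistsBound
    { toFun := fun F => ⟨T F.toSchwartz, hT.mem_stepSubmodule F⟩
      map_add' := fun F G => Subtype.ext <|
        congrArg (fun f : 𝓢(Space d, ℂ) => ⇑f) (T.map_add F.toSchwartz G.toSchwartz)
      map_smul' := fun a F => Subtype.ext <|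
        congrArg (fun f : 𝓢(Space d, ℂ) => ⇑f) (T.map_smul a F.toSchwartz) } <| by
    obtain ⟨C, -, hC⟩ := hT
    exact ⟨C, fun F => ciSup_le fun p => hC F.toSchwartz ‖F‖ F.quotient_le p⟩

section Roumieu

/-- `T` maps every `𝒮_{s;h}^σ` boundedly into some `𝒮_{s;h'}^σ`. -/
def RoumieuBounded (s σ : Fin 3 → ℝ) (T : 𝓢(Space d, ℂ) →L[ℂ] 𝓢(Space d, ℂ)) : Prop :=
  ∀ h : Scale, ∃ h' : Scale, BoundedBetween s σ h h' T

theorem RoumieuBounded.mem_roumieuSubmodule (hT : RoumieuBounded s σ T) (F : Roumieu d s σ) :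
    ⇑(T F.toSchwartz) ∈ roumieuSubmodule d s σ := by
  obtain ⟨h, G, rfl⟩ := F.exists_toRoumieu_eq
  obtain ⟨h', hT'⟩ := hT h
  exact ⟨h', hT'.mem_stepSubmodule G⟩

/-- The continuous restriction of `T` to `𝒮_s^σ`. -/
def RoumieuBounded.map (hT : RoumieuBounded s σ T) : Roumieu d s σ →L[ℂ] Roumieu d s σ :=
  let A : Roumieu d s σ →ₗ[ℂ] Roumieu d s σ :=
    { toFun := fun F => ⟨T F.toSchwartz, hT.mem_roumieuSubmodule F⟩
      map_add' := fun F G => Subtype.ext <|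
        congrArg (fun f : 𝓢(Space d, ℂ) => ⇑f) (T.map_add F.toSchwartz G.toSchwartz)
      map_smul' := fun a F => Subtype.ext <|
        congrArg (fun f : 𝓢(Space d, ℂ) => ⇑f) (T.map_smul a F.toSchwartz) }
  ⟨A, continuous_of_inductiveTopology
    (fun h : Scale => ⇑(Step.toRoumieu : Step d s σ h →ₗ[ℂ] Roumieu d s σ)) A fun h => by
      obtain ⟨h', hT'⟩ := hT h
      exact (Step.toRoumieuCLM.comp hT'.stepMap).continuous⟩

theorem RoumieuBounded.toSchwartz_map (hT : RoumieuBounded s σ T) (F : Roumieu d s σ) :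
    (hT.map F).toSchwartz = T F.toSchwartz := rfl

/-- The transpose of the restriction of `T` to `𝒮_s^σ`. -/
def RoumieuBounded.dualMap (hT : RoumieuBounded s σ T) :
    RoumieuDual d s σ →L[ℂ] RoumieuDual d s σ where
  toFun u := ContinuousLinearMap.comp (show Roumieu d s σ →L[ℂ] ℂ from u) hT.map
  map_add' _ _ := rfl
  map_smul' _ _ := rfl
  cont := by
    refine continuous_iInf_rng.2 fun h => continuous_induced_rng.2 ?_
    obtain ⟨h', hT'⟩ := hT h
    have h1 : Continuous
        (RoumieuDual.restrict h' : RoumieuDual d s σ →ₗ[ℂ] StrongDual ℂ (Step d s σ h')) :=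
      continuous_iInf_dom continuous_induced_dom
    exact h1.clm_comp (continuous_const (y := hT'.stepMap))

theorem RoumieuDual.ext {u v : RoumieuDual d s σ}
    (huv : ∀ F, (show Roumieu d s σ →L[ℂ] ℂ from u) F = (show Roumieu d s σ →L[ℂ] ℂ from v) F) :
    u = v :=
  ContinuousLinearMap.ext huv

theorem RoumieuBounded.dualMap_apply (hT : RoumieuBounded s σ T) (u : RoumieuDual d s σ)
    (F : Roumieu d s σ) :
    (show Roumieu d s σ →L[ℂ] ℂ from hT.dualMap u) F =
      (show Roumieu d s σ →L[ℂ] ℂ from u) (hT.map F) := rfl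

theorem RoumieuBounded.dualMap_toRoumieuDual (hT : RoumieuBounded s σ T)
    (hsymm : ∀ f g : 𝓢(Space d, ℂ), ∫ x, T f x * g x = ∫ x, f x * T g x) (f : 𝓢(Space d, ℂ)) :
    hT.dualMap (toRoumieuDual f) = toRoumieuDual (T f) :=
  RoumieuDual.ext fun F => by
    rw [hT.dualMap_apply, toRoumieuDual_apply, toRoumieuDual_apply, hT.toSchwartz_map, hsymm]

instance : T2Space (RoumieuDual d s σ) := by
  refine T2Space.of_injective_continuous
    (f := fun (u : RoumieuDual d s σ) F => (show Roumieu d s σ →L[ℂ] ℂ from u) F)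
    (fun u v huv => RoumieuDual.ext (congrFun huv)) (continuous_pi fun F => ?_)
  obtain ⟨h, G, rfl⟩ := F.exists_toRoumieu_eq
  have h1 : Continuous
      (RoumieuDual.restrict h : RoumieuDual d s σ →ₗ[ℂ] StrongDual ℂ (Step d s σ h)) :=
    continuous_iInf_dom continuous_induced_dom
  exact h1.clm_apply (continuous_const (y := G))

/-- A basic neighbourhood of `u` only involves the restriction of `u` to one step space, which
extends to a larger step space. -/
theorem denseRange_toRoumieuDual :
    DenseRange (toRoumieuDual : 𝓢(Space d, ℂ) → RoumieuDual d s σ) := by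
  intro u
  rw [mem_closure_iff_nhds]
  intro V hV
  have hn : nhds u = ⨅ h : Scale, Filter.comap
      (RoumieuDual.restrict h : RoumieuDual d s σ →ₗ[ℂ] StrongDual ℂ (Step d s σ h))
      (nhds (RoumieuDual.restrict h u)) := by
    simp only [← nhds_induced]
    exact nhds_iInf
  have hdir : Directed (· ≥ ·) fun h : Scale => Filter.comap
      (RoumieuDual.restrict h : RoumieuDual d s σ →ₗ[ℂ] StrongDual ℂ (Step d s σ h))
      (nhds (RoumieuDual.restrict h u)) := by
    refine Antitone.directed_ge fun h₁ h hle => ?_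
    have hc : Continuous fun v : StrongDual ℂ (Step d s σ h) => v.comp (Step.inclCLM hle) :=
      continuous_id.clm_comp continuous_const
    exact Filter.tendsto_iff_comap.1
      ((hc.tendsto (RoumieuDual.restrict h u)).comp Filter.tendsto_comap)
  have : Nonempty Scale := ⟨⟨1, one_pos⟩⟩
  rw [hn, Filter.mem_iInf_of_directed hdir] at hV
  obtain ⟨h, t, ht, htV⟩ := hV
  have hlt : h < ⟨h + 1, by linarith [h.2]⟩ := lt_add_one h.1
  obtain ⟨_, hft, f, rfl⟩ := mem_closure_iff_nhds.1
    (comp_inclCLM_mem_closure hlt (RoumieuDual.restrict _ u)) t ht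
  exact ⟨_, htV hft, f, rfl⟩

/-- An invertible symmetric operator that is bounded in the sense of Roumieu together with its
inverse acts on `𝒮_s^σ` and on its dual. -/
theorem exists_roumieu_equiv (hT : RoumieuBounded s σ T) (hS : RoumieuBounded s σ S)
    (hST : ∀ f, S (T f) = f) (hTS : ∀ f, T (S f) = f)
    (hsymm : ∀ f g : 𝓢(Space d, ℂ), ∫ x, T f x * g x = ∫ x, f x * T g x) :
    (∃ A : Roumieu d s σ ≃L[ℂ] Roumieu d s σ, ∀ F, (A F).toSchwartz = T F.toSchwartz) ∧
    ∃ A : RoumieuDual d s σ ≃L[ℂ] RoumieuDual d s σ,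
      (∀ f, A (toRoumieuDual f) = toRoumieuDual (T f)) ∧
      ∀ A' : RoumieuDual d s σ → RoumieuDual d s σ, Continuous A' →
        (∀ f, A' (toRoumieuDual f) = toRoumieuDual (T f)) → A' = ⇑A := by
  have h1 : ∀ F, hS.map (hT.map F) = F := fun F => Roumieu.toSchwartz_injective <| by
    rw [hS.toSchwartz_map, hT.toSchwartz_map, hST]
  have h2 : ∀ F, hT.map (hS.map F) = F := fun F => Roumieu.toSchwartz_injective <| by
    rw [hT.toSchwartz_map, hS.toSchwartz_map, hTS]
  refine ⟨⟨.equivOfInverse hT.map hS.map h1 h2, fun F => rfl⟩,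
    .equivOfInverse hT.dualMap hS.dualMap
      (fun u => RoumieuDual.ext fun F => by rw [hS.dualMap_apply, hT.dualMap_apply, h2])
      (fun u => RoumieuDual.ext fun F => by rw [hT.dualMap_apply, hS.dualMap_apply, h1]),
    hT.dualMap_toRoumieuDual hsymm, fun A' hA' hA'T => ?_⟩
  refine denseRange_toRoumieuDual.equalizer hA' (ContinuousLinearEquiv.continuous _) ?_
  funext f
  exact (hA'T f).trans (hT.dualMap_toRoumieuDual hsymm f).symm

end Roumieu

section Beurling

/-- For every `h'`, `T` maps some `𝒮_{s;h}^σ` boundedly into `𝒮_{s;h'}^σ`. -/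
def BeurlingBounded (s σ : Fin 3 → ℝ) (T : 𝓢(Space d, ℂ) →L[ℂ] 𝓢(Space d, ℂ)) : Prop :=
  ∀ h' : Scale, ∃ h : Scale, BoundedBetween s σ h h' T

theorem BeurlingBounded.mem_beurlingSubmodule (hT : BeurlingBounded s σ T) (F : Beurling d s σ) :
    ⇑(T F.toSchwartz) ∈ beurlingSubmodule d s σ :=
  (Submodule.mem_iInf _).2 fun h' =>
    let ⟨h, hT'⟩ := hT h'
    hT'.mem_stepSubmodule (Beurling.toStep h F)

/-- The continuous restriction of `T` to `Σ_s^σ`. -/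
def BeurlingBounded.map (hT : BeurlingBounded s σ T) : Beurling d s σ →L[ℂ] Beurling d s σ where
  toFun F := ⟨T F.toSchwartz, hT.mem_beurlingSubmodule F⟩
  map_add' F G := Subtype.ext <|
    congrArg (fun f : 𝓢(Space d, ℂ) => ⇑f) (T.map_add F.toSchwartz G.toSchwartz)
  map_smul' a F := Subtype.ext <|
    congrArg (fun f : 𝓢(Space d, ℂ) => ⇑f) (T.map_smul a F.toSchwartz)
  cont := by
    refine continuous_iInf_rng.2 fun h' => continuous_induced_rng.2 ?_
    obtain ⟨h, hT'⟩ := hT h'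
    exact (hT'.stepMap.comp (Beurling.toStepCLM h)).continuous

theorem BeurlingBounded.toSchwartz_map (hT : BeurlingBounded s σ T) (F : Beurling d s σ) :
    (hT.map F).toSchwartz = T F.toSchwartz := rfl

theorem BeurlingDual.continuous_ofStepDual (h : Scale) : Continuous
    (BeurlingDual.ofStepDual h : StrongDual ℂ (Step d s σ h) →ₗ[ℂ] BeurlingDual d s σ) :=
  continuous_inductiveTopology (fun h : Scale =>
    ⇑(BeurlingDual.ofStepDual h : StrongDual ℂ (Step d s σ h) →ₗ[ℂ] BeurlingDual d s σ)) h

instance : LocallyConvexSpace ℝ (BeurlingDual d s σ) := .sInf fun _ ht => ht.2.2.2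

/-- The transpose of the restriction of `T` to `Σ_s^σ`. -/
def BeurlingBounded.dualMap (hT : BeurlingBounded s σ T) :
    BeurlingDual d s σ →L[ℂ] BeurlingDual d s σ :=
  let A : BeurlingDual d s σ →ₗ[ℂ] BeurlingDual d s σ :=
    { toFun := fun u => ContinuousLinearMap.comp (show Beurling d s σ →L[ℂ] ℂ from u) hT.map
      map_add' := fun _ _ => rfl
      map_smul' := fun _ _ => rfl }
  ⟨A, continuous_of_inductiveTopology (fun h : Scale =>
    ⇑(BeurlingDual.ofStepDual h : StrongDual ℂ (Step d s σ h) →ₗ[ℂ] BeurlingDual d s σ)) A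
    fun h' => by
      obtain ⟨h, hT'⟩ := hT h'
      exact (BeurlingDual.continuous_ofStepDual h).comp
        (continuous_id.clm_comp (continuous_const (y := hT'.stepMap)))⟩

theorem BeurlingDual.ext {u v : BeurlingDual d s σ}
    (huv : ∀ F, (show Beurling d s σ →L[ℂ] ℂ from u) F = (show Beurling d s σ →L[ℂ] ℂ from v) F) :
    u = v :=
  ContinuousLinearMap.ext huv

theorem BeurlingBounded.dualMap_apply (hT : BeurlingBounded s σ T) (u : BeurlingDual d s σ)
    (F : Beurling d s σ) :
    (show Beurling d s σ →L[ℂ] ℂ from hT.dualMap u) F =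
      (show Beurling d s σ →L[ℂ] ℂ from u) (hT.map F) := rfl

theorem BeurlingBounded.dualMap_toBeurlingDual (hT : BeurlingBounded s σ T)
    (hsymm : ∀ f g : 𝓢(Space d, ℂ), ∫ x, T f x * g x = ∫ x, f x * T g x) (f : 𝓢(Space d, ℂ)) :
    hT.dualMap (toBeurlingDual f) = toBeurlingDual (T f) :=
  BeurlingDual.ext fun F => by
    rw [hT.dualMap_apply, toBeurlingDual_apply, toBeurlingDual_apply, hT.toSchwartz_map, hsymm]

instance : T2Space (BeurlingDual d s σ) := by
  refine T2Space.of_injective_continuous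
    (f := fun (u : BeurlingDual d s σ) F => (show Beurling d s σ →L[ℂ] ℂ from u) F)
    (fun u v huv => BeurlingDual.ext (congrFun huv)) (continuous_pi fun F => ?_)
  let ev : BeurlingDual d s σ →ₗ[ℂ] ℂ :=
    { toFun := fun u => (show Beurling d s σ →L[ℂ] ℂ from u) F
      map_add' := fun _ _ => rfl
      map_smul' := fun _ _ => rfl }
  exact continuous_of_inductiveTopology (fun h : Scale =>
    ⇑(BeurlingDual.ofStepDual h : StrongDual ℂ (Step d s σ h) →ₗ[ℂ] BeurlingDual d s σ)) ev
    fun h => continuous_id.clm_apply (continuous_const (y := Beurling.toStep h F))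

/-- A continuous functional on `Σ_s^σ` is bounded for one of the norms, and it extends to the
corresponding `𝒮_{s;h}^σ` by the Hahn-Banach theorem. -/
theorem BeurlingDual.exists_ofStepDual_eq (u : BeurlingDual d s σ) :
    ∃ (h : Scale) (v : StrongDual ℂ (Step d s σ h)), BeurlingDual.ofStepDual h v = u := by
  let u' : Beurling d s σ →L[ℂ] ℂ := u
  have hn : nhds (0 : Beurling d s σ) = ⨅ h : Scale, Filter.comap
      (Beurling.toStep h : Beurling d s σ →ₗ[ℂ] Step d s σ h) (nhds (Beurling.toStep h 0)) := by
    simp only [← nhds_induced]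
    exact nhds_iInf
  have hdir : Directed (· ≥ ·) fun h : Scale => Filter.comap
      (Beurling.toStep h : Beurling d s σ →ₗ[ℂ] Step d s σ h) (nhds (Beurling.toStep h 0)) := by
    refine Monotone.directed_ge fun h₁ h hle => ?_
    exact Filter.tendsto_iff_comap.1 (((Step.inclCLM hle).continuous.tendsto
      (Beurling.toStep h₁ 0)).comp Filter.tendsto_comap)
  have : Nonempty Scale := ⟨⟨1, one_pos⟩⟩
  have hV : {F | ‖u' F‖ ≤ 1} ∈ nhds (0 : Beurling d s σ) := by
    have h1 : Filter.Tendsto (fun F => ‖u' F‖) (nhds 0) (nhds 0) := by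
      simpa using u'.continuous.norm.tendsto 0
    exact h1 (Iic_mem_nhds one_pos)
  rw [hn, Filter.mem_iInf_of_directed hdir] at hV
  obtain ⟨h, t, ht, htV⟩ := hV
  rw [map_zero] at ht
  obtain ⟨δ, hδ, hδt⟩ := Metric.nhds_basis_closedBall.mem_iff.1 ht
  have hinj : Function.Injective (Beurling.toStep h : Beurling d s σ →ₗ[ℂ] Step d s σ h) :=
    Submodule.inclusion_injective _
  let e := LinearEquiv.ofInjective (Beurling.toStep h : Beurling d s σ →ₗ[ℂ] Step d s σ h) hinj
  let w : LinearMap.range (Beurling.toStep h : Beurling d s σ →ₗ[ℂ] Step d s σ h) →ₗ[ℂ] ℂ :=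
    (u' : Beurling d s σ →ₗ[ℂ] ℂ).comp e.symm.toLinearMap
  have hw : ∀ F, w (e F) = u' F := fun F => congrArg u' (e.symm_apply_apply F)
  have hball : ∀ z ∈ Metric.closedBall 0 δ, ‖w z‖ ≤ 1 := by
    intro z hz
    obtain ⟨F, rfl⟩ := e.surjective z
    rw [hw]
    refine htV (hδt ?_)
    rw [mem_closedBall_zero_iff] at hz ⊢
    exact hz
  obtain ⟨v, hv, -⟩ := exists_extension_norm_eq
    (LinearMap.range (Beurling.toStep h : Beurling d s σ →ₗ[ℂ] Step d s σ h))
    (w.mkContinuous (1 / δ) (LinearMap.bound_of_ball_bound' hδ 1 w hball))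
  exact ⟨h, v, BeurlingDual.ext fun F => (hv (e F)).trans (hw F)⟩

/-- A functional on `Σ_s^σ` comes from some step space, so it is approximated in the dual of a
smaller one. -/
theorem denseRange_toBeurlingDual :
    DenseRange (toBeurlingDual : 𝓢(Space d, ℂ) → BeurlingDual d s σ) := by
  intro u
  obtain ⟨h, v, rfl⟩ := u.exists_ofStepDual_eq
  have hlt : (⟨h / 2, half_pos h.2⟩ : Scale) < h := half_lt_self h.2
  have hmaps : Set.MapsTo (BeurlingDual.ofStepDual ⟨h / 2, half_pos h.2⟩)
      (Set.range (pairing (d := d) (s := s) (σ := σ) ⟨h / 2, half_pos h.2⟩))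
      (Set.range toBeurlingDual) := by
    rintro _ ⟨f, rfl⟩
    exact ⟨f, rfl⟩
  have h1 := map_mem_closure (BeurlingDual.continuous_ofStepDual _)
    (comp_inclCLM_mem_closure hlt v) hmaps
  exact h1

/-- An invertible symmetric operator that is bounded in the sense of Beurling together with its
inverse acts on `Σ_s^σ` and on its dual. -/
theorem exists_beurling_equiv (hT : BeurlingBounded s σ T) (hS : BeurlingBounded s σ S)
    (hST : ∀ f, S (T f) = f) (hTS : ∀ f, T (S f) = f)
    (hsymm : ∀ f g : 𝓢(Space d, ℂ), ∫ x, T f x * g x = ∫ x, f x * T g x) :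
    (∃ A : Beurling d s σ ≃L[ℂ] Beurling d s σ, ∀ F, (A F).toSchwartz = T F.toSchwartz) ∧
    ∃ A : BeurlingDual d s σ ≃L[ℂ] BeurlingDual d s σ,
      (∀ f, A (toBeurlingDual f) = toBeurlingDual (T f)) ∧
      ∀ A' : BeurlingDual d s σ → BeurlingDual d s σ, Continuous A' →
        (∀ f, A' (toBeurlingDual f) = toBeurlingDual (T f)) → A' = ⇑A := by
  have h1 : ∀ F, hS.map (hT.map F) = F := fun F => Beurling.toSchwartz_injective <| by
    rw [hS.toSchwartz_map, hT.toSchwartz_map, hST]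
  have h2 : ∀ F, hT.map (hS.map F) = F := fun F => Beurling.toSchwartz_injective <| by
    rw [hT.toSchwartz_map, hS.toSchwartz_map, hTS]
  refine ⟨⟨.equivOfInverse hT.map hS.map h1 h2, fun F => rfl⟩,
    .equivOfInverse hT.dualMap hS.dualMap
      (fun u => BeurlingDual.ext fun F => by rw [hS.dualMap_apply, hT.dualMap_apply, h2])
      (fun u => BeurlingDual.ext fun F => by rw [hT.dualMap_apply, hS.dualMap_apply, h1]),
    hT.dualMap_toBeurlingDual hsymm, fun A' hA' hA'T => ?_⟩
  refine denseRange_toBeurlingDual.equalizer hA' (ContinuousLinearEquiv.continuous _) ?_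
  funext f
  exact (hA'T f).trans (hT.dualMap_toBeurlingDual hsymm f).symm

/-- If `Σ_s^σ` is trivial, so is its dual, and the identity maps serve as the homeomorphisms. -/
theorem exists_beurling_equiv_of_subsingleton [Subsingleton (Beurling d s σ)] :
    (∃ A : Beurling d s σ ≃L[ℂ] Beurling d s σ, ∀ F, (A F).toSchwartz = T F.toSchwartz) ∧
    ∃ A : BeurlingDual d s σ ≃L[ℂ] BeurlingDual d s σ,
      (∀ f, A (toBeurlingDual f) = toBeurlingDual (T f)) ∧
      ∀ A' : BeurlingDual d s σ → BeurlingDual d s σ, Continuous A' →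
        (∀ f, A' (toBeurlingDual f) = toBeurlingDual (T f)) → A' = ⇑A := by
  have hD : Subsingleton (BeurlingDual d s σ) := ⟨fun u v => BeurlingDual.ext fun F => by
    rw [Subsingleton.elim F 0, map_zero, map_zero]⟩
  refine ⟨⟨.refl ℂ _, fun F => ?_⟩, .refl ℂ _, fun f => Subsingleton.elim _ _,
    fun A' _ _ => Subsingleton.elim _ _⟩
  have hF : F.toSchwartz = 0 := by
    rw [Subsingleton.elim F 0]
    rfl
  change F.toSchwartz = T F.toSchwartz
  rw [hF, map_zero]

end Beurling

/-! ### The operator on Gelfand-Shilov spaces -/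

theorem Admissible.roumieuBounded_expOp (H : Admissible s σ) (r t : ℝ) :
    RoumieuBounded s σ (expOp (d := d) r t) := fun h =>
  let ⟨h', hh', hT⟩ := H.exists_boundedBetween_expOp r t h.2
  ⟨⟨h', hh'⟩, hT⟩

theorem Admissible.beurlingBounded_expOp (H : Admissible s σ)
    (h1 : ∀ c : Fin 3 × Fin d, 1 < s c.1 + σ c.1) (r t : ℝ) :
    BeurlingBounded s σ (expOp (d := d) r t) := fun h' =>
  let ⟨h, hh, hT⟩ := H.exists_boundedBetween_expOp' h1 r t h'.2
  ⟨⟨h, hh⟩, hT⟩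

theorem expOp_neg_expOp (r t : ℝ) (f : 𝓢(Space d, ℂ)) : expOp (-r) (-t) (expOp r t f) = f := by
  rw [expOp_expOp, neg_add_cancel, neg_add_cancel, expOp_zero_zero]

theorem expOp_expOp_neg (r t : ℝ) (f : 𝓢(Space d, ℂ)) : expOp r t (expOp (-r) (-t) f) = f := by
  rw [expOp_expOp, add_neg_cancel, add_neg_cancel, expOp_zero_zero]

end

end GelfandShilov

end

theorem mainTheorem1 (d : ℕ) (s₁ s₂ s₃ σ₁ σ₂ σ₃ r t : ℝ)
    (h₁ : 1 ≤ s₁ + σ₁) (h₂ : 1 ≤ s₂ + σ₂) (h₃ : 1 ≤ s₃ + σ₃)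
    (hs₂ : 0 < s₂) (hs₂₁ : s₂ ≤ s₁) (hs₃ : 0 < s₃) (hs₃₁ : s₃ ≤ s₁)
    (hσ₁ : 0 < σ₁) (hσ₁₂ : σ₁ ≤ σ₂) (hσ₁₃ : σ₁ ≤ σ₃)
    (hr : r ∈ Set.Icc (0 : ℝ) 1) (ht : t ∈ Set.Icc (0 : ℝ) 1) (hrt : r + t ≤ 1) :
    ((∃ T : GelfandShilov.Roumieu d ![s₁, σ₂, σ₃] ![σ₁, s₂, s₃] ≃L[ℂ]
          GelfandShilov.Roumieu d ![s₁, σ₂, σ₃] ![σ₁, s₂, s₃],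
        ∀ F, (T F).toSchwartz = GelfandShilov.expOp r t F.toSchwartz) ∧
      (∃ T : GelfandShilov.RoumieuDual d ![s₁, σ₂, σ₃] ![σ₁, s₂, s₃] ≃L[ℂ]
          GelfandShilov.RoumieuDual d ![s₁, σ₂, σ₃] ![σ₁, s₂, s₃],
        (∀ f, T (GelfandShilov.toRoumieuDual f) =
          GelfandShilov.toRoumieuDual (GelfandShilov.expOp r t f)) ∧
        ∀ T' : GelfandShilov.RoumieuDual d ![s₁, σ₂, σ₃] ![σ₁, s₂, s₃] →
            GelfandShilov.RoumieuDual d ![s₁, σ₂, σ₃] ![σ₁, s₂, s₃],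
          Continuous T' →
          (∀ f, T' (GelfandShilov.toRoumieuDual f) =
            GelfandShilov.toRoumieuDual (GelfandShilov.expOp r t f)) →
          T' = ⇑T)) ∧
    ((s₁, σ₁) ≠ (1 / 2, 1 / 2) → (s₂, σ₂) ≠ (1 / 2, 1 / 2) → (s₃, σ₃) ≠ (1 / 2, 1 / 2) →
      (∃ T : GelfandShilov.Beurling d ![s₁, σ₂, σ₃] ![σ₁, s₂, s₃] ≃L[ℂ]
          GelfandShilov.Beurling d ![s₁, σ₂, σ₃] ![σ₁, s₂, s₃],
        ∀ F, (T F).toSchwartz = GelfandShilov.expOp r t F.toSchwartz) ∧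
      (∃ T : GelfandShilov.BeurlingDual d ![s₁, σ₂, σ₃] ![σ₁, s₂, s₃] ≃L[ℂ]
          GelfandShilov.BeurlingDual d ![s₁, σ₂, σ₃] ![σ₁, s₂, s₃],
        (∀ f, T (GelfandShilov.toBeurlingDual f) =
          GelfandShilov.toBeurlingDual (GelfandShilov.expOp r t f)) ∧
        ∀ T' : GelfandShilov.BeurlingDual d ![s₁, σ₂, σ₃] ![σ₁, s₂, s₃] →
            GelfandShilov.BeurlingDual d ![s₁, σ₂, σ₃] ![σ₁, s₂, s₃],
          Continuous T' →
          (∀ f, T' (GelfandShilov.toBeurlingDual f) =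
            GelfandShilov.toBeurlingDual (GelfandShilov.expOp r t f)) →
          T' = ⇑T)) := by
  have H : GelfandShilov.Admissible ![s₁, σ₂, σ₃] ![σ₁, s₂, s₃] := by
    constructor
    · intro j; fin_cases j <;> simp <;> linarith
    · intro j; fin_cases j <;> simp <;> linarith
    · intro j; fin_cases j <;> simp <;> linarith
    all_goals simpa
  have hST := GelfandShilov.expOp_neg_expOp (d := d) r t
  have hTS := GelfandShilov.expOp_expOp_neg (d := d) r t
  have hsymm := GelfandShilov.integral_expOp_mul (d := d) r t
  refine ⟨GelfandShilov.exists_roumieu_equiv (H.roumieuBounded_expOp r t)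
    (H.roumieuBounded_expOp (-r) (-t)) hST hTS hsymm, fun _ _ _ => ?_⟩
  by_cases h1 : ∀ c : Fin 3 × Fin d, 1 < (![s₁, σ₂, σ₃] : Fin 3 → ℝ) c.1 + ![σ₁, s₂, s₃] c.1
  · exact GelfandShilov.exists_beurling_equiv (H.beurlingBounded_expOp h1 r t)
      (H.beurlingBounded_expOp h1 (-r) (-t)) hST hTS hsymm
  · push Not at h1
    obtain ⟨c, hc⟩ := h1
    have : Subsingleton (GelfandShilov.Beurling d ![s₁, σ₂, σ₃] ![σ₁, s₂, s₃]) :=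
      subsingleton_of_forall_eq 0 <| GelfandShilov.Beurling.eq_zero_of_critical c (H.pos c.1)
        (H.pos' c.1).le (le_antisymm hc (H.one_le c.1))
    exact GelfandShilov.exists_beurling_equiv_of_subsingleton
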